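/- For a graph $G$ on the vertex set $V=\{0,\dots,n-1\}$ and a bijection $\pi:V\to\{0,\dots,n-1\}$ (an order on $V$), the greedy MIS of $G$ with respect to $\pi$ is the set obtained by scanning the vertices in increasing order of $\pi$, starting from the empty set, and adding a vertex whenever it has no neighbour in the set built so far. Theorem. There are a deterministic word-RAM algorithm, consisting of one preprocessing program and one update program that do not depend on $n$, and constants $c,d,C$ such that the following holds for every $n$ and every word length $w\ge c\log_2(n+2)$. Let $G_0$ be a graph on $V$ and let $\sigma_0,\dots,\sigma_{m-1}$ be any sequence of edge updates leading through graphs $G_0,G_1,\dots,G_m$, where each $\sigma_i$ either inserts an edge that is absent from $G_i$ or deletes an edge that is present in $G_i$. The sequence is fixed before $\pi$ is drawn (oblivious adversary). Given $n$, an order $\pi$ and the adjacency matrix of $G_0$, the algorithm first performs preprocessing and then receives the updates one by one. For every $\pi$ all of its runs halt, preprocessing takes at most $(n+2)^d$ steps, and the characteristic vector of the greedy MIS of the current graph with respect to $\pi$ is stored in memory after preprocessing and after each update. If $T_i(\pi)$ denotes the number of steps that the algorithm spends on update $\sigma_i$, then for a uniformly random permutation $\pi$ of $V$, $$\mathbb{E}_\pi[T_i(\pi)]\le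 C\,(\log n)^4\qquad\text{for every } 0\le i<m .$$ -/

import Mathlib

/-! ## A word RAM with a step count

The machine has words of `w` bits, registers `0, 1, 2, …` and memory segments `0, 1, 2, …`, each
segment being an array of words addressed by words. A program is a fixed finite text, so it names
only finitely many registers and segments. Arithmetic is modulo `2 ^ w`, and every operation,
constant, register access and memory access costs one step. -/

namespace WordRAM

/-- The content of the registers and of the memory segments. -/
structure State where
  reg : ℕ → ℕ
  mem : ℕ → ℕ → ℕ

/-- The unit-cost operations on words. -/
inductive Op
  | add | sub | mul | div | mod | lt | eq

/-- Value of an operation on `w`-bit words; comparisons return `1` for true and `0` for false. -/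
def Op.eval (w : ℕ) : Op → ℕ → ℕ → ℕ
  | .add, a, b => (a + b) % 2 ^ w
  | .sub, a, b => (a + 2 ^ w - b) % 2 ^ w
  | .mul, a, b => (a * b) % 2 ^ w
  | .div, a, b => (a / b) % 2 ^ w
  | .mod, a, b => (a % b) % 2 ^ w
  | .lt, a, b => if a < b then 1 else 0
  | .eq, a, b => if a = b then 1 else 0

/-- Expressions: constants, registers, indirect memory reads, operations. -/
inductive Expr
  | lit (k : ℕ)
  | reg (x : ℕ)
  | load (a : ℕ) (i : Expr)
  | op (o : Op) (e₁ e₂ : Expr)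

/-- The word that an expression denotes in a given state. -/
def Expr.eval (w : ℕ) (s : State) : Expr → ℕ
  | .lit k => k % 2 ^ w
  | .reg x => s.reg x
  | .load a i => s.mem a (i.eval w s)
  | .op o e₁ e₂ => o.eval w (e₁.eval w s) (e₂.eval w s)

/-- The number of steps needed to evaluate an expression. -/
def Expr.cost : Expr → ℕ
  | .lit _ => 1
  | .reg _ => 1
  | .load _ i => i.cost + 1
  | .op _ e₁ e₂ => e₁.cost + e₂.cost + 1

/-- Programs. -/
inductive Prog
  | nop
  | assign (x : ℕ) (e : Expr)
  | store (a : ℕ) (i e : Expr)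
  | seq (p q : Prog)
  | cond (e : Expr) (p q : Prog)
  | loop (e : Expr) (p : Prog)

/-- Write the value `k` into register `x`. -/
def State.setReg (s : State) (x k : ℕ) : State :=
  { s with reg := Function.update s.reg x k }

/-- Write the value `k` into cell `i` of segment `a`. -/
def State.setMem (s : State) (a i k : ℕ) : State :=
  { s with mem := Function.update s.mem a (Function.update (s.mem a) i k) }

/-- `Exec w p s t s'`: on a machine with `w`-bit words, program `p` started in state `s` halts
after exactly `t` steps in state `s'`. -/
inductive Exec (w : ℕ) : Prog → State → ℕ → State → Prop
  | nop (s : State) : Exec w .nop s 1 s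
  | assign (x : ℕ) (e : Expr) (s : State) :
      Exec w (.assign x e) s (e.cost + 1) (s.setReg x (e.eval w s))
  | store (a : ℕ) (i e : Expr) (s : State) :
      Exec w (.store a i e) s (i.cost + e.cost + 1) (s.setMem a (i.eval w s) (e.eval w s))
  | seq {p q : Prog} {s s' s'' : State} {t t' : ℕ} :
      Exec w p s t s' → Exec w q s' t' s'' → Exec w (.seq p q) s (t + t') s''
  | cond_true {e : Expr} {p q : Prog} {s s' : State} {t : ℕ} :
      e.eval w s ≠ 0 → Exec w p s t s' → Exec w (.cond e p q) s (e.cost + 1 + t) s'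
  | cond_false {e : Expr} {p q : Prog} {s s' : State} {t : ℕ} :
      e.eval w s = 0 → Exec w q s t s' → Exec w (.cond e p q) s (e.cost + 1 + t) s'
  | loop_exit {e : Expr} {p : Prog} {s : State} :
      e.eval w s = 0 → Exec w (.loop e p) s (e.cost + 1) s
  | loop_step {e : Expr} {p : Prog} {s s' s'' : State} {t t' : ℕ} :
      e.eval w s ≠ 0 → Exec w p s t s' → Exec w (.loop e p) s' t' s'' →
        Exec w (.loop e p) s (e.cost + 1 + t + t') s''

/-- The machine is deterministic: a program and a start state determine the running time and the
final state. -/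
theorem Exec.deterministic {w : ℕ} {p : Prog} {s s₁ s₂ : State} {t₁ t₂ : ℕ}
    (h₁ : Exec w p s t₁ s₁) (h₂ : Exec w p s t₂ s₂) : t₁ = t₂ ∧ s₁ = s₂ := by
  induction h₁ generalizing t₂ s₂ with
  | nop s => cases h₂; exact ⟨rfl, rfl⟩
  | assign x e s => cases h₂; exact ⟨rfl, rfl⟩
  | store a i e s => cases h₂; exact ⟨rfl, rfl⟩
  | seq _ _ ih₁ ih₂ =>
    cases h₂ with
    | seq h h' =>
      obtain ⟨rfl, rfl⟩ := ih₁ h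
      obtain ⟨rfl, rfl⟩ := ih₂ h'
      exact ⟨rfl, rfl⟩
  | cond_true hc _ ih =>
    cases h₂ with
    | cond_true _ h => obtain ⟨rfl, rfl⟩ := ih h; exact ⟨rfl, rfl⟩
    | cond_false hc' _ => exact absurd hc' hc
  | cond_false hc _ ih =>
    cases h₂ with
    | cond_true hc' _ => exact absurd hc hc'
    | cond_false _ h => obtain ⟨rfl, rfl⟩ := ih h; exact ⟨rfl, rfl⟩
  | loop_exit hc =>
    cases h₂ with
    | loop_exit _ => exact ⟨rfl, rfl⟩
    | loop_step hc' _ _ => exact absurd hc hc'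
  | loop_step hc _ _ ih₁ ih₂ =>
    cases h₂ with
    | loop_exit hc' => exact absurd hc' hc
    | loop_step _ h h' =>
      obtain ⟨rfl, rfl⟩ := ih₁ h
      obtain ⟨rfl, rfl⟩ := ih₂ h'
      exact ⟨rfl, rfl⟩

end WordRAM

/-! ## Greedy MIS and the dynamic problem -/

namespace DynamicMIS

open Classical in
/-- The greedy MIS of `G` with respect to the order `π`, where `π v` is the position of the vertex
`v` (counted from `0`): the vertices are scanned in the order of their positions, and a vertex is
added to the set if it has no neighbour in the set built so far. -/
noncomputable def greedyMIS {n : ℕ} (G : SimpleGraph (Fin n)) (π : Equiv.Perm (Fin n)) :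
    Finset (Fin n) :=
  (List.ofFn fun i : Fin n => π.symm i).foldl
    (fun M v => if ∃ u ∈ M, G.Adj u v then M else insert v M) ∅

/-- An edge update on the vertex set `Fin n`. -/
inductive EdgeUpdate (n : ℕ)
  | insert (u v : Fin n)
  | delete (u v : Fin n)

/-- `σ.Step G G'`: the update `σ` is legal in `G` and turns `G` into `G'`. Only an absent edge
between two distinct vertices can be inserted, and only a present edge can be deleted. -/
def EdgeUpdate.Step {n : ℕ} : EdgeUpdate n → SimpleGraph (Fin n) → SimpleGraph (Fin n) → Prop
  | .insert u v, G, G' => u ≠ v ∧ ¬ G.Adj u v ∧ G' = G ⊔ SimpleGraph.edge u v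
  | .delete u v, G, G' => G.Adj u v ∧ G' = G.deleteEdges {s(u, v)}

/-- A dynamic algorithm: one program that is run once on the initial graph, and one program that is
run after each update. -/
structure Algorithm where
  preprocess : WordRAM.Prog
  update : WordRAM.Prog

open Classical in
/-- The state in which preprocessing starts: register `0` holds `n`, segment `0` holds the order
`π`, segment `1` holds the adjacency matrix of `G` row by row, and everything else is `0`. -/
noncomputable def inputState {n : ℕ} (G : SimpleGraph (Fin n)) (π : Equiv.Perm (Fin n)) :
    WordRAM.State where
  reg x := if x = 0 then n else 0
  mem a i :=
    if a = 0 then (if h : i < n then (π ⟨i, h⟩ : ℕ) else 0)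
    else if a = 1 then (if ∃ u v : Fin n, i = u * n + v ∧ G.Adj u v then 1 else 0)
    else 0

/-- Announce an update to the algorithm: register `1` receives the kind of the update (`1` for an
insertion, `0` for a deletion), registers `2` and `3` receive the endpoints; all other registers
and the whole memory are kept. -/
def announce {n : ℕ} (s : WordRAM.State) : EdgeUpdate n → WordRAM.State
  | .insert u v => ((s.setReg 1 1).setReg 2 u).setReg 3 v
  | .delete u v => ((s.setReg 1 0).setReg 2 u).setReg 3 v

/-- Segment `2` stores the characteristic vector of `M`. -/
def Stores {n : ℕ} (s : WordRAM.State) (M : Finset (Fin n)) : Prop :=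
  ∀ v : Fin n, s.mem 2 v = if v ∈ M then 1 else 0

end DynamicMIS

/-!
# Maintaining a greedy maximal independent set in polylogarithmic expected time

For a vertex `x`, `elimRank G π x` is the position of the vertex whose scanning decides about `x`:
`x` itself if it joins the greedy MIS, and otherwise its first neighbour there. A vertex is alive at
position `s` if its rank is at least `s`, and `x` is in the greedy MIS if and only if
`elimRank G π x = π x` (`mem_greedyMIS`). The algorithm stores the ranks, and for each vertex `x` a
segment tree with the neighbours `z` of `x`, ordered by `min (elimRank G π x) (elimRank G π z)`, so
that the neighbours that are alive at a given position can be listed at logarithmic cost for each.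

*Update.* When the edge `ab` is toggled, `π a < π b`, only `b` can change its rank at once, and only
if `a` is in the greedy MIS. Any other vertex with a new rank is a neighbour of a vertex that enters
or leaves the greedy MIS (`Toggle.exists_first`). The update program therefore keeps a priority
queue with the vertices for which the scans of the two graphs have begun to disagree, and repairs
them in the order of their positions. Together with a vertex `x` it records the position
`diffRank G G' π x` at which the disagreement begins; to repair `x` it suffices to visit the
neighbours that are alive at this position (`eq_elimRank_of_min`, `Toggle.mem_waiting_succ`). So the
time is `O(log n)` times `repairCost`, the sum over all `x` with a new rank of the number of
neighbours alive at position `diffRank G G' π x` (`updateProg_spec`). Preprocessing inserts the edges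
of the input graph one by one with the same program (`preprocess_spec`).

*Expectation.* Given the first `s` positions, the vertex at position `s` is uniformly distributed
among the others (`sum_resample`). This has two consequences.

* A vertex with more than `d` alive neighbours dies in each step with probability at least `d / n`,
  so with high probability the vertices that are alive at position `s` have `O(n * log n / s)` alive
  neighbours (`sum_tail_le`, `sum_not_lowDegree_le`).
* The expected number of vertices that are alive at position `s` in exactly one of the two scans is
  at most `2 * s / n` (`sum_card_disagree_le`). Such a disagreement at `x` spreads to an adjacent
  vertex `y` that is alive in both scans if `x` is scanned next, but it disappears if `y` is scanned
  next, which is equally likely; so in expectation only the toggled edge creates disagreements.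
  Hence the vertex at position `s` enters or leaves the greedy MIS with probability at most
  `2 * s / (n * (n - s))` (`sum_flip_le`).

If the vertex at position `s` enters or leaves, then `O(n * log n / s)` vertices `x` have
`diffRank G G' π x = s`, and each of them costs `O(n * log n / s)`. Summing
`s / (n * (n - s)) * (n * log n / s) ^ 2` over all `s` gives `O((log n) ^ 3)`
(`sum_repairCost_le`), and the segment trees contribute the fourth logarithm.
-/

/-! ### Total correctness with a step bound -/

namespace WordRAM

instance : Add Expr := ⟨.op .add⟩
instance : Sub Expr := ⟨.op .sub⟩
instance : Mul Expr := ⟨.op .mul⟩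
instance : Div Expr := ⟨.op .div⟩
instance : Mod Expr := ⟨.op .mod⟩

/-- Run the first program, then the second. -/
infixr:60 " ;; " => Prog.seq

section Eval
variable {w : ℕ} {s : State} {e₁ e₂ : Expr}

@[simp] theorem Expr.eval_reg (x : ℕ) : (Expr.reg x).eval w s = s.reg x := rfl
@[simp] theorem Expr.eval_lit (k : ℕ) : (Expr.lit k).eval w s = k % 2 ^ w := rfl
@[simp] theorem Expr.eval_load (a : ℕ) (i : Expr) :
    (Expr.load a i).eval w s = s.mem a (i.eval w s) := rfl
@[simp] theorem Expr.eval_add : (e₁ + e₂).eval w s = (e₁.eval w s + e₂.eval w s) % 2 ^ w := rfl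
@[simp] theorem Expr.eval_sub :
    (e₁ - e₂).eval w s = (e₁.eval w s + 2 ^ w - e₂.eval w s) % 2 ^ w := rfl
@[simp] theorem Expr.eval_mul : (e₁ * e₂).eval w s = (e₁.eval w s * e₂.eval w s) % 2 ^ w := rfl
@[simp] theorem Expr.eval_div : (e₁ / e₂).eval w s = (e₁.eval w s / e₂.eval w s) % 2 ^ w := rfl
@[simp] theorem Expr.eval_mod : (e₁ % e₂).eval w s = (e₁.eval w s % e₂.eval w s) % 2 ^ w := rfl
@[simp] theorem Expr.eval_lt :
    (Expr.op .lt e₁ e₂).eval w s = if e₁.eval w s < e₂.eval w s then 1 else 0 := rfl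
@[simp] theorem Expr.eval_eq :
    (Expr.op .eq e₁ e₂).eval w s = if e₁.eval w s = e₂.eval w s then 1 else 0 := rfl

@[simp] theorem Expr.cost_add : (e₁ + e₂).cost = e₁.cost + e₂.cost + 1 := rfl
@[simp] theorem Expr.cost_sub : (e₁ - e₂).cost = e₁.cost + e₂.cost + 1 := rfl
@[simp] theorem Expr.cost_mul : (e₁ * e₂).cost = e₁.cost + e₂.cost + 1 := rfl
@[simp] theorem Expr.cost_div : (e₁ / e₂).cost = e₁.cost + e₂.cost + 1 := rfl
@[simp] theorem Expr.cost_mod : (e₁ % e₂).cost = e₁.cost + e₂.cost + 1 := rfl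

@[simp] theorem State.reg_setReg (x k y : ℕ) :
    (s.setReg x k).reg y = if y = x then k else s.reg y := by
  simp [State.setReg, Function.update_apply]
@[simp] theorem State.mem_setReg (x k : ℕ) : (s.setReg x k).mem = s.mem := rfl
@[simp] theorem State.reg_setMem (a i k : ℕ) : (s.setMem a i k).reg = s.reg := rfl
theorem State.mem_setMem (a i k : ℕ) :
    (s.setMem a i k).mem = Function.update s.mem a (Function.update (s.mem a) i k) := rfl
@[simp] theorem State.mem_setMem_self (a i k : ℕ) :
    (s.setMem a i k).mem a = Function.update (s.mem a) i k := by
  simp [State.mem_setMem]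
theorem State.mem_setMem_of_ne {a b : ℕ} (h : b ≠ a) (i k : ℕ) :
    (s.setMem a i k).mem b = s.mem b := by
  simp [State.mem_setMem, Function.update_of_ne h]

end Eval

/-- `RunsWithin w p s T Q`: started in `s`, the program `p` halts after at most `T` steps in a
state with property `Q`. -/
def RunsWithin (w : ℕ) (p : Prog) (s : State) (T : ℕ) (Q : State → Prop) : Prop :=
  ∃ t s', Exec w p s t s' ∧ t ≤ T ∧ Q s'

namespace RunsWithin
variable {w : ℕ} {p q : Prog} {s : State} {T T' : ℕ} {Q Q' : State → Prop} {e : Expr}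

theorem mono (h : RunsWithin w p s T Q) (hT : T ≤ T') (hQ : ∀ s', Q s' → Q' s') :
    RunsWithin w p s T' Q' := by
  obtain ⟨t, s', he, ht, hs⟩ := h
  exact ⟨t, s', he, ht.trans hT, hQ _ hs⟩

theorem nop (h : Q s) : RunsWithin w .nop s 1 Q := ⟨_, _, .nop s, le_rfl, h⟩

theorem assign {x : ℕ} (h : Q (s.setReg x (e.eval w s))) :
    RunsWithin w (.assign x e) s (e.cost + 1) Q := ⟨_, _, .assign x e s, le_rfl, h⟩

theorem store {a : ℕ} {i : Expr} (h : Q (s.setMem a (i.eval w s) (e.eval w s))) :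
    RunsWithin w (.store a i e) s (i.cost + e.cost + 1) Q := ⟨_, _, .store a i e s, le_rfl, h⟩

theorem seq (h : RunsWithin w p s T fun s' => RunsWithin w q s' T' Q) :
    RunsWithin w (p ;; q) s (T + T') Q := by
  obtain ⟨t, s', he, ht, t', s'', he', ht', hs⟩ := h
  exact ⟨_, _, .seq he he', by omega, hs⟩

/-- An assignment at the head of a sequence. -/
theorem assign_seq {x v : ℕ} (hv : e.eval w s = v) (h : RunsWithin w q (s.setReg x v) T Q) :
    RunsWithin w (.assign x e ;; q) s (e.cost + 1 + T) Q :=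
  seq (assign (by rw [hv]; exact h))

/-- A store at the head of a sequence. -/
theorem store_seq {a j v : ℕ} {i : Expr} (hi : i.eval w s = j) (hv : e.eval w s = v)
    (h : RunsWithin w q (s.setMem a j v) T Q) :
    RunsWithin w (.store a i e ;; q) s (i.cost + e.cost + 1 + T) Q :=
  seq (store (by rw [hi, hv]; exact h))

theorem cond (h₁ : e.eval w s ≠ 0 → RunsWithin w p s T Q)
    (h₂ : e.eval w s = 0 → RunsWithin w q s T' Q) :
    RunsWithin w (.cond e p q) s (e.cost + 1 + max T T') Q := by
  by_cases h : e.eval w s = 0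
  · obtain ⟨t, s', he, ht, hs⟩ := h₂ h
    exact ⟨_, _, .cond_false h he, by omega, hs⟩
  · obtain ⟨t, s', he, ht, hs⟩ := h₁ h
    exact ⟨_, _, .cond_true h he, by omega, hs⟩

/-- The rule for loops. The invariant `I` carries the number of steps that are still allowed; as
every test of the loop condition costs a step, this number is also the variant. -/
theorem loop (I : ℕ → State → Prop)
    (hI : ∀ c s, I c s → (e.eval w s = 0 ∧ e.cost + 1 ≤ c ∧ Q s) ∨
      (e.eval w s ≠ 0 ∧ ∃ c₁ c₂, e.cost + 1 + c₁ + c₂ ≤ c ∧ RunsWithin w p s c₁ (I c₂)))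
    (h : I T s) : RunsWithin w (.loop e p) s T Q := by
  induction T using Nat.strong_induction_on generalizing s with
  | _ T ih =>
    rcases hI T s h with ⟨h0, hc, hq⟩ | ⟨h0, c₁, c₂, hc, t, s', he, ht, hs⟩
    · exact ⟨_, _, .loop_exit h0, hc, hq⟩
    · obtain ⟨t', s'', he', ht', hs'⟩ := ih c₂ (by omega) hs
      exact ⟨_, _, .loop_step h0 he he', by omega, hs'⟩

end RunsWithin

/-- The two states agree on the registers below `r` and on all memory segments but segment `3`. -/
structure SameBut (r : ℕ) (s s' : State) : Prop where
  reg : ∀ x < r, s'.reg x = s.reg x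
  mem : ∀ a, a ≠ 3 → s'.mem a = s.mem a

/-! ### Sets of numbers in segment trees -/

/-- `IsTree h f S`: the numbers `f 1, …, f (2 ^ (h + 1) - 1)` form a segment tree (in heap layout:
the children of node `i` are `2 * i` and `2 * i + 1`) for the maximum of the set `S` of keys below
`2 ^ h`. The leaf `2 ^ h + κ` contains `κ` if `κ ∈ S`, and `0` otherwise. -/
structure IsTree (h : ℕ) (f : ℕ → ℕ) (S : Finset ℕ) : Prop where
  leaf : ∀ κ < 2 ^ h, f (2 ^ h + κ) = if κ ∈ S then κ else 0
  inner : ∀ i, 1 ≤ i → i < 2 ^ h → f i = max (f (2 * i)) (f (2 * i + 1))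
  bdd : ∀ κ ∈ S, κ < 2 ^ h

theorem IsTree.mem_or_zero {h : ℕ} {f : ℕ → ℕ} {S : Finset ℕ} (H : IsTree h f S) {i : ℕ}
    (hi : 1 ≤ i) (hi' : i < 2 ^ h + 2 ^ h) : f i ∈ S ∨ f i = 0 := by
  induction hk : 2 ^ h + 2 ^ h - i using Nat.strong_induction_on generalizing i with
  | _ k ih =>
    by_cases hl : i < 2 ^ h
    · rw [H.inner i hi hl]
      rcases max_choice (f (2 * i)) (f (2 * i + 1)) with e | e <;> rw [e]
      · exact ih _ (by omega) (by omega) (by omega) rfl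
      · exact ih _ (by omega) (by omega) (by omega) rfl
    · obtain ⟨κ, rfl⟩ := Nat.exists_eq_add_of_le (not_lt.mp hl)
      rw [H.leaf κ (by omega)]
      split_ifs with hκ <;> simp [hκ]

theorem IsTree.le_root {h : ℕ} {f : ℕ → ℕ} {S : Finset ℕ} (H : IsTree h f S) {κ : ℕ}
    (hκ : κ ∈ S) : κ ≤ f 1 := by
  have hb := H.bdd κ hκ
  have key : ∀ t ≤ h, κ ≤ f ((2 ^ h + κ) / 2 ^ t) := by
    intro t ht
    induction t with
    | zero => simp [H.leaf κ hb, hκ]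
    | succ t ih =>
      have h1 : (2 ^ h + κ) / 2 ^ (t + 1) = (2 ^ h + κ) / 2 ^ t / 2 := by
        rw [pow_succ, Nat.div_div_eq_div_mul]
      have h2 : 2 * 2 ^ t ≤ 2 ^ h := by
        rw [← pow_succ']; exact Nat.pow_le_pow_right (by norm_num) ht
      have h3 : 2 ≤ (2 ^ h + κ) / 2 ^ t := by
        rw [Nat.le_div_iff_mul_le (by positivity)]; omega
      have h4 : (2 ^ h + κ) / 2 ^ t < 2 ^ h + 2 ^ h :=
        lt_of_le_of_lt (Nat.div_le_self _ _) (by omega)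
      have ih := ih (by omega)
      rw [h1, H.inner _ (by omega) (by omega)]
      refine ih.trans ?_
      rcases Nat.even_or_odd' ((2 ^ h + κ) / 2 ^ t) with ⟨j, hj | hj⟩
      · rw [hj]; simp
      · rw [hj, show (2 * j + 1) / 2 = j by omega]; simp
  have := key h le_rfl
  rwa [Nat.div_eq_of_lt_le (k := 1) (by omega) (by omega)] at this

theorem IsTree.root_mem {h : ℕ} {f : ℕ → ℕ} {S : Finset ℕ} (H : IsTree h f S) (h0 : f 1 ≠ 0) :
    f 1 ∈ S :=
  (H.mem_or_zero le_rfl (by have := Nat.one_le_two_pow (n := h); omega)).resolve_right h0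

/-- `Trees h n f S`: the array `f` contains, one after the other, segment trees for the sets
`S 0, …, S n`, each in a block of `2 ^ h + 2 ^ h` cells. -/
def Trees (h n : ℕ) (f : ℕ → ℕ) (S : ℕ → Finset ℕ) : Prop :=
  ∀ id ≤ n, IsTree h (fun i => f (id * (2 ^ h + 2 ^ h) + i)) (S id)

theorem block_injective {N a b i j : ℕ} (hi : i < N) (hj : j < N)
    (e : a * N + i = b * N + j) : a = b ∧ i = j := by
  have hN : 0 < N := by omega
  have h1 : (a * N + i) / N = a := by
    rw [mul_comm, Nat.mul_add_div hN, Nat.div_eq_of_lt hi, add_zero]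
  have h2 : (b * N + j) / N = b := by
    rw [mul_comm, Nat.mul_add_div hN, Nat.div_eq_of_lt hj, add_zero]
  have hab : a = b := by rw [← h1, e, h2]
  subst hab
  exact ⟨rfl, by omega⟩

/-- In the tree whose number is in register `40`, write register `42` into the leaf of the key in
register `41`, and restore the maxima on the path to the root. Register `4` holds the number of
leaves. -/
def treeSet : Prog :=
  .assign 43 (.reg 40 * (.reg 4 + .reg 4)) ;;
  .assign 44 (.reg 4 + .reg 41) ;;
  .store 3 (.reg 43 + .reg 44) (.reg 42) ;;
  .loop (.op .lt (.lit 1) (.reg 44)) (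
    .assign 44 (.reg 44 / .lit 2) ;;
    .assign 45 (.load 3 (.reg 43 + (.reg 44 + .reg 44))) ;;
    .assign 46 (.load 3 (.reg 43 + (.reg 44 + .reg 44 + .lit 1))) ;;
    .cond (.op .lt (.reg 45) (.reg 46))
      (.store 3 (.reg 43 + .reg 44) (.reg 46))
      (.store 3 (.reg 43 + .reg 44) (.reg 45)))

/-- Writing the value `if b then κ else 0` into a leaf inserts or erases the key `κ`. -/
def setKey (S : Finset ℕ) (κ : ℕ) (b : Prop) [Decidable b] : Finset ℕ :=
  if b then insert κ S else S.erase κ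

theorem mem_setKey {S : Finset ℕ} {κ x : ℕ} {b : Prop} [Decidable b] :
    x ∈ setKey S κ b ↔ if x = κ then b else x ∈ S := by
  unfold setKey
  split_ifs <;> simp_all

/-- The trees while `treeSet` walks from a leaf to the root: only the parent of the node `i` of the
tree `id` may hold a wrong maximum. -/
structure TreesExcept (h n : ℕ) (f : ℕ → ℕ) (S : ℕ → Finset ℕ) (id i : ℕ) : Prop where
  leaf : ∀ a ≤ n, ∀ κ < 2 ^ h,
    f (a * (2 ^ h + 2 ^ h) + (2 ^ h + κ)) = if κ ∈ S a then κ else 0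
  inner : ∀ a ≤ n, ∀ j, 1 ≤ j → j < 2 ^ h → ¬ (a = id ∧ j = i / 2) →
    f (a * (2 ^ h + 2 ^ h) + j) = max (f (a * (2 ^ h + 2 ^ h) + 2 * j))
      (f (a * (2 ^ h + 2 ^ h) + (2 * j + 1)))
  bdd : ∀ a ≤ n, ∀ κ ∈ S a, κ < 2 ^ h

theorem TreesExcept.up {h n : ℕ} {f : ℕ → ℕ} {S : ℕ → Finset ℕ} {id i : ℕ}
    (H : TreesExcept h n f S id i) (hi : 2 ≤ i) (hi' : i < 2 ^ h + 2 ^ h) :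
    TreesExcept h n (Function.update f (id * (2 ^ h + 2 ^ h) + i / 2)
      (max (f (id * (2 ^ h + 2 ^ h) + 2 * (i / 2)))
        (f (id * (2 ^ h + 2 ^ h) + (2 * (i / 2) + 1))))) S id (i / 2) := by
  have ne : ∀ a j, j < 2 ^ h + 2 ^ h → ¬ (a = id ∧ j = i / 2) →
      a * (2 ^ h + 2 ^ h) + j ≠ id * (2 ^ h + 2 ^ h) + i / 2 := fun a j hj hne e =>
    hne (block_injective hj (by omega) e)
  refine ⟨fun a ha κ hκ => ?_, fun a ha j hj hj' hne => ?_, H.bdd⟩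
  · rw [Function.update_of_ne (ne _ _ (by omega) (by omega)), H.leaf a ha κ hκ]
  · rw [Function.update_of_ne (ne _ (2 * j) (by omega) (by omega)),
      Function.update_of_ne (ne _ (2 * j + 1) (by omega) (by omega))]
    by_cases e : a = id ∧ j = i / 2
    · obtain ⟨rfl, rfl⟩ := e
      rw [Function.update_self]
    · rw [Function.update_of_ne (ne _ j (by omega) e), H.inner a ha j hj hj' e]

/-- The loop of `treeSet` maintains that only the parent of the current node may be wrong; the height
of the node bounds the number of rounds that are left. -/
theorem treeSet_spec {w h n : ℕ} (hw : (n + 1) * (2 ^ h + 2 ^ h) ≤ 2 ^ w) (hw2 : 2 < 2 ^ w)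
    {s : State} {S : ℕ → Finset ℕ} {id κ : ℕ} {b : Prop} [Decidable b]
    (h4 : s.reg 4 = 2 ^ h) (hid : s.reg 40 = id) (hidn : id ≤ n)
    (hκ : s.reg 41 = κ) (hκh : κ < 2 ^ h) (hv : s.reg 42 = if b then κ else 0)
    (hT : Trees h n (s.mem 3) S) :
    RunsWithin w treeSet s (50 * (h + 1)) fun s' => SameBut 43 s s' ∧
      Trees h n (s'.mem 3) (Function.update S id (setKey (S id) κ b)) := by
  set S' := Function.update S id (setKey (S id) κ b) with hS'
  have hidw : id * (2 ^ h + 2 ^ h) + (2 ^ h + 2 ^ h) ≤ 2 ^ w := by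
    refine le_trans ?_ hw
    rw [← Nat.succ_mul]
    exact Nat.mul_le_mul_right _ (by omega)
  have hb1 : id * (2 ^ h + 2 ^ h) < 2 ^ w := by omega
  have hb2 : 2 ^ h + 2 ^ h ≤ 2 ^ w := by omega
  have e1 : (1 : ℕ) % 2 ^ w = 1 := Nat.mod_eq_of_lt (by omega)
  have e2 : (2 : ℕ) % 2 ^ w = 2 := Nat.mod_eq_of_lt (by omega)
  have hh : 0 < 2 ^ h := by positivity
  unfold treeSet
  refine RunsWithin.mono (RunsWithin.assign_seq (v := id * (2 ^ h + 2 ^ h)) ?_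
    (RunsWithin.assign_seq (v := 2 ^ h + κ) ?_
    (RunsWithin.store_seq (j := id * (2 ^ h + 2 ^ h) + (2 ^ h + κ)) (v := if b then κ else 0) ?_ ?_
    (RunsWithin.loop (T := 40 * h + 4) (fun c t => ∃ i j, i < 2 ^ (j + 1) ∧ 1 ≤ i ∧
      i < 2 ^ h + 2 ^ h ∧ c = 40 * j + 4 ∧
      SameBut 43 s t ∧ t.reg 43 = id * (2 ^ h + 2 ^ h) ∧ t.reg 44 = i ∧
      TreesExcept h n (t.mem 3) S' id i) ?_ ?_)))) ?_ (fun s' h => h)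
  · have : 2 ^ h < 2 ^ h + 2 ^ h := by omega
    have e3 : (2 ^ h + 2 ^ h) % 2 ^ w = 2 ^ h + 2 ^ h ∨ id = 0 := by
      by_cases h0 : id = 0
      · exact .inr h0
      · left
        apply Nat.mod_eq_of_lt
        have : 1 * (2 ^ h + 2 ^ h) ≤ id * (2 ^ h + 2 ^ h) := Nat.mul_le_mul_right _ (by omega)
        omega
    rcases e3 with e3 | e3
    · simp [h4, hid, e3, Nat.mod_eq_of_lt hb1]
    · simp [h4, hid, e3]
  · simp [h4, hκ, Nat.mod_eq_of_lt (show 2 ^ h + κ < 2 ^ w by omega)]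
  · simp [Nat.mod_eq_of_lt (show id * (2 ^ h + 2 ^ h) + (2 ^ h + κ) < 2 ^ w by omega)]
  · simp [hv]
  · rintro c t ⟨i, j, hij, hi1, hi2, rfl, hs, h43, h44, hT'⟩
    by_cases hi : i = 1
    · left
      subst hi
      refine ⟨by simp [h44, e1], by simp [Expr.cost], hs, fun a ha => ⟨?_, ?_, hT'.bdd a ha⟩⟩
      · exact hT'.leaf a ha
      · intro k hk hk'
        exact hT'.inner a ha k hk hk' (by omega)
    · right
      have hi3 : 2 ≤ i := by omega
      obtain ⟨j, rfl⟩ : ∃ j', j = j' + 1 := by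
        refine ⟨j - 1, ?_⟩
        rcases j with _ | j
        · simp at hij; omega
        · omega
      refine ⟨by simp [h44, e1]; omega, 35, 40 * j + 4, by simp [Expr.cost]; omega, ?_⟩
      have i2 : i / 2 + i / 2 = 2 * (i / 2) := by ring
      have hup := hT'.up hi3 hi2
      have hlt : i / 2 < 2 ^ (j + 1) := by rw [pow_succ] at hij; omega
      refine RunsWithin.mono (RunsWithin.assign_seq (v := i / 2) ?_
        (RunsWithin.assign_seq (v := t.mem 3 (id * (2 ^ h + 2 ^ h) + 2 * (i / 2))) ?_
        (RunsWithin.assign_seq (v := t.mem 3 (id * (2 ^ h + 2 ^ h) + (2 * (i / 2) + 1))) ?_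
        (RunsWithin.cond (fun hc => RunsWithin.store ?_) (fun hc => RunsWithin.store ?_)))))
        ?_ (fun s' h => h)
      · simp [h44, e2, Nat.mod_eq_of_lt (show i / 2 < 2 ^ w by omega)]
      · simp [h43, i2, Nat.mod_eq_of_lt (show 2 * (i / 2) < 2 ^ w by omega),
          Nat.mod_eq_of_lt (show id * (2 ^ h + 2 ^ h) + 2 * (i / 2) < 2 ^ w by omega)]
      · simp [h43, i2, e1, Nat.mod_eq_of_lt (show 2 * (i / 2) + 1 < 2 ^ w by omega),
          Nat.mod_eq_of_lt (show id * (2 ^ h + 2 ^ h) + (2 * (i / 2) + 1) < 2 ^ w by omega)]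
      · have hc' : t.mem 3 (id * (2 ^ h + 2 ^ h) + 2 * (i / 2)) <
            t.mem 3 (id * (2 ^ h + 2 ^ h) + (2 * (i / 2) + 1)) := by
          by_contra hcon; simp [hcon] at hc
        refine ⟨i / 2, j, hlt, by omega, by omega, rfl, ⟨fun x hx => ?_, fun a ha => ?_⟩, ?_, ?_, ?_⟩
        · simp [show x ≠ 44 by omega, show x ≠ 45 by omega, show x ≠ 46 by omega, hs.reg x hx]
        · simp [State.mem_setMem_of_ne ha, hs.mem a ha]
        · simp [h43]
        · simp
        · simpa [h43, Nat.mod_eq_of_lt (show id * (2 ^ h + 2 ^ h) + i / 2 < 2 ^ w by omega),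
            max_eq_right hc'.le] using hup
      · have hc' : ¬ t.mem 3 (id * (2 ^ h + 2 ^ h) + 2 * (i / 2)) <
            t.mem 3 (id * (2 ^ h + 2 ^ h) + (2 * (i / 2) + 1)) := by
          intro hcon; simp [hcon] at hc
        refine ⟨i / 2, j, hlt, by omega, by omega, rfl, ⟨fun x hx => ?_, fun a ha => ?_⟩, ?_, ?_, ?_⟩
        · simp [show x ≠ 44 by omega, show x ≠ 45 by omega, show x ≠ 46 by omega, hs.reg x hx]
        · simp [State.mem_setMem_of_ne ha, hs.mem a ha]
        · simp [h43]
        · simp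
        · simpa [h43, Nat.mod_eq_of_lt (show id * (2 ^ h + 2 ^ h) + i / 2 < 2 ^ w by omega),
            max_eq_left (not_lt.mp hc')] using hup
      · simp [Expr.cost]
  · refine ⟨2 ^ h + κ, h, by rw [pow_succ]; omega, by omega, by omega, rfl,
      ⟨fun x hx => ?_, fun a ha => ?_⟩, ?_, ?_, ?_⟩
    · simp [show x ≠ 43 by omega, show x ≠ 44 by omega]
    · simp [State.mem_setMem_of_ne ha]
    · simp
    · simp
    · have ne : ∀ a j, j < 2 ^ h + 2 ^ h → ¬ (a = id ∧ j = 2 ^ h + κ) →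
          a * (2 ^ h + 2 ^ h) + j ≠ id * (2 ^ h + 2 ^ h) + (2 ^ h + κ) := fun a j hj hne e =>
        hne (block_injective hj (by omega) e)
      simp only [State.mem_setMem_self, State.mem_setReg]
      refine ⟨fun a ha κ' hκ' => ?_, fun a ha j hj hj' hne => ?_, fun a ha κ' hκ' => ?_⟩
      · by_cases e : a = id ∧ κ' = κ
        · obtain ⟨rfl, rfl⟩ := e
          rw [Function.update_self, hS', Function.update_self]
          simp [mem_setKey]
        · rw [Function.update_of_ne (ne _ _ (by omega) (by omega)), (hT a ha).leaf κ' hκ', hS']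
          by_cases ea : a = id
          · subst ea
            have : κ' ≠ κ := fun hk => e ⟨rfl, hk⟩
            simp [mem_setKey, this]
          · simp [Function.update_of_ne ea]
      · rw [Function.update_of_ne (ne _ j (by omega) (by omega)),
          Function.update_of_ne (ne _ (2 * j) (by omega) (by omega)),
          Function.update_of_ne (ne _ (2 * j + 1) (by omega) (by omega))]
        exact (hT a ha).inner j hj hj'
      · rw [hS'] at hκ'
        by_cases ea : a = id
        · subst ea
          rw [Function.update_self, mem_setKey] at hκ'
          split_ifs at hκ' with hk
          · omega
          · exact (hT a ha).bdd κ' hκ'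
        · rw [Function.update_of_ne ea] at hκ'
          exact (hT a ha).bdd κ' hκ'
  · simp [Expr.cost]; omega

end WordRAM

/-! ### Elimination ranks -/

namespace DynamicMIS

section ElimRank
variable {n : ℕ} (G : SimpleGraph (Fin n)) (π : Equiv.Perm (Fin n))

/-- The vertices that survive the first `s` positions of the greedy scan: a vertex is eliminated
when it, or one of its neighbours, is scanned while still alive. -/
def alive : ℕ → Set (Fin n)
  | 0 => Set.univ
  | s + 1 => {x | x ∈ alive s ∧ ∀ y ∈ alive s, (π y : ℕ) = s → y ≠ x ∧ ¬ G.Adj y x}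

theorem not_mem_alive_succ (x : Fin n) : x ∉ alive G π (π x + 1) :=
  fun h => (h.2 x h.1 rfl).1 rfl

open Classical in
/-- The position of the vertex whose scanning eliminates `x`. -/
noncomputable def elimRank (x : Fin n) : ℕ :=
  Nat.find (p := fun s => x ∉ alive G π (s + 1)) ⟨π x, not_mem_alive_succ G π x⟩

theorem alive_antitone : Antitone (alive G π) := antitone_nat_of_succ_le fun _ _ h => h.1

theorem le_elimRank {s : ℕ} {x : Fin n} : s ≤ elimRank G π x ↔ x ∈ alive G π s := by
  classical
  rw [elimRank, Nat.le_find_iff]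
  constructor
  · intro h
    rcases s with _ | s
    · trivial
    · simpa using h s (Nat.lt_succ_self s)
  · intro h m hm
    exact not_not.mpr (alive_antitone G π hm h)

theorem elimRank_le (x : Fin n) : elimRank G π x ≤ π x := by
  by_contra! h
  exact not_mem_alive_succ G π x ((le_elimRank G π).1 h)

theorem elimRank_lt (x : Fin n) : elimRank G π x < n :=
  (elimRank_le G π x).trans_lt (π x).2

theorem succ_le_elimRank {s : ℕ} {x : Fin n} : s + 1 ≤ elimRank G π x ↔ s ≤ elimRank G π x ∧
    ∀ y, (π y : ℕ) = s → elimRank G π y = π y → y ≠ x ∧ ¬ G.Adj y x := by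
  rw [le_elimRank, le_elimRank]
  refine and_congr_right fun _ => forall_congr' fun y => ⟨fun h e1 e2 => h ?_ e1, fun h e1 e2 => h e2 ?_⟩
  · rw [← le_elimRank]; omega
  · rw [← le_elimRank] at e1
    have := elimRank_le G π y
    omega

/-- A vertex survives until position `s` if and only if neither itself nor a neighbour in the
greedy MIS is scanned before. -/
theorem le_elimRank_iff {s : ℕ} {x : Fin n} : s ≤ elimRank G π x ↔
    s ≤ π x ∧ ∀ z, G.Adj z x → elimRank G π z = π z → s ≤ π z := by
  constructor
  · refine fun h => ⟨h.trans (elimRank_le G π x), fun z hz e => ?_⟩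
    by_contra! hlt
    exact ((succ_le_elimRank G π (s := π z)).1 (by omega)).2 z rfl e |>.2 hz
  · induction s with
    | zero => simp
    | succ s ih =>
      rintro ⟨h1, h2⟩
      rw [succ_le_elimRank]
      refine ⟨ih ⟨by omega, fun z hz e => by have := h2 z hz e; omega⟩, fun y hy e => ⟨?_, ?_⟩⟩
      · rintro rfl; omega
      · intro hadj; have := h2 y hadj e; omega

theorem elimRank_le_of_adj {x z : Fin n} (h : G.Adj z x) (hz : elimRank G π z = π z) :
    elimRank G π x ≤ π z :=
  ((le_elimRank_iff G π).1 le_rfl).2 z h hz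

theorem exists_adj_of_elimRank_ne {x : Fin n} (h : elimRank G π x ≠ π x) :
    ∃ z, G.Adj z x ∧ elimRank G π z = π z ∧ elimRank G π x = π z := by
  by_contra! hcon
  have h1 : ¬ elimRank G π x + 1 ≤ elimRank G π x := by omega
  refine h1 ((succ_le_elimRank G π).2 ⟨le_rfl, fun y hy e => ⟨?_, fun hadj => ?_⟩⟩)
  · rintro rfl; exact h hy.symm
  · exact hcon y hadj e hy.symm

theorem foldl_greedy {s : ℕ} (hs : s ≤ n) (g : Finset (Fin n) → Fin n → Finset (Fin n))
    (hg : ∀ M v, (∃ u ∈ M, G.Adj u v) → g M v = M)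
    (hg' : ∀ M v, (¬ ∃ u ∈ M, G.Adj u v) → g M v = insert v M) (x : Fin n) :
    x ∈ ((List.ofFn fun i : Fin n => π.symm i).take s).foldl g ∅ ↔
      (π x : ℕ) < s ∧ elimRank G π x = π x := by
  induction s generalizing x with
  | zero => simp
  | succ s ih =>
    have hlen : s < (List.ofFn fun i : Fin n => π.symm i).length := by simp; omega
    rw [← List.take_append_getElem hlen, List.foldl_append]
    simp only [List.getElem_ofFn, List.foldl_cons, List.foldl_nil]
    set M := ((List.ofFn fun i : Fin n => π.symm i).take s).foldl g ∅ with hM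
    have ih : ∀ x, x ∈ M ↔ (π x : ℕ) < s ∧ elimRank G π x = π x := fun x => ih (by omega) x
    set v := π.symm ⟨s, hs⟩ with hv
    have hπv : (π v : ℕ) = s := by simp [hv]
    have hxv : (π x : ℕ) = s → x = v := fun h => by
      rw [hv, Equiv.eq_symm_apply]; exact Fin.ext h
    by_cases hc : ∃ u ∈ M, G.Adj u v
    · rw [hg _ _ hc, ih]
      refine ⟨fun h => ⟨by omega, h.2⟩, fun h => ⟨?_, h.2⟩⟩
      by_contra hlt
      obtain rfl := hxv (by omega)
      obtain ⟨u, hu, hadj⟩ := hc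
      have := elimRank_le_of_adj G π hadj ((ih u).1 hu).2
      have := ((ih u).1 hu).1
      omega
    · rw [hg' _ _ hc, Finset.mem_insert, ih]
      constructor
      · rintro (rfl | h)
        · refine ⟨by omega, ?_⟩
          by_contra hne
          obtain ⟨z, hz, hz1, hz2⟩ := exists_adj_of_elimRank_ne G π hne
          have := elimRank_le G π v
          exact hc ⟨z, (ih z).2 ⟨by omega, hz1⟩, hz⟩
        · exact ⟨by omega, h.2⟩
      · rintro ⟨h1, h2⟩
        rcases Nat.lt_succ_iff_lt_or_eq.1 h1 with h | h
        · exact .inr ⟨h, h2⟩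
        · exact .inl (hxv h)

theorem mem_greedyMIS {x : Fin n} : x ∈ greedyMIS G π ↔ elimRank G π x = π x := by
  classical
  have := foldl_greedy G π le_rfl
    (fun M v => if ∃ u ∈ M, G.Adj u v then M else insert v M)
    (fun M v h => if_pos h) (fun M v h => if_neg h) x
  rw [List.take_of_length_le (by simp)] at this
  simp only [(π x).2, true_and] at this
  rw [← this, greedyMIS]

end ElimRank

end DynamicMIS

/-! ### The effect of one edge update on the elimination ranks -/

namespace DynamicMIS

/-- `G` and `G'` differ exactly in the edge `ab`. -/
structure Toggle {n : ℕ} (G G' : SimpleGraph (Fin n)) (a b : Fin n) : Prop where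
  adj : G.Adj a b ↔ ¬ G'.Adj a b
  same : ∀ x y, ¬ (x = a ∧ y = b) → ¬ (x = b ∧ y = a) → (G.Adj x y ↔ G'.Adj x y)

namespace Toggle
variable {n : ℕ} {G G' : SimpleGraph (Fin n)} {π : Equiv.Perm (Fin n)} {a b : Fin n}

theorem comm (T : Toggle G G' a b) : Toggle G' G a b :=
  ⟨by have := T.adj; tauto, fun x y h h' => (T.same x y h h').symm⟩

theorem swap (T : Toggle G G' a b) : Toggle G G' b a :=
  ⟨by have := T.adj; rwa [G.adj_comm, G'.adj_comm], fun x y h h' => T.same x y h' h⟩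

theorem le_elimRank_iff_of_le (T : Toggle G G' a b) (hab : π a < π b) {s : ℕ} (hs : s ≤ π a)
    (x : Fin n) : s ≤ elimRank G π x ↔ s ≤ elimRank G' π x := by
  rw [le_elimRank, le_elimRank]
  induction s generalizing x with
  | zero => exact Iff.rfl
  | succ s ih =>
    have ih := fun x => ih (by omega) x
    refine and_congr (ih x) (forall_congr' fun y => ?_)
    rw [ih y]
    refine forall_congr' fun _ => forall_congr' fun hy => ?_
    rw [T.same y x (by rintro ⟨rfl, -⟩; omega)
      (by rintro ⟨rfl, -⟩; have : (π a : ℕ) < π y := hab; omega)]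

theorem elimRank_fst (T : Toggle G G' a b) (hab : π a < π b) :
    elimRank G π a = elimRank G' π a :=
  le_antisymm ((T.le_elimRank_iff_of_le hab (elimRank_le G π a) a).1 le_rfl)
    ((T.le_elimRank_iff_of_le hab (elimRank_le G' π a) a).2 le_rfl)

theorem exists_first_of_lt (T : Toggle G G' a b) (hab : π a < π b) {x : Fin n}
    (h : elimRank G π x < elimRank G' π x) : ∃ y, (π y : ℕ) = elimRank G π x ∧
      (y = a ∧ x = b ∧ elimRank G π a = π a ∨
      elimRank G π y = π y ∧ elimRank G' π y ≠ π y ∧ G.Adj y x ∧ G'.Adj y x) := by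
  have h1 : ¬ elimRank G π x + 1 ≤ elimRank G π x := by omega
  have h2 : elimRank G π x + 1 ≤ elimRank G' π x := h
  rw [succ_le_elimRank] at h1 h2
  push Not at h1
  obtain ⟨y, hy, e, hyx⟩ := h1 le_rfl
  have hne : y ≠ x := by
    rintro rfl
    have := elimRank_le G' π y
    omega
  have hadj := hyx hne
  refine ⟨y, hy, ?_⟩
  by_cases hc1 : y = a ∧ x = b
  · obtain ⟨rfl, rfl⟩ := hc1
    exact .inl ⟨rfl, rfl, e⟩
  right
  have hc2 : ¬ (y = b ∧ x = a) := by
    rintro ⟨rfl, rfl⟩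
    have := elimRank_le G π x
    have : (π x : ℕ) < π y := hab
    omega
  have hadj' := (T.same y x hc1 hc2).1 hadj
  exact ⟨e, fun e' => (h2.2 y hy e').2 hadj', hadj, hadj'⟩

/-- The vertices `x` whose elimination rank changes are `b`, if `a` is in the greedy MIS, and
neighbours of vertices that enter or leave the greedy MIS. -/
theorem exists_first (T : Toggle G G' a b) (hab : π a < π b) {x : Fin n}
    (h : elimRank G π x ≠ elimRank G' π x) :
    ∃ y, (π y : ℕ) = min (elimRank G π x) (elimRank G' π x) ∧
      (y = a ∧ x = b ∧ elimRank G π a = π a ∨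
      elimRank G π y ≠ elimRank G' π y ∧ (elimRank G π y = π y ∨ elimRank G' π y = π y) ∧
        G.Adj y x ∧ G'.Adj y x) := by
  rcases lt_or_gt_of_ne h with h | h
  · obtain ⟨y, hy, hy'⟩ := T.exists_first_of_lt hab h
    refine ⟨y, by omega, hy'.imp_right fun ⟨h1, h2, h3, h4⟩ => ⟨fun e => h2 (e ▸ h1), .inl h1, h3, h4⟩⟩
  · obtain ⟨y, hy, hy'⟩ := T.comm.exists_first_of_lt hab h
    refine ⟨y, by omega, hy'.imp ?_ fun ⟨h1, h2, h3, h4⟩ => ⟨fun e => h2 (e ▸ h1), .inr h1, h4, h3⟩⟩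
    rintro ⟨rfl, rfl, e⟩
    exact ⟨rfl, rfl, (T.elimRank_fst hab).trans e⟩

end Toggle

section Progress
variable {n : ℕ} (G G' : SimpleGraph (Fin n)) (π : Equiv.Perm (Fin n))

/-- The position at which the scans of `G` and of `G'` begin to disagree about `x`, for a vertex `x`
whose elimination rank changes. -/
noncomputable def diffRank (x : Fin n) : ℕ := min (elimRank G π x) (elimRank G' π x)

/-- The ranks stored when all positions below `s` have been repaired: new ranks for the vertices
before position `s`, old ranks for the others. -/
noncomputable def mixRank (s : ℕ) (x : Fin n) : ℕ :=
  if (π x : ℕ) < s then elimRank G' π x else elimRank G π x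

open Classical in
/-- The vertices that wait for repair when all positions below `s` have been repaired. -/
noncomputable def waiting (s : ℕ) : Finset (Fin n) :=
  Finset.univ.filter fun x =>
    elimRank G π x ≠ elimRank G' π x ∧ diffRank G G' π x < s ∧ s ≤ (π x : ℕ)

variable {G G' π}

theorem mem_waiting {s : ℕ} {x : Fin n} : x ∈ waiting G G' π s ↔
    elimRank G π x ≠ elimRank G' π x ∧ diffRank G G' π x < s ∧ s ≤ (π x : ℕ) := by
  simp [waiting]

theorem mixRank_le (s : ℕ) (x : Fin n) : mixRank G G' π s x ≤ π x := by
  unfold mixRank; split_ifs <;> exact elimRank_le _ _ _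

theorem mixRank_of_le {s : ℕ} {x : Fin n} (h : s ≤ π x) :
    mixRank G G' π s x = elimRank G π x := if_neg (by omega)

theorem mixRank_of_lt {s : ℕ} {x : Fin n} (h : (π x : ℕ) < s) :
    mixRank G G' π s x = elimRank G' π x := if_pos h

theorem mixRank_succ {s : ℕ} {y : Fin n} (hy : (π y : ℕ) = s) :
    mixRank G G' π (s + 1) = Function.update (mixRank G G' π s) y (elimRank G' π y) := by
  funext x
  by_cases h : x = y
  · subst h
    rw [Function.update_self, mixRank_of_lt (by omega)]
  · rw [Function.update_of_ne h]
    have : (π x : ℕ) ≠ s := fun e => h (π.injective (Fin.ext (e.trans hy.symm)))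
    unfold mixRank
    congr 1
    exact propext (by omega)

end Progress

namespace Toggle
variable {n : ℕ} {G G' : SimpleGraph (Fin n)} {π : Equiv.Perm (Fin n)} {a b : Fin n}

theorem not_trigger_of_lt (T : Toggle G G' a b) (hab : π a < π b) {x : Fin n}
    (h : elimRank G π x ≠ elimRank G' π x) (hlt : diffRank G G' π x < π a + 1) :
    x = b ∧ elimRank G π a = π a ∧ π a ≤ elimRank G π b := by
  obtain ⟨y, hy, h'⟩ := T.exists_first hab h
  have hge : (π a : ℕ) ≤ diffRank G G' π x := by
    by_contra! hc
    unfold diffRank at hc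
    have h1 := T.le_elimRank_iff_of_le hab (s := elimRank G π x + 1)
    have h2 := T.le_elimRank_iff_of_le hab (s := elimRank G' π x + 1)
    rcases lt_or_gt_of_ne h with h | h
    · have := (h1 (by omega) x).2 (by omega); omega
    · have := (h2 (by omega) x).1 (by omega); omega
  unfold diffRank at hge hlt
  rcases h' with ⟨rfl, rfl, e⟩ | ⟨hne, -⟩
  · exact ⟨rfl, e, by omega⟩
  · obtain rfl : y = a := π.injective (Fin.ext (by omega))
    exact absurd (T.elimRank_fst hab) hne

theorem trigger_of_adj (T : Toggle G G' a b) (hab : π a < π b) (ha : elimRank G π a = π a)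
    (hb : π a ≤ elimRank G π b) (hG : G.Adj a b) :
    elimRank G π b = π a ∧ (π a : ℕ) < elimRank G' π b := by
  have h1 := elimRank_le_of_adj G π hG ha
  refine ⟨by omega, (succ_le_elimRank G' π).2 ⟨(T.le_elimRank_iff_of_le hab le_rfl b).1 hb, ?_⟩⟩
  rintro y hy -
  obtain rfl : y = a := π.injective (Fin.ext hy)
  exact ⟨hG.ne, T.adj.1 hG⟩

/-- If `a` is in the greedy MIS and `b` survives until the position of `a`, then the elimination
rank of `b` changes, and the two scans disagree about `b` from the position of `a` on. -/
theorem trigger (T : Toggle G G' a b) (hab : π a < π b) (ha : elimRank G π a = π a)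
    (hb : π a ≤ elimRank G π b) :
    elimRank G π b ≠ elimRank G' π b ∧ diffRank G G' π b = π a := by
  unfold diffRank
  by_cases hG : G.Adj a b
  · have := T.trigger_of_adj hab ha hb hG
    omega
  · have := T.comm.trigger_of_adj hab (by rw [← T.elimRank_fst hab, ha])
      ((T.le_elimRank_iff_of_le hab le_rfl b).1 hb) (by have := T.adj; tauto)
    omega

theorem waiting_init (T : Toggle G G' a b) (hab : π a < π b) (x : Fin n) :
    x ∈ waiting G G' π (π a + 1) ↔ x = b ∧ elimRank G π a = π a ∧ π a ≤ elimRank G π b := by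
  rw [mem_waiting]
  constructor
  · exact fun h => T.not_trigger_of_lt hab h.1 h.2.1
  · rintro ⟨rfl, ha, hb⟩
    have := T.trigger hab ha hb
    exact ⟨this.1, by omega, hab⟩

theorem mixRank_init (T : Toggle G G' a b) (hab : π a < π b) :
    mixRank G G' π (π a + 1) = elimRank G π := by
  funext x
  by_cases hx : (π x : ℕ) < π a + 1
  · rw [mixRank_of_lt hx]
    have h1 := elimRank_le G π x
    have h2 := elimRank_le G' π x
    exact le_antisymm ((T.le_elimRank_iff_of_le hab (by omega) x).2 le_rfl)
      ((T.le_elimRank_iff_of_le hab (by omega) x).1 le_rfl)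
  · exact mixRank_of_le (by omega)

theorem elimRank_eq_of_not_waiting {s : ℕ} {y : Fin n} (hy : (π y : ℕ) = s)
    (h : y ∉ waiting G G' π s) : elimRank G π y = elimRank G' π y := by
  by_contra hne
  rw [mem_waiting, diffRank] at h
  have h1 := elimRank_le G π y
  have h2 := elimRank_le G' π y
  have : ¬ min (elimRank G π y) (elimRank G' π y) < s := fun hl => h ⟨hne, hl, hy.ge⟩
  omega

theorem waiting_succ_of_not_mem (T : Toggle G G' a b) (hab : π a < π b) {s : ℕ}
    (hs : π a + 1 ≤ s) {y : Fin n} (hy : (π y : ℕ) = s) (h : y ∉ waiting G G' π s) :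
    waiting G G' π (s + 1) = waiting G G' π s := by
  have hk := elimRank_eq_of_not_waiting hy h
  ext x
  rw [mem_waiting, mem_waiting]
  refine and_congr_right fun hx => ?_
  constructor
  · rintro ⟨h1, h2⟩
    refine ⟨lt_of_le_of_ne (by omega) fun e => ?_, by omega⟩
    obtain ⟨y', hy', h'⟩ := T.exists_first hab hx
    obtain rfl : y' = y := π.injective (Fin.ext (by unfold diffRank at e; omega))
    rcases h' with ⟨rfl, -, -⟩ | ⟨hne, -⟩
    · omega
    · exact hne hk
  · rintro ⟨h1, h2⟩
    refine ⟨by omega, lt_of_le_of_ne h2 fun e => ?_⟩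
    obtain rfl : x = y := π.injective (Fin.ext (by omega))
    exact hx hk

theorem jump (T : Toggle G G' a b) (hab : π a < π b) {s s' : ℕ} (hs : π a + 1 ≤ s) (hss : s ≤ s')
    (hn : s' ≤ n) (h : ∀ x ∈ waiting G G' π s, s' ≤ π x) :
    waiting G G' π s' = waiting G G' π s ∧ mixRank G G' π s' = mixRank G G' π s := by
  induction s', hss using Nat.le_induction with
  | base => exact ⟨rfl, rfl⟩
  | succ t ht ih =>
    obtain ⟨ih1, ih2⟩ := ih (by omega) fun x hx => (Nat.le_succ t).trans (h x hx)
    set y := π.symm ⟨t, by omega⟩ with hy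
    have hyt : (π y : ℕ) = t := by simp [hy]
    have hyn : y ∉ waiting G G' π t := fun hy' => by
      have := h y (ih1 ▸ hy'); omega
    refine ⟨(T.waiting_succ_of_not_mem hab (by omega) hyt hyn).trans ih1, ?_⟩
    rw [mixRank_succ hyt, ← ih2, ← elimRank_eq_of_not_waiting hyt hyn, ← mixRank_of_le hyt.ge,
      Function.update_eq_self]

/-- If no vertex waits, all ranks are up to date. -/
theorem mixRank_eq_of_waiting_eq_empty (T : Toggle G G' a b) (hab : π a < π b) {s : ℕ}
    (hs : π a + 1 ≤ s) (hsn : s ≤ n) (h : waiting G G' π s = ∅) :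
    mixRank G G' π s = elimRank G' π := by
  rw [← (T.jump hab hs hsn le_rfl (by simp [h])).2]
  funext x
  exact mixRank_of_lt (π x).2

theorem new_of_adj (T : Toggle G G' a b) (hab : π a < π b) {s : ℕ}
    (hs : π a + 1 ≤ s) {y : Fin n} (hy : (π y : ℕ) = s) (hyw : y ∈ waiting G G' π s)
    (hf : elimRank G π y = s ∨ elimRank G' π y = s) {z : Fin n} (hz : G'.Adj y z)
    (hzs : s ≤ mixRank G G' π s z) (hzw : z ∉ waiting G G' π s) :
    z ∈ waiting G G' π (s + 1) ∧ diffRank G G' π z = s := by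
  have hne := (mem_waiting.1 hyw).1
  have hπz : s < π z := by
    rcases lt_trichotomy (π z : ℕ) s with h | h | h
    · have := mixRank_le (G := G) (G' := G') (π := π) s z; omega
    · exact absurd (π.injective (Fin.ext (hy.trans h.symm))) hz.ne
    · exact h
  rw [mixRank_of_le hπz.le] at hzs
  have hzs' : s ≤ elimRank G' π z := by
    by_cases e : elimRank G π z = elimRank G' π z
    · omega
    · by_contra! hlt
      exact hzw (mem_waiting.2 ⟨e, by unfold diffRank; omega, hπz.le⟩)
  have hadj : G.Adj y z := (T.same y z (by rintro ⟨rfl, -⟩; omega)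
    (by rintro ⟨-, rfl⟩; omega)).2 hz
  have succ : ∀ H : SimpleGraph (Fin n), s ≤ elimRank H π z → elimRank H π y ≠ s →
      s + 1 ≤ elimRank H π z := fun H h1 h2 => by
    refine (succ_le_elimRank H π).2 ⟨h1, fun y' hy' e => ?_⟩
    obtain rfl : y' = y := π.injective (Fin.ext (by omega))
    omega
  rw [mem_waiting, diffRank]
  rcases hf with hf | hf
  · have h1 := elimRank_le_of_adj G π hadj (hf.trans hy.symm)
    have h2 := succ G' hzs' (by omega)
    omega
  · have h1 := elimRank_le_of_adj G' π hz (hf.trans hy.symm)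
    have h2 := succ G hzs (by omega)
    omega

/-- Repairing `y` affects only the neighbours that are stored as surviving until the position of
`y`, and these only if `y` enters or leaves the greedy MIS. -/
theorem mem_waiting_succ (T : Toggle G G' a b) (hab : π a < π b) {s : ℕ}
    (hs : π a + 1 ≤ s) {y : Fin n} (hy : (π y : ℕ) = s) (hyw : y ∈ waiting G G' π s) (z : Fin n) :
    z ∈ waiting G G' π (s + 1) ↔ (z ∈ waiting G G' π s ∧ z ≠ y) ∨
      ((elimRank G π y = s ∨ elimRank G' π y = s) ∧ G'.Adj y z ∧ s ≤ mixRank G G' π s z) := by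
  constructor
  · intro h
    obtain ⟨h1, h2, h3⟩ := mem_waiting.1 h
    rcases Nat.lt_succ_iff_lt_or_eq.1 h2 with h2 | h2
    · exact .inl ⟨mem_waiting.2 ⟨h1, h2, by omega⟩, by rintro rfl; omega⟩
    · obtain ⟨y', hy', h'⟩ := T.exists_first hab h1
      unfold diffRank at h2
      obtain rfl : y' = y := π.injective (Fin.ext (by omega))
      rcases h' with ⟨rfl, -, -⟩ | ⟨-, hf, -, hadj⟩
      · omega
      · rw [hy] at hf
        exact .inr ⟨hf, hadj, by rw [mixRank_of_le (by omega)]; omega⟩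
  · rintro (⟨h, hne⟩ | ⟨hf, hz, hzs⟩)
    · obtain ⟨h1, h2, h3⟩ := mem_waiting.1 h
      have : (π z : ℕ) ≠ s := fun e => hne (π.injective (Fin.ext (e.trans hy.symm)))
      exact mem_waiting.2 ⟨h1, by omega, by omega⟩
    · by_cases hzw : z ∈ waiting G G' π s
      · obtain ⟨h1, h2, h3⟩ := mem_waiting.1 hzw
        have : (π z : ℕ) ≠ s := fun e => hz.ne (π.injective (Fin.ext (hy.trans e.symm)))
        exact mem_waiting.2 ⟨h1, by omega, by omega⟩
      · exact (T.new_of_adj hab hs hy hyw hf hz hzs hzw).1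

end Toggle

section Recompute
variable {n : ℕ} {G G' : SimpleGraph (Fin n)} {π : Equiv.Perm (Fin n)}

/-- The new rank of the vertex at position `s` is determined by the neighbours that are stored as
surviving until the position where the two scans begin to disagree. -/
theorem eq_elimRank_of_min {s : ℕ} {y : Fin n} (hy : (π y : ℕ) = s) {m : ℕ} (hm : m ≤ π y)
    (hm' : m = π y ∨ ∃ z, G'.Adj y z ∧ mixRank G G' π s z = π z ∧ m = π z)
    (hmin : ∀ z, G'.Adj y z → diffRank G G' π y ≤ mixRank G G' π s z →
      mixRank G G' π s z = π z → m ≤ π z) : m = elimRank G' π y := by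
  apply le_antisymm
  · by_cases e : elimRank G' π y = π y
    · omega
    · obtain ⟨z, hz, hz1, hz2⟩ := exists_adj_of_elimRank_ne G' π e
      have hlt : (π z : ℕ) < s := by have := elimRank_le G' π y; omega
      rw [hz2]
      refine hmin z hz.symm ?_ (by rw [mixRank_of_lt hlt, hz1])
      rw [mixRank_of_lt hlt, diffRank]; omega
  · have := elimRank_le G' π y
    rcases hm' with rfl | ⟨z, hz, hz1, rfl⟩
    · exact this
    · by_cases hlt : (π z : ℕ) < s
      · exact elimRank_le_of_adj G' π hz.symm (by rw [← mixRank_of_lt hlt, hz1])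
      · omega

end Recompute

end DynamicMIS

/-! ### The data structure -/

namespace DynamicMIS
open WordRAM

/-- Words of `w` bits can address `n + 1` segment trees with `2 ^ h` leaves each, and a tree has a
leaf for each pair of a position and a vertex. -/
structure Fits (w n h : ℕ) : Prop where
  leaves : n * n < 2 ^ h
  blocks : (n + 1) * (2 ^ h + 2 ^ h) ≤ 2 ^ w
  two_lt : 2 < 2 ^ w

namespace Fits
variable {w n h : ℕ} (F : Fits w n h)
include F

theorem tree_le : 2 ^ h + 2 ^ h ≤ 2 ^ w :=
  le_trans (by nlinarith [Nat.one_le_two_pow (n := h)]) F.blocks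

theorem sq_lt : n * n + n * n < 2 ^ w := by have := F.leaves; have := F.tree_le; omega

theorem lt_of_le {v : ℕ} (hv : v ≤ n) : v < 2 ^ w := by
  rcases Nat.eq_zero_or_pos n with rfl | hn
  · have := F.two_lt; omega
  · nlinarith [F.sq_lt]

theorem one_mod : 1 % 2 ^ w = 1 := Nat.mod_eq_of_lt (by have := F.two_lt; omega)

theorem block_lt {id i : ℕ} (hid : id ≤ n) (hi : i < 2 ^ h + 2 ^ h) :
    id * (2 ^ h + 2 ^ h) + i < 2 ^ w := by
  refine lt_of_lt_of_le ?_ F.blocks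
  rw [Nat.succ_mul]
  have := Nat.mul_le_mul_right (2 ^ h + 2 ^ h) hid
  omega

end Fits

/-- A positive number that encodes the pair of a position `r` and a vertex `x`; keys are ordered by
position first. -/
def key (n r x : ℕ) : ℕ := r * n + x + 1

section Key
variable {n r x : ℕ}

theorem key_le (hr : r < n) (hx : x < n) : key n r x ≤ n * n := by
  unfold key
  have : (r + 1) * n ≤ n * n := Nat.mul_le_mul_right _ hr
  rw [Nat.succ_mul] at this
  omega

theorem key_sub_one_mod (hx : x < n) : (key n r x - 1) % n = x := by
  unfold key
  rw [Nat.add_sub_cancel, mul_comm, Nat.mul_add_mod, Nat.mod_eq_of_lt hx]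

theorem key_injective {r' x' : ℕ} (hx : x < n) (hx' : x' < n) (h : key n r x = key n r' x') :
    r = r' ∧ x = x' :=
  block_injective hx hx' (by unfold key at h; omega)

theorem mul_lt_key {p : ℕ} (hx : x < n) : p * n < key n r x ↔ p ≤ r := by
  unfold key
  constructor
  · intro h
    by_contra! hlt
    have : (r + 1) * n ≤ p * n := Nat.mul_le_mul_right _ hlt
    rw [Nat.succ_mul] at this
    omega
  · intro h
    have := Nat.mul_le_mul_right n h
    omega

end Key

section Keys
variable {n : ℕ} (π : Equiv.Perm (Fin n)) (H : SimpleGraph (Fin n)) (k : Fin n → ℕ)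
  (Q : Finset (Fin n))

open Classical in
/-- The contents of the segment trees: tree `x < n` holds the neighbours `z` of the vertex `x`,
ordered by the position until which both `x` and `z` survive according to `k`; tree `n` is a
priority queue with the vertices of `Q`, the first one having the largest key. -/
noncomputable def treeKeys (id : ℕ) : Finset ℕ :=
  if h : id < n then
    (Finset.univ.filter (H.Adj ⟨id, h⟩)).image fun z => key n (min (k ⟨id, h⟩) (k z)) z
  else if id = n then Q.image fun x => key n (n - 1 - π x) x else ∅

variable {π H k Q}

theorem mem_treeKeys (x : Fin n) {κ : ℕ} : κ ∈ treeKeys π H k Q x ↔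
    ∃ z, H.Adj x z ∧ key n (min (k x) (k z)) z = κ := by
  simp [treeKeys]

theorem mem_treeKeys_queue {κ : ℕ} : κ ∈ treeKeys π H k Q n ↔
    ∃ x ∈ Q, key n (n - 1 - π x) x = κ := by
  simp [treeKeys]

/-- `H` with the edge `xz` inserted or deleted. -/
noncomputable def setAdj (H : SimpleGraph (Fin n)) (x z : Fin n) (b : Bool) :
    SimpleGraph (Fin n) :=
  if b then H ⊔ SimpleGraph.edge x z else H.deleteEdges {s(x, z)}

theorem setAdj_adj {x z : Fin n} (hxz : x ≠ z) {b : Bool} {u v : Fin n} :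
    (setAdj H x z b).Adj u v ↔
      if (u = x ∧ v = z) ∨ (u = z ∧ v = x) then b = true else H.Adj u v := by
  have hd : (u = x ∧ v = z) ∨ (u = z ∧ v = x) → u ≠ v := by
    rintro (⟨rfl, rfl⟩ | ⟨rfl, rfl⟩)
    · exact hxz
    · exact hxz.symm
  cases b
  · simp only [setAdj, Bool.false_eq_true, if_false, SimpleGraph.deleteEdges_adj,
      Set.mem_singleton_iff, Sym2.eq_iff]
    split_ifs with h <;> simp [h]
  · simp only [setAdj, if_true, SimpleGraph.sup_adj, SimpleGraph.edge_adj]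
    split_ifs with h
    · have := hd h; tauto
    · tauto

theorem key_eq_key_iff {r r' : ℕ} {z z' : Fin n} : key n r z = key n r' z' ↔ r = r' ∧ z = z' :=
  ⟨fun h => by have := key_injective z.2 z'.2 h; exact ⟨this.1, Fin.ext this.2⟩,
    by rintro ⟨rfl, rfl⟩; rfl⟩

theorem treeKeys_setAdj {x z : Fin n} (hxz : x ≠ z) (b : Bool) :
    treeKeys π (setAdj H x z b) k Q =
      Function.update (Function.update (treeKeys π H k Q) x
        (setKey (treeKeys π H k Q x) (key n (min (k x) (k z)) z) b)) z
        (setKey (treeKeys π H k Q z) (key n (min (k x) (k z)) x) b) := by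
  funext id
  by_cases hid : id < n
  · obtain ⟨y, rfl⟩ : ∃ y : Fin n, (y : ℕ) = id := ⟨⟨id, hid⟩, rfl⟩
    have main : ∀ x z : Fin n, x ≠ z → treeKeys π (setAdj H x z b) k Q z =
        setKey (treeKeys π H k Q z) (key n (min (k x) (k z)) x) b := by
      intro x z hxz
      ext κ
      rw [mem_treeKeys, mem_setKey, mem_treeKeys]
      simp only [setAdj_adj hxz]
      constructor
      · rintro ⟨v, hv, rfl⟩
        by_cases hvx : v = x
        · subst hvx
          rw [if_pos (by rw [min_comm])]
          simpa using hv
        · rw [if_neg (by simp [key_eq_key_iff, hvx])]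
          rw [if_neg (by rintro (⟨rfl, -⟩ | ⟨-, rfl⟩) <;> simp_all)] at hv
          exact ⟨v, hv, rfl⟩
      · intro h
        split_ifs at h with hκ
        · exact ⟨x, by simpa using h, by rw [hκ, min_comm]⟩
        · obtain ⟨v, hv, rfl⟩ := h
          have hvx : v ≠ x := by rintro rfl; exact hκ (by rw [min_comm])
          refine ⟨v, ?_, rfl⟩
          rw [if_neg (by rintro (⟨rfl, -⟩ | ⟨-, rfl⟩) <;> simp_all)]
          exact hv
    have hsymm : setAdj H x z b = setAdj H z x b := by
      unfold setAdj
      rw [SimpleGraph.edge_comm, Sym2.eq_swap]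
    by_cases hyz : y = z
    · subst hyz
      rw [Function.update_self]
      exact main _ _ hxz
    by_cases hyx : y = x
    · subst hyx
      rw [Function.update_of_ne (by simpa [Fin.val_inj] using hxz), Function.update_self, hsymm,
        min_comm]
      exact main _ _ hxz.symm
    rw [Function.update_of_ne (by simpa [Fin.val_inj] using hyz),
      Function.update_of_ne (by simpa [Fin.val_inj] using hyx)]
    ext κ
    rw [mem_treeKeys, mem_treeKeys]
    simp [setAdj_adj hxz, hyx, hyz]
  · rw [Function.update_of_ne (by have := z.2; omega), Function.update_of_ne (by have := x.2; omega)]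
    simp [treeKeys, hid]

open Classical in
theorem treeKeys_setQueue (x : Fin n) (b : Bool) :
    treeKeys π H k (if b then insert x Q else Q.erase x) =
      Function.update (treeKeys π H k Q) n
        (setKey (treeKeys π H k Q n) (key n (n - 1 - π x) x) b) := by
  funext id
  by_cases hid : id < n
  · rw [Function.update_of_ne (by omega)]
    simp [treeKeys, hid]
  by_cases hid' : id = n
  · subst hid'
    rw [Function.update_self]
    ext κ
    rw [mem_treeKeys_queue, mem_setKey, mem_treeKeys_queue]
    cases b
    · simp only [Bool.false_eq_true, if_false, Finset.mem_erase]
      constructor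
      · rintro ⟨y, hy, rfl⟩
        rw [if_neg (by simp [key_eq_key_iff, hy.1])]
        exact ⟨y, hy.2, rfl⟩
      · intro h
        split_ifs at h with hκ
        obtain ⟨y, hy, rfl⟩ := h
        exact ⟨y, ⟨by rintro rfl; exact hκ rfl, hy⟩, rfl⟩
    · simp only [if_true, Finset.mem_insert]
      constructor
      · rintro ⟨y, rfl | hy, rfl⟩
        · simp
        · split_ifs
          exact ⟨y, hy, rfl⟩
      · intro h
        split_ifs at h with hκ
        · exact ⟨x, .inl rfl, hκ.symm⟩
        · obtain ⟨y, hy, rfl⟩ := h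
          exact ⟨y, .inr hy, rfl⟩
  · rw [Function.update_of_ne hid']
    simp [treeKeys, hid, hid']

end Keys

/-- The state `s` holds the order `π`, the ranks `k`, and the segment trees for the graph `H`, the
ranks `k` and the priority queue `Q`. -/
structure Rep {n : ℕ} (h : ℕ) (π : Equiv.Perm (Fin n)) (H : SimpleGraph (Fin n)) (k : Fin n → ℕ)
    (Q : Finset (Fin n)) (s : State) : Prop where
  size : s.reg 0 = n
  leaves : s.reg 4 = 2 ^ h
  order : ∀ x : Fin n, s.mem 0 x = π x
  ranks : ∀ x : Fin n, s.mem 4 x = k x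
  trees : Trees h n (s.mem 3) (treeKeys π H k Q)

/-- The maximum of the tree whose number is in register `r`. -/
def root (r : ℕ) : Expr := .load 3 (.reg r * (.reg 4 + .reg 4) + .lit 1)

namespace Rep
variable {w n h : ℕ} {π : Equiv.Perm (Fin n)} {H : SimpleGraph (Fin n)} {k : Fin n → ℕ}
  {Q : Finset (Fin n)} {s s' : State}

theorem congr (R : Rep h π H k Q s) (h0 : s'.reg 0 = s.reg 0) (h4 : s'.reg 4 = s.reg 4)
    (m0 : s'.mem 0 = s.mem 0) (m3 : s'.mem 3 = s.mem 3) (m4 : s'.mem 4 = s.mem 4) :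
    Rep h π H k Q s' :=
  ⟨h0.trans R.size, h4.trans R.leaves, fun x => by rw [m0, R.order], fun x => by rw [m4, R.ranks],
    by rw [m3]; exact R.trees⟩

theorem eval_root (R : Rep h π H k Q s) (F : Fits w n h) {r id : ℕ} (hr : s.reg r = id)
    (hid : id ≤ n) : (root r).eval w s = s.mem 3 (id * (2 ^ h + 2 ^ h) + 1) := by
  have h1 : 1 ≤ 2 ^ h := Nat.one_le_two_pow
  have e := F.block_lt hid (i := 1) (by omega)
  have e' := F.block_lt hid (i := 0) (by omega)
  rw [add_zero] at e'
  rcases Nat.eq_zero_or_pos id with rfl | hpos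
  · simp [root, hr, R.leaves, F.one_mod]
  · have : 1 * (2 ^ h + 2 ^ h) ≤ id * (2 ^ h + 2 ^ h) := Nat.mul_le_mul_right _ hpos
    simp [root, hr, R.leaves, F.one_mod, Nat.mod_eq_of_lt e, Nat.mod_eq_of_lt e',
      Nat.mod_eq_of_lt (show 2 ^ h + 2 ^ h < 2 ^ w by omega)]

theorem root_mem (R : Rep h π H k Q s) {id : ℕ} (hid : id ≤ n)
    (h0 : s.mem 3 (id * (2 ^ h + 2 ^ h) + 1) ≠ 0) :
    s.mem 3 (id * (2 ^ h + 2 ^ h) + 1) ∈ treeKeys π H k Q id :=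
  (R.trees id hid).root_mem h0

theorem le_root (R : Rep h π H k Q s) {id κ : ℕ} (hid : id ≤ n) (hκ : κ ∈ treeKeys π H k Q id) :
    κ ≤ s.mem 3 (id * (2 ^ h + 2 ^ h) + 1) :=
  (R.trees id hid).le_root hκ

end Rep

/-- Insert (if register `32` is `1`) or delete (if it is `0`) the edge between the vertices in
registers `30` and `31`. -/
def edgeSet : Prog :=
  .assign 33 (.load 4 (.reg 30)) ;;
  .cond (.op .lt (.load 4 (.reg 31)) (.reg 33)) (.assign 33 (.load 4 (.reg 31))) .nop ;;
  .assign 40 (.reg 30) ;;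
  .assign 41 (.reg 33 * .reg 0 + .reg 31 + .lit 1) ;;
  .assign 42 (.reg 32 * .reg 41) ;;
  treeSet ;;
  .assign 40 (.reg 31) ;;
  .assign 41 (.reg 33 * .reg 0 + .reg 30 + .lit 1) ;;
  .assign 42 (.reg 32 * .reg 41) ;;
  treeSet

/-- Insert (if register `32` is `1`) the vertex in register `30` into the priority queue, or delete
it from there (if register `32` is `0`). -/
def queueSet : Prog :=
  .assign 40 (.reg 0) ;;
  .assign 41 ((.reg 0 - .lit 1 - .load 0 (.reg 30)) * .reg 0 + .reg 30 + .lit 1) ;;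
  .assign 42 (.reg 32 * .reg 41) ;;
  treeSet

section Procedures
variable {w n h : ℕ} {π : Equiv.Perm (Fin n)} {H : SimpleGraph (Fin n)} {k : Fin n → ℕ}
  {Q : Finset (Fin n)} {s : State}

theorem key_mod (F : Fits w n h) {r x : ℕ} (hr : r < n) (hx : x < n) :
    (r * n + x + 1) % 2 ^ w = key n r x := by
  have := key_le hr hx
  have := F.leaves
  have := F.tree_le
  unfold key at *
  rw [Nat.mod_eq_of_lt (show r * n + x + 1 < 2 ^ w by omega)]

theorem flag_key_mod (F : Fits w n h) {r x : ℕ} (hr : r < n) (hx : x < n) (b : Bool) :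
    (if b then key n r x else 0) % 2 ^ w = if b then key n r x else 0 := by
  have := key_le hr hx
  have := F.leaves
  have := F.tree_le
  cases b
  · simp
  · simp [Nat.mod_eq_of_lt (show key n r x < 2 ^ w by omega)]

theorem edgeSet_spec (F : Fits w n h) (R : Rep h π H k Q s) (hk : ∀ x, k x < n) {x z : Fin n}
    (hxz : x ≠ z) {b : Bool} (hx : s.reg 30 = x) (hz : s.reg 31 = z)
    (hb : s.reg 32 = if b then 1 else 0) :
    RunsWithin w edgeSet s (150 * (h + 1)) fun s' => SameBut 33 s s' ∧
      Rep h π (setAdj H x z b) k Q s' := by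
  have hm : min (k x) (k z) < n := by have := hk x; omega
  have hkx := key_le hm x.2
  have hkz := key_le hm z.2
  have hl := F.leaves
  refine RunsWithin.mono (RunsWithin.assign_seq (v := k x) (by simp [hx, R.ranks])
    (RunsWithin.seq (T := 10) (T' := 130 * (h + 1)) (RunsWithin.mono (Q := fun t => t.reg 33 = min (k x) (k z) ∧
      (∀ r < 33, t.reg r = s.reg r) ∧ t.mem = s.mem)
      (RunsWithin.cond (fun hc => RunsWithin.assign ?_) (fun hc => RunsWithin.nop ?_))
      (by simp [Expr.cost]) ?_))) ?_ (fun _ h => h)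
  · have : k z < k x := by by_contra hcon; simp [hz, R.ranks, hcon] at hc
    refine ⟨by simp [hz, R.ranks, min_eq_right this.le], fun r hr => ?_, by simp⟩
    simp [show r ≠ 33 by omega]
  · have : ¬ k z < k x := by intro hcon; simp [hz, R.ranks, hcon] at hc
    refine ⟨by simp [min_eq_left (not_lt.1 this)], fun r hr => ?_, by simp⟩
    simp [show r ≠ 33 by omega]
  · rintro t ⟨h33, hreg, hmem⟩
    refine RunsWithin.mono (RunsWithin.assign_seq (v := x) (by simp [hreg, hx])
      (RunsWithin.assign_seq (v := key n (min (k x) (k z)) z)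
        (by simp [hreg, h33, hz, R.size, F.one_mod, key_mod F hm z.2])
      (RunsWithin.assign_seq (v := if b then key n (min (k x) (k z)) z else 0)
        (by simp [hreg, hb, flag_key_mod F hm z.2])
      (RunsWithin.seq (T' := 65 * (h + 1)) (RunsWithin.mono (treeSet_spec (b := b) F.blocks F.two_lt
        (S := treeKeys π H k Q) (id := x) (κ := key n (min (k x) (k z)) z)
        (by simp [hreg, R.leaves]) (by simp) x.2.le (by simp) (by omega) (by simp)
        (by simpa [hmem] using R.trees)) le_rfl ?_))))) ?_ (fun _ h => h)
    · rintro t' ⟨hs, htr⟩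
      have hreg' : ∀ r < 33, t'.reg r = s.reg r := fun r hr => by
        rw [hs.reg r (by omega)]
        simp [hreg r hr, show r ≠ 40 by omega, show r ≠ 41 by omega, show r ≠ 42 by omega]
      have h33' : t'.reg 33 = min (k x) (k z) := by rw [hs.reg 33 (by omega)]; simp [h33]
      have hmem' : ∀ a, a ≠ 3 → t'.mem a = s.mem a := fun a ha => by
        rw [hs.mem a ha]; simp [hmem]
      refine RunsWithin.mono (RunsWithin.assign_seq (v := z) (by simp [hreg', hz])
        (RunsWithin.assign_seq (v := key n (min (k x) (k z)) x)
          (by simp [hreg', h33', hx, R.size, F.one_mod, key_mod F hm x.2])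
        (RunsWithin.assign_seq (v := if b then key n (min (k x) (k z)) x else 0)
          (by simp [hreg', hb, flag_key_mod F hm x.2])
        (RunsWithin.mono (treeSet_spec (b := b) F.blocks F.two_lt
          (id := z) (κ := key n (min (k x) (k z)) x)
          (by simp [hreg', R.leaves]) (by simp) z.2.le (by simp) (by omega) (by simp)
          (by simpa using htr)) le_rfl ?_)))) ?_ (fun _ h => h)
      · rintro t'' ⟨hs', htr'⟩
        have hreg'' : ∀ r < 33, t''.reg r = s.reg r := fun r hr => by
          rw [hs'.reg r (by omega)]
          simp [hreg' r hr, show r ≠ 40 by omega, show r ≠ 41 by omega, show r ≠ 42 by omega]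
        have hmem'' : ∀ a, a ≠ 3 → t''.mem a = s.mem a := fun a ha => by
          rw [hs'.mem a ha]; simp [hmem' a ha]
        refine ⟨⟨hreg'', hmem''⟩, ⟨by rw [hreg'' 0 (by omega), R.size],
          by rw [hreg'' 4 (by omega), R.leaves], fun y => by rw [hmem'' 0 (by omega), R.order],
          fun y => by rw [hmem'' 4 (by omega), R.ranks], ?_⟩⟩
        rw [treeKeys_setAdj hxz]
        rwa [Function.update_of_ne (by simpa [Fin.val_inj] using hxz.symm)] at htr'
      · simp [Expr.cost]; omega
    · simp [Expr.cost]; omega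
  · simp [Expr.cost]; omega

open Classical in
theorem queueSet_spec (F : Fits w n h) (R : Rep h π H k Q s) {x : Fin n} {b : Bool}
    (hx : s.reg 30 = x) (hb : s.reg 32 = if b then 1 else 0) :
    RunsWithin w queueSet s (70 * (h + 1)) fun s' => SameBut 33 s s' ∧
      Rep h π H k (if b then insert x Q else Q.erase x) s' := by
  have hm : n - 1 - π x < n := by have := (π x).2; omega
  have hkx := key_le hm x.2
  have hl := F.leaves
  have hw := F.two_lt
  have e1 : (n + 2 ^ w - 1) % 2 ^ w = n - 1 := by
    have := (π x).2
    rw [show n + 2 ^ w - 1 = n - 1 + 2 ^ w by omega, Nat.add_mod_right,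
      Nat.mod_eq_of_lt (F.lt_of_le (by omega))]
  have e2 : (n - 1 + 2 ^ w - π x) % 2 ^ w = n - 1 - π x := by
    have := (π x).2
    rw [show n - 1 + 2 ^ w - π x = n - 1 - π x + 2 ^ w by omega, Nat.add_mod_right,
      Nat.mod_eq_of_lt (F.lt_of_le (by omega))]
  refine RunsWithin.mono (RunsWithin.assign_seq (v := n) (by simp [R.size])
    (RunsWithin.assign_seq (v := key n (n - 1 - π x) x)
      (by simp [R.size, hx, R.order, F.one_mod, e1, e2, key_mod F hm x.2])
    (RunsWithin.assign_seq (v := if b then key n (n - 1 - π x) x else 0)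
      (by simp [hb, flag_key_mod F hm x.2])
    (RunsWithin.mono (treeSet_spec (b := b) F.blocks F.two_lt
      (S := treeKeys π H k Q) (id := n) (κ := key n (n - 1 - π x) x)
      (by simp [R.leaves]) (by simp) le_rfl (by simp) (by omega) (by simp)
      (by simpa using R.trees)) le_rfl ?_)))) ?_ (fun _ h => h)
  · rintro t ⟨hs, htr⟩
    have hreg : ∀ r < 33, t.reg r = s.reg r := fun r hr => by
      rw [hs.reg r (by omega)]
      simp [show r ≠ 40 by omega, show r ≠ 41 by omega, show r ≠ 42 by omega]
    have hmem : ∀ a, a ≠ 3 → t.mem a = s.mem a := fun a ha => by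
      rw [hs.mem a ha]; simp
    refine ⟨⟨hreg, hmem⟩, ⟨by rw [hreg 0 (by omega), R.size],
      by rw [hreg 4 (by omega), R.leaves], fun y => by rw [hmem 0 (by omega), R.order],
      fun y => by rw [hmem 4 (by omega), R.ranks], ?_⟩⟩
    rwa [treeKeys_setQueue]
  · simp [Expr.cost]; omega

end Procedures

end DynamicMIS

/-! ### The procedures of the update program -/

namespace DynamicMIS
open WordRAM

/-- In addition to `Rep`, segment `2` holds the characteristic vector of the vertices whose rank is
their own position, and segment `5` holds, for each vertex `x` in the queue, the number `lo x + 1`,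
and `0` for all other vertices. -/
structure Full {n : ℕ} (h : ℕ) (π : Equiv.Perm (Fin n)) (H : SimpleGraph (Fin n)) (k : Fin n → ℕ)
    (Q : Finset (Fin n)) (lo : Fin n → ℕ) (s : State) : Prop extends Rep h π H k Q s where
  marks : ∀ x : Fin n, s.mem 2 x = if k x = π x then 1 else 0
  levels : ∀ x : Fin n, s.mem 5 x = if x ∈ Q then lo x + 1 else 0

/-- The register `0`, the number of leaves, and all segments of the data structure agree. -/
structure SameData (s s' : State) : Prop where
  size : s'.reg 0 = s.reg 0
  leaves : s'.reg 4 = s.reg 4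
  mem : ∀ a < 6, s'.mem a = s.mem a

namespace Full
variable {w n h : ℕ} {π : Equiv.Perm (Fin n)} {H : SimpleGraph (Fin n)} {k : Fin n → ℕ}
  {Q : Finset (Fin n)} {lo : Fin n → ℕ} {s s' : State}

theorem congr (R : Full h π H k Q lo s) (S : SameData s s') : Full h π H k Q lo s' :=
  ⟨R.toRep.congr S.size S.leaves (S.mem 0 (by omega)) (S.mem 3 (by omega)) (S.mem 4 (by omega)),
    fun x => by rw [S.mem 2 (by omega), R.marks], fun x => by rw [S.mem 5 (by omega), R.levels]⟩

end Full

/-- Put the vertex in register `31` into the priority queue, unless it is already there; record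
the position in register `11` for it. -/
def push : Prog :=
  .cond (.load 5 (.reg 31)) .nop (
    .store 5 (.reg 31) (.reg 11 + .lit 1) ;;
    .assign 30 (.reg 31) ;;
    .assign 32 (.lit 1) ;;
    queueSet)

/-- For the vertex `x` in register `8`: remove all edges between `x` and neighbours that survive
until the position in register `9`, list these neighbours in segment `6`, put their number into
register `13`, and compute in register `12` the first position of a vertex of the independent set
among `x` (whose position is in register `11`) and these neighbours. -/
def pull : Prog :=
  .assign 30 (.reg 8) ;;
  .assign 32 (.lit 0) ;;
  .assign 13 (.lit 0) ;;
  .assign 12 (.reg 11) ;;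
  .loop (.op .lt (.reg 9 * .reg 0) (root 8)) (
    .assign 31 ((root 8 - .lit 1) % .reg 0) ;;
    edgeSet ;;
    .store 6 (.reg 13) (.reg 31) ;;
    .assign 13 (.reg 13 + .lit 1) ;;
    .cond (.op .eq (.load 4 (.reg 31)) (.load 0 (.reg 31)))
      (.cond (.op .lt (.load 4 (.reg 31)) (.reg 12)) (.assign 12 (.load 4 (.reg 31))) .nop)
      .nop)

/-- Insert the edges between the vertex in register `8` and the listed neighbours again; if register
`14` is not `0`, put the neighbours that survive until the position in register `11` into the
queue. -/
def pushBack : Prog :=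
  .loop (.reg 13) (
    .assign 13 (.reg 13 - .lit 1) ;;
    .assign 30 (.reg 8) ;;
    .assign 31 (.load 6 (.reg 13)) ;;
    .assign 32 (.lit 1) ;;
    edgeSet ;;
    .cond (.reg 14) (.cond (.op .lt (.load 4 (.reg 31)) (.reg 11)) .nop push) .nop)

section Cut
variable {n : ℕ} {H : SimpleGraph (Fin n)} {x z : Fin n} {l : List (Fin n)}

/-- `H` without the edges between `x` and the vertices of `l`. -/
def cut (H : SimpleGraph (Fin n)) (x : Fin n) (l : List (Fin n)) : SimpleGraph (Fin n) :=
  H.deleteEdges {e | ∃ z ∈ l, e = s(x, z)}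

theorem cut_adj {u v : Fin n} :
    (cut H x l).Adj u v ↔ H.Adj u v ∧ ¬ (u = x ∧ v ∈ l) ∧ ¬ (v = x ∧ u ∈ l) := by
  simp only [cut, SimpleGraph.deleteEdges_adj, Set.mem_ofPred_eq, Sym2.eq_iff]
  refine and_congr_right fun _ => ?_
  constructor
  · intro h
    exact ⟨fun ⟨h1, h2⟩ => h ⟨v, h2, .inl ⟨h1, rfl⟩⟩, fun ⟨h1, h2⟩ => h ⟨u, h2, .inr ⟨rfl, h1⟩⟩⟩
  · rintro ⟨h1, h2⟩ ⟨y, hy, ⟨rfl, rfl⟩ | ⟨rfl, rfl⟩⟩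
    · exact h1 ⟨rfl, hy⟩
    · exact h2 ⟨rfl, hy⟩

theorem cut_nil : cut H x [] = H := by ext u v; simp [cut_adj]

theorem setAdj_cut_false (hxz : x ≠ z) : setAdj (cut H x l) x z false = cut H x (l ++ [z]) := by
  ext u v
  rw [setAdj_adj hxz, cut_adj, cut_adj]
  simp only [List.mem_append, List.mem_singleton]
  split_ifs with h
  · simp; tauto
  · tauto

theorem setAdj_cut_true (hadj : H.Adj x z) (hz : z ∉ l) :
    setAdj (cut H x (l ++ [z])) x z true = cut H x l := by
  ext u v
  rw [setAdj_adj hadj.ne, cut_adj, cut_adj]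
  simp only [List.mem_append, List.mem_singleton]
  split_ifs with h
  · rcases h with ⟨rfl, rfl⟩ | ⟨rfl, rfl⟩
    · simp [hadj, hz, hadj.ne.symm]
    · simp [hadj.symm, hz, hadj.ne.symm]
  · tauto

end Cut

section Specs
variable {w n h : ℕ} {π : Equiv.Perm (Fin n)} {H : SimpleGraph (Fin n)} {k : Fin n → ℕ}
  {Q : Finset (Fin n)} {lo : Fin n → ℕ} {s : State}

theorem push_spec (F : Fits w n h) (R : Full h π H k Q lo s) {z : Fin n} {p : ℕ}
    (hz : s.reg 31 = z) (hp : s.reg 11 = p) (hpn : p < n) (hlo : z ∉ Q → lo z = p) :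
    RunsWithin w push s (85 * (h + 1)) fun s' => Full h π H k (insert z Q) lo s' ∧
      (∀ r < 30, s'.reg r = s.reg r) ∧ s'.mem 1 = s.mem 1 ∧ s'.mem 6 = s.mem 6 := by
  classical
  refine RunsWithin.mono (RunsWithin.cond (T' := 80 * (h + 1)) (fun hc => RunsWithin.nop ?_)
    (fun hc => ?_)) ?_ (fun _ h => h)
  · have hzQ : z ∈ Q := by by_contra hcon; simp [hz, R.levels, hcon] at hc
    rw [Finset.insert_eq_of_mem hzQ]
    exact ⟨R, fun _ _ => rfl, rfl, rfl⟩
  · have hzQ : z ∉ Q := by intro hcon; simp [hz, R.levels, hcon] at hc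
    refine RunsWithin.mono (RunsWithin.store_seq (j := z) (v := p + 1) (by simp [hz])
      (by simp [hp, F.one_mod, Nat.mod_eq_of_lt (F.lt_of_le (show p + 1 ≤ n by omega))])
      (RunsWithin.assign_seq (v := z) (by simp [hz])
      (RunsWithin.assign_seq (v := 1) (by simp [F.one_mod])
      (RunsWithin.mono (queueSet_spec F (π := π) (H := H) (k := k) (Q := Q) (x := z) (b := true)
        ?_ (by simp) (by simp)) le_rfl ?_)))) ?_ (fun _ h => h)
    · exact R.toRep.congr (by simp) (by simp) (by simp [State.mem_setMem])
        (by simp [State.mem_setMem]) (by simp [State.mem_setMem])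
    · rintro t ⟨hs, hR⟩
      simp only [if_true] at hR
      refine ⟨⟨hR, fun x => ?_, fun x => ?_⟩, fun r hr => ?_, ?_, ?_⟩
      · rw [hs.mem 2 (by omega)]
        simp [State.mem_setMem, R.marks]
      · rw [hs.mem 5 (by omega)]
        simp only [State.mem_setReg, State.mem_setMem_self, Function.update_apply, Fin.val_inj,
          R.levels, Finset.mem_insert]
        by_cases hx : x = z
        · subst hx; simp [hlo hzQ]
        · simp [hx]
      · rw [hs.reg r (by omega)]
        simp [show r ≠ 32 by omega, show r ≠ 30 by omega]
      · rw [hs.mem 1 (by omega)]; simp [State.mem_setMem]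
      · rw [hs.mem 6 (by omega)]; simp [State.mem_setMem]
    · simp [Expr.cost]; omega
  · simp [Expr.cost]; omega

theorem length_lt_of_new {l : List (Fin n)} {S : Finset (Fin n)} (hl : l.Nodup)
    (hS : ∀ y ∈ l, y ∈ S) {z : Fin n} (hz : z ∉ l) (hzS : z ∈ S) : l.length + 1 ≤ S.card := by
  classical
  have h1 : (z :: l).toFinset.card = l.length + 1 := by
    rw [List.toFinset_card_of_nodup (List.nodup_cons.2 ⟨hz, hl⟩), List.length_cons]
  rw [← h1]
  refine Finset.card_le_card fun y hy => ?_
  rw [List.mem_toFinset, List.mem_cons] at hy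
  rcases hy with rfl | hy
  · exact hzS
  · exact hS y hy

open Classical in
/-- The neighbours of `x` that survive until position `p` are those with a key above `p * n` in the
tree of `x`, since `x` itself survives until `p`. They are found one by one at the root of the tree
and disappear from it when their edge is removed. -/
theorem pull_spec (F : Fits w n h) (R : Full h π H k Q lo s) (hk : ∀ x, k x < n) {x : Fin n}
    {p : ℕ} (hx : s.reg 8 = x) (hp : s.reg 9 = p) (hπ : s.reg 11 = π x) (hpk : p ≤ k x) :
    RunsWithin w pull s
      (230 * (h + 1) * ((Finset.univ.filter fun z => H.Adj x z ∧ p ≤ k z).card + 1)) fun s' =>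
      ∃ l : List (Fin n), l.Nodup ∧ (∀ z, z ∈ l ↔ H.Adj x z ∧ p ≤ k z) ∧
        s'.reg 13 = l.length ∧ (∀ i (z : Fin n), l[i]? = some z → s'.mem 6 i = z) ∧
        Full h π (cut H x l) k Q lo s' ∧
        (s'.reg 12 ≤ π x ∧ (s'.reg 12 = π x ∨ ∃ z ∈ l, k z = π z ∧ s'.reg 12 = π z) ∧
          ∀ z ∈ l, k z = π z → s'.reg 12 ≤ π z) ∧
        (∀ r < 12, s'.reg r = s.reg r) ∧ s'.mem 1 = s.mem 1 := by
  set D := (Finset.univ.filter fun z => H.Adj x z ∧ p ≤ k z).card with hD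
  have hpn : p * n < 2 ^ w := by
    have : p * n ≤ n * n := Nat.mul_le_mul_right _ (hpk.trans (hk x).le)
    have := F.leaves; have := F.tree_le; omega
  unfold pull
  refine RunsWithin.mono (RunsWithin.assign_seq (v := x) (by simp [hx])
    (RunsWithin.assign_seq (v := 0) (by simp)
    (RunsWithin.assign_seq (v := 0) (by simp)
    (RunsWithin.assign_seq (v := π x) (by simp [hπ])
    (RunsWithin.loop (T := 230 * (h + 1) * D + 15) (fun c t => ∃ l : List (Fin n),
      l.Nodup ∧ (∀ z ∈ l, H.Adj x z ∧ p ≤ k z) ∧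
      t.reg 13 = l.length ∧ (∀ i (z : Fin n), l[i]? = some z → t.mem 6 i = z) ∧
        Full h π (cut H x l) k Q lo t ∧
        (t.reg 12 ≤ π x ∧ (t.reg 12 = π x ∨ ∃ z ∈ l, k z = π z ∧ t.reg 12 = π z) ∧
          ∀ z ∈ l, k z = π z → t.reg 12 ≤ π z) ∧
        (∀ r < 12, t.reg r = s.reg r) ∧ t.mem 1 = s.mem 1 ∧ t.reg 30 = x ∧ t.reg 32 = 0 ∧
        c = 230 * (h + 1) * (D - l.length) + 15) ?_ ?_))))) ?_ (fun _ h => h)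
  -- in the invariant, `l` lists the neighbours that have been removed so far
  · rintro c t ⟨l, hl, hlS, h13, h6, Rt, hm, hreg, hm1, h30, h32, rfl⟩
    have e8 : t.reg 8 = x := by rw [hreg 8 (by omega), hx]
    have e9 : t.reg 9 = p := by rw [hreg 9 (by omega), hp]
    have eroot := Rt.toRep.eval_root F e8 x.2.le
    set κ := t.mem 3 (x * (2 ^ h + 2 ^ h) + 1) with hκ
    have econd : (Expr.op .lt (.reg 9 * .reg 0) (root 8)).eval w t = if p * n < κ then 1 else 0 := by
      simp only [Expr.eval_lt, Expr.eval_mul, Expr.eval_reg, e9, Rt.size, eroot,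
        Nat.mod_eq_of_lt hpn]
    rw [econd]
    have ecost : (Expr.op .lt (.reg 9 * .reg 0) (root 8)).cost = 12 := by
      simp [Expr.cost, root]
    by_cases hlt : p * n < κ
    · right
      obtain ⟨z, hz, hzκ⟩ := (mem_treeKeys x).1 (Rt.root_mem x.2.le (by omega))
      rw [← hκ] at hzκ
      have hpz : p ≤ min (k x) (k z) := (mul_lt_key z.2).1 (by rw [hzκ]; exact hlt)
      have hxz : H.Adj x z := (cut_adj.1 hz).1
      have hzl : z ∉ l := fun hcon => (cut_adj.1 hz).2.1 ⟨rfl, hcon⟩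
      have hDl : l.length + 1 ≤ D := length_lt_of_new hl
        (fun y hy => Finset.mem_filter.2 ⟨Finset.mem_univ _, hlS y hy⟩) hzl
        (Finset.mem_filter.2 ⟨Finset.mem_univ _, hxz, by omega⟩)
      have hDn : D ≤ n := by simpa using Finset.card_le_univ (Finset.univ.filter fun z => H.Adj x z ∧ p ≤ k z)
      have hκw : key n (min (k x) (k z)) z < 2 ^ w := by
        have := key_le (show min (k x) (k z) < n by have := hk x; omega) z.2
        have := F.leaves; have := F.tree_le; omega
      have hn : n < 2 ^ w := F.lt_of_le le_rfl
      have hzw : (z : ℕ) < 2 ^ w := z.2.trans hn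
      have hκ1 : key n (min (k x) (k z)) z - 1 < 2 ^ w := by omega
      have e31 : ((root 8 - .lit 1) % .reg 0 : Expr).eval w t = z := by
        simp only [Expr.eval_mod, Expr.eval_sub, eroot, Expr.eval_lit, Expr.eval_reg, F.one_mod,
          Rt.size, ← hzκ]
        have hpos : 1 ≤ key n (min (k x) (k z)) z := by unfold key; omega
        rw [show key n (min (k x) (k z)) z + 2 ^ w - 1 = key n (min (k x) (k z)) z - 1 + 2 ^ w
          by omega, Nat.add_mod_right, Nat.mod_eq_of_lt hκ1, key_sub_one_mod z.2, Nat.mod_eq_of_lt hzw]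
      refine ⟨by simp [hlt], 215 * (h + 1), 230 * (h + 1) * (D - (l.length + 1)) + 15, ?_, ?_⟩
      · rw [ecost]
        obtain ⟨d, hd⟩ := Nat.exists_eq_add_of_le hDl
        rw [show D - (l.length + 1) = d by omega, show D - l.length = d + 1 by omega,
          Nat.mul_succ (230 * (h + 1))]
        omega
      refine RunsWithin.mono (RunsWithin.assign_seq e31 (RunsWithin.seq (T' := 50)
        (RunsWithin.mono (edgeSet_spec F (H := cut H x l) (Q := Q) (π := π) (b := false)
          (Rt.toRep.congr (by simp) (by simp) (by simp) (by simp) (by simp)) hk hxz.ne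
          (by simp [h30]) (by simp) (by simp [h32])) le_rfl ?_))) ?_ (fun _ h => h)
      · rintro t' ⟨hs, Rt'⟩
        rw [setAdj_cut_false hxz.ne] at Rt'
        have Ft' : Full h π (cut H x (l ++ [z])) k Q lo t' :=
          ⟨Rt', fun y => by rw [hs.mem 2 (by omega)]; simp [Rt.marks],
            fun y => by rw [hs.mem 5 (by omega)]; simp [Rt.levels]⟩
        have f13 : t'.reg 13 = l.length := by rw [hs.reg 13 (by omega)]; simp [h13]
        have f31 : t'.reg 31 = z := by rw [hs.reg 31 (by omega)]; simp
        have f12 : t'.reg 12 = t.reg 12 := by rw [hs.reg 12 (by omega)]; simp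
        have f6 : t'.mem 6 = t.mem 6 := by rw [hs.mem 6 (by omega)]; simp
        set u := (t'.setMem 6 l.length z).setReg 13 (l.length + 1) with hu
        have Fu : Full h π (cut H x (l ++ [z])) k Q lo u := Ft'.congr
          ⟨by simp [hu], by simp [hu], fun a ha => by
            simp [hu, State.mem_setMem_of_ne (show a ≠ 6 by omega)]⟩
        have u6 : ∀ i (y : Fin n), (l ++ [z])[i]? = some y → u.mem 6 i = y := by
          intro i y hy
          simp only [hu, State.mem_setReg, State.mem_setMem_self, Function.update_apply, f6]
          rcases lt_trichotomy i l.length with hi | hi | hi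
          · rw [List.getElem?_append_left hi] at hy
            rw [if_neg (by omega), h6 i y hy]
          · subst hi
            simp at hy
            simp [hy]
          · rw [List.getElem?_eq_none (by simp; omega)] at hy
            simp at hy
        have ureg : ∀ r < 12, u.reg r = s.reg r := fun r hr => by
          simp only [hu, State.reg_setReg, State.reg_setMem, show r ≠ 13 by omega, if_false]
          rw [hs.reg r (by omega)]
          simp [show r ≠ 31 by omega, hreg r hr]
        have um1 : u.mem 1 = s.mem 1 := by
          simp only [hu, State.mem_setReg]
          rw [State.mem_setMem_of_ne (by omega), hs.mem 1 (by omega)]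
          simp [hm1]
        have u30 : u.reg 30 = x := by
          simp only [hu, State.reg_setReg, State.reg_setMem]
          rw [hs.reg 30 (by omega)]; simp [h30]
        have u32 : u.reg 32 = 0 := by
          simp only [hu, State.reg_setReg, State.reg_setMem]
          rw [hs.reg 32 (by omega)]; simp [h32]
        have u12 : u.reg 12 = t.reg 12 := by simp [hu, f12]
        have u31 : u.reg 31 = z := by simp [hu, f31]
        have hnd : (l ++ [z]).Nodup := by
          rw [List.nodup_append]
          exact ⟨hl, List.nodup_singleton _, by
            intro y hy y' hy'
            rw [List.mem_singleton] at hy'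
            subst hy'
            rintro rfl; exact hzl hy⟩
        have hlS' : ∀ y ∈ l ++ [z], H.Adj x y ∧ p ≤ k y := by
          intro y hy
          rw [List.mem_append, List.mem_singleton] at hy
          rcases hy with hy | rfl
          · exact hlS y hy
          · exact ⟨hxz, by omega⟩
        have hll : (l ++ [z]).length = l.length + 1 := by simp
        -- the invariant after this round, for each way to update the minimum in register `12`
        have wrap : ∀ v : State, SameData u v → v.mem 6 = u.mem 6 →
            (∀ r, r ≠ 12 → v.reg r = u.reg r) →
            (v.reg 12 ≤ π x ∧ (v.reg 12 = π x ∨ ∃ z' ∈ l ++ [z], k z' = π z' ∧ v.reg 12 = π z') ∧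
              ∀ z' ∈ l ++ [z], k z' = π z' → v.reg 12 ≤ π z') → _ := fun v hv1 hv2 hv3 hv4 =>
          (⟨l ++ [z], hnd, hlS', by rw [hv3 13 (by omega), hll]; simp [hu],
            fun i y hy => by rw [hv2, u6 i y hy], Fu.congr hv1, hv4,
            fun r hr => by rw [hv3 r (by omega), ureg r hr], by rw [hv1.mem 1 (by omega), um1],
            by rw [hv3 30 (by omega), u30], by rw [hv3 32 (by omega), u32], by rw [hll]⟩ :
          ∃ l' : List (Fin n), l'.Nodup ∧ (∀ z ∈ l', H.Adj x z ∧ p ≤ k z) ∧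
            v.reg 13 = l'.length ∧ (∀ i (z : Fin n), l'[i]? = some z → v.mem 6 i = z) ∧
            Full h π (cut H x l') k Q lo v ∧
            (v.reg 12 ≤ π x ∧ (v.reg 12 = π x ∨ ∃ z ∈ l', k z = π z ∧ v.reg 12 = π z) ∧
              ∀ z ∈ l', k z = π z → v.reg 12 ≤ π z) ∧
            (∀ r < 12, v.reg r = s.reg r) ∧ v.mem 1 = s.mem 1 ∧ v.reg 30 = x ∧ v.reg 32 = 0 ∧
            230 * (h + 1) * (D - (l.length + 1)) + 15 = 230 * (h + 1) * (D - l'.length) + 15)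
        obtain ⟨hm1', hm2, hm3⟩ := hm
        have uz4 : u.mem 4 z = k z := Fu.ranks z
        have uz0 : u.mem 0 z = π z := Fu.order z
        refine RunsWithin.mono (RunsWithin.store_seq (j := l.length) (v := z) (by simp [f13])
          (by simp [f31]) (RunsWithin.assign_seq (v := l.length + 1)
            (by simp [f13, F.one_mod, Nat.mod_eq_of_lt (F.lt_of_le (show l.length + 1 ≤ n by omega))])
          (RunsWithin.cond (fun hc => RunsWithin.cond (fun hc' => RunsWithin.assign ?_)
            (fun hc' => RunsWithin.nop ?_)) (fun hc => RunsWithin.nop ?_)))) ?_ (fun _ h => h)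
        · rw [← hu] at hc hc' ⊢
          have hzM : k z = π z := by by_contra hcon; simp [u31, uz4, uz0, hcon] at hc
          have hlt' : k z < t.reg 12 := by by_contra hcon; simp [u31, uz4, u12, hcon] at hc'
          refine wrap _ ⟨by simp, by simp, fun a _ => by simp⟩ (by simp)
            (fun r hr => by simp [hr]) ?_
          simp only [State.reg_setReg, if_true, Expr.eval_load, Expr.eval_reg, u31, uz4]
          refine ⟨by omega, .inr ⟨z, by simp, hzM, hzM⟩, fun y hy hyM => ?_⟩
          rw [List.mem_append, List.mem_singleton] at hy
          rcases hy with hy | rfl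
          · have := hm3 y hy hyM; omega
          · omega
        · rw [← hu] at hc hc' ⊢
          have hzM : k z = π z := by by_contra hcon; simp [u31, uz4, uz0, hcon] at hc
          have hlt' : ¬ k z < t.reg 12 := by intro hcon; simp [u31, uz4, u12, hcon] at hc'
          refine wrap _ ⟨rfl, rfl, fun a _ => rfl⟩ rfl (fun r hr => rfl) ?_
          rw [u12]
          refine ⟨hm1', hm2.imp_right fun ⟨y, hy, h'⟩ => ⟨y, by simp [hy], h'⟩, fun y hy hyM => ?_⟩
          rw [List.mem_append, List.mem_singleton] at hy
          rcases hy with hy | rfl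
          · exact hm3 y hy hyM
          · omega
        · rw [← hu] at hc ⊢
          have hzM : k z ≠ π z := by intro hcon; simp [u31, uz4, uz0, hcon] at hc
          refine wrap _ ⟨rfl, rfl, fun a _ => rfl⟩ rfl (fun r hr => rfl) ?_
          rw [u12]
          refine ⟨hm1', hm2.imp_right fun ⟨y, hy, h'⟩ => ⟨y, by simp [hy], h'⟩, fun y hy hyM => ?_⟩
          rw [List.mem_append, List.mem_singleton] at hy
          rcases hy with hy | rfl
          · exact hm3 y hy hyM
          · exact absurd hyM hzM
        · simp [Expr.cost]
      · simp [Expr.cost, root]; omega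
    · left
      refine ⟨by simp [hlt], by rw [ecost]; omega, l, hl, fun z => ⟨hlS z, fun ⟨h1, h2⟩ => ?_⟩, h13, h6, Rt,
        hm, hreg, hm1⟩
      by_contra hzl
      have hadj : (cut H x l).Adj x z := cut_adj.2 ⟨h1, fun h => hzl h.2, fun h => h1.ne h.1.symm⟩
      have hle := Rt.le_root x.2.le ((mem_treeKeys x).2 ⟨z, hadj, rfl⟩)
      have : p * n < key n (min (k x) (k z)) z := (mul_lt_key z.2).2 (by omega)
      omega
  · refine ⟨[], List.nodup_nil, by simp, by simp, by simp, ?_, ?_, fun r hr => ?_, by simp, by simp,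
      by simp, by simp⟩
    · rw [cut_nil]
      exact R.congr ⟨by simp, by simp, fun a _ => by simp⟩
    · simp
    · simp [show r ≠ 12 by omega, show r ≠ 13 by omega, show r ≠ 30 by omega, show r ≠ 32 by omega]
  · simp only [Expr.cost]
    nlinarith

/-- The listed neighbours with `p ≤ k z` are queued if `b` holds. The assumption `hlo` says that
`p` is the right level to record for those that are not in the queue yet. -/
theorem pushBack_spec (F : Fits w n h) (hk : ∀ x, k x < n) {x : Fin n} {p : ℕ} {b : Prop}
    {l : List (Fin n)} (R : Full h π (cut H x l) k Q lo s)
    (hx : s.reg 8 = x) (hp : s.reg 11 = p) (hpn : p < n) (hb : s.reg 14 ≠ 0 ↔ b)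
    (h13 : s.reg 13 = l.length) (h6 : ∀ i (z : Fin n), l[i]? = some z → s.mem 6 i = z)
    (hl : l.Nodup) (hH : ∀ z ∈ l, H.Adj x z)
    (hlo : ∀ z ∈ l, b → p ≤ k z → z ∉ Q → lo z = p) :
    RunsWithin w pushBack s (270 * (h + 1) * l.length + 2) fun s' =>
      ∃ Q', Full h π H k Q' lo s' ∧ (∀ z, z ∈ Q' ↔ z ∈ Q ∨ (b ∧ z ∈ l ∧ p ≤ k z)) ∧
        (∀ r < 12, s'.reg r = s.reg r) ∧ s'.mem 1 = s.mem 1 := by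
  classical
  unfold pushBack
  refine RunsWithin.loop (fun c t => ∃ l₁ l₂ Q', l = l₁ ++ l₂ ∧ Full h π (cut H x l₁) k Q' lo t ∧
    (∀ z, z ∈ Q' ↔ z ∈ Q ∨ (b ∧ z ∈ l₂ ∧ p ≤ k z)) ∧ t.reg 13 = l₁.length ∧
    (t.reg 14 ≠ 0 ↔ b) ∧ (∀ r < 12, t.reg r = s.reg r) ∧ t.mem 1 = s.mem 1 ∧ t.mem 6 = s.mem 6 ∧
    c = 270 * (h + 1) * l₁.length + 2) ?_ ⟨l, [], Q, by simp, R, by simp, h13, hb, fun _ _ => rfl,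
      rfl, rfl, rfl⟩
  -- the edges to `l₁` are still missing, those to `l₂` have been inserted again
  rintro c t ⟨l₁, l₂, Q', hll, Rt, hQ', t13, t14, treg, tm1, tm6, rfl⟩
  rcases List.eq_nil_or_concat l₁ with rfl | ⟨l₁, z, rfl⟩
  · left
    rw [cut_nil] at Rt
    refine ⟨by simp [t13], by simp [Expr.cost], Q', Rt, ?_, treg, tm1⟩
    simpa [hll] using hQ'
  · right
    have hlen : l.length ≤ n := by simpa using hl.length_le_card
    have hlen' : l₁.length + 1 ≤ l.length := by rw [hll]; simp
    have hzl : z ∈ l := by simp [hll]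
    have hxz := hH z hzl
    have hz₁ : z ∉ l₁ := by
      intro hcon
      rw [hll, List.concat_eq_append, List.append_assoc, List.nodup_append] at hl
      exact hl.2.2 z hcon z (by simp) rfl
    have t6 : t.mem 6 l₁.length = z := by
      rw [tm6]
      exact h6 _ _ (by rw [hll]; simp)
    have hn := F.lt_of_le (v := l₁.length) (by omega)
    refine ⟨by simp [t13], 265 * (h + 1), 270 * (h + 1) * l₁.length + 2, ?_, ?_⟩
    · simp only [Expr.cost, List.concat_eq_append, List.length_append, List.length_singleton,
        Nat.mul_succ (270 * (h + 1))]
      omega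
    rw [List.concat_eq_append] at Rt t13 hll
    refine RunsWithin.mono (RunsWithin.assign_seq (v := l₁.length) ?_
      (RunsWithin.assign_seq (v := x) (by simp [treg, hx])
      (RunsWithin.assign_seq (v := z) (by simp [t6])
      (RunsWithin.assign_seq (v := 1) (by simp [F.one_mod])
      (RunsWithin.seq (T' := 100 * (h + 1))
         (RunsWithin.mono (edgeSet_spec F (H := cut H x (l₁ ++ [z])) (Q := Q') (π := π) (b := true)
          (Rt.toRep.congr (by simp) (by simp) (by simp) (by simp) (by simp)) hk hxz.ne
          (by simp) (by simp) (by simp)) le_rfl ?_)))))) ?_ (fun _ h => h)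
    · simp only [Expr.eval_sub, Expr.eval_reg, t13, Expr.eval_lit, F.one_mod, List.length_append,
        List.length_singleton]
      rw [show l₁.length + 1 + 2 ^ w - 1 = l₁.length + 2 ^ w by omega, Nat.add_mod_right,
        Nat.mod_eq_of_lt hn]
    · rintro u ⟨hs, Ru⟩
      rw [setAdj_cut_true hxz hz₁] at Ru
      have Fu : Full h π (cut H x l₁) k Q' lo u :=
        ⟨Ru, fun y => by rw [hs.mem 2 (by omega)]; simp [Rt.marks],
          fun y => by rw [hs.mem 5 (by omega)]; simp [Rt.levels]⟩
      have ureg : ∀ r < 12, u.reg r = s.reg r := fun r hr => by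
        rw [hs.reg r (by omega)]
        simp [show r ≠ 13 by omega, show r ≠ 30 by omega, show r ≠ 31 by omega,
          show r ≠ 32 by omega, treg r hr]
      have u13 : u.reg 13 = l₁.length := by rw [hs.reg 13 (by omega)]; simp
      have u14 : u.reg 14 ≠ 0 ↔ b := by rw [hs.reg 14 (by omega)]; simpa using t14
      have u31 : u.reg 31 = z := by rw [hs.reg 31 (by omega)]; simp
      have um1 : u.mem 1 = s.mem 1 := by rw [hs.mem 1 (by omega)]; simp [tm1]
      have um6 : u.mem 6 = s.mem 6 := by rw [hs.mem 6 (by omega)]; simp [tm6]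
      have u11 : u.reg 11 = p := by rw [ureg 11 (by omega), hp]
      have uz := Fu.ranks z
      have hll' : l = l₁ ++ (z :: l₂) := by rw [hll]; simp
      -- a neighbour that need not be queued leaves the queue as it is
      have skip : ¬ (b ∧ p ≤ k z) → ∀ y, y ∈ Q' ↔ y ∈ Q ∨ (b ∧ y ∈ z :: l₂ ∧ p ≤ k y) := by
        intro hz y
        rw [hQ', List.mem_cons]
        constructor
        · rintro (h | ⟨h1, h2, h3⟩)
          · exact .inl h
          · exact .inr ⟨h1, .inr h2, h3⟩
        · rintro (h | ⟨h1, rfl | h2, h3⟩)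
          · exact .inl h
          · exact absurd ⟨h1, h3⟩ hz
          · exact .inr ⟨h1, h2, h3⟩
      refine RunsWithin.mono (RunsWithin.cond (fun hc => RunsWithin.cond
        (fun hc' => RunsWithin.nop ?_) (fun hc' => RunsWithin.mono
          (push_spec F Fu u31 u11 hpn ?_) le_rfl ?_)) (fun hc => RunsWithin.nop ?_)) ?_
        (fun _ h => h)
      · have : k z < p := by by_contra hcon; simp [u31, uz, u11, hcon] at hc'
        exact ⟨l₁, z :: l₂, Q', hll', Fu, skip (by omega), u13, u14, ureg, um1, um6, rfl⟩
      · have hpz : ¬ k z < p := by intro hcon; simp [u31, uz, u11, hcon] at hc'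
        intro hzQ
        exact hlo z hzl (u14.1 hc) (by omega) fun hcon => hzQ ((hQ' z).2 (.inl hcon))
      · have hpz : ¬ k z < p := by intro hcon; simp [u31, uz, u11, hcon] at hc'
        have hb' := u14.1 hc
        rintro v ⟨Rv, vreg, vm1, vm6⟩
        refine ⟨l₁, z :: l₂, insert z Q', hll', Rv, fun y => ?_, by rw [vreg 13 (by omega), u13],
          by rw [vreg 14 (by omega)]; exact u14, fun r hr => by rw [vreg r (by omega), ureg r hr],
          vm1.trans um1, vm6.trans um6, rfl⟩
        rw [Finset.mem_insert, hQ', List.mem_cons]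
        constructor
        · rintro (rfl | h | ⟨h1, h2, h3⟩)
          · exact .inr ⟨hb', .inl rfl, by omega⟩
          · exact .inl h
          · exact .inr ⟨h1, .inr h2, h3⟩
        · rintro (h | ⟨h1, rfl | h2, h3⟩)
          · exact .inr (.inl h)
          · exact .inl rfl
          · exact .inr (.inr ⟨h1, h2, h3⟩)
      · have hnb : ¬ b := fun hb' => (u14.2 hb') hc
        exact ⟨l₁, z :: l₂, Q', hll', Fu, skip (fun h => hnb h.1), u13, u14, ureg, um1, um6, rfl⟩
      · simp [Expr.cost]; omega
    · simp [Expr.cost]; omega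

end Specs

end DynamicMIS

/-! ### The update program -/

namespace DynamicMIS
open WordRAM

/-- Repair the vertex of the queue that comes first in the order. -/
def repair : Prog :=
  .assign 8 ((root 0 - .lit 1) % .reg 0) ;;
  .assign 30 (.reg 8) ;;
  .assign 32 (.lit 0) ;;
  queueSet ;;
  .assign 9 (.load 5 (.reg 8) - .lit 1) ;;
  .store 5 (.reg 8) (.lit 0) ;;
  .assign 10 (.load 4 (.reg 8)) ;;
  .assign 11 (.load 0 (.reg 8)) ;;
  pull ;;
  .store 4 (.reg 8) (.reg 12) ;;
  .store 2 (.reg 8) (.op .eq (.reg 12) (.reg 11)) ;;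
  .assign 14 (.op .eq (.reg 10) (.reg 11) + .op .eq (.reg 12) (.reg 11)) ;;
  pushBack

/-- Toggle the edge between the vertices in registers `30` and `31`, queue the second one, which
comes later in the order, if its rank changes, and repair vertices until the queue is empty. -/
def updateOrdered : Prog :=
  .assign 32 (.reg 1) ;;
  edgeSet ;;
  .assign 11 (.load 0 (.reg 30)) ;;
  .cond (.op .eq (.load 4 (.reg 30)) (.reg 11))
    (.cond (.op .lt (.load 4 (.reg 31)) (.reg 11)) .nop push) .nop ;;
  .loop (root 0) repair

/-- The update program: order the endpoints of the announced edge by position, and process the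
edge. -/
def updateProg : Prog :=
  .cond (.op .lt (.load 0 (.reg 2)) (.load 0 (.reg 3)))
    (.assign 30 (.reg 2) ;; .assign 31 (.reg 3))
    (.assign 30 (.reg 3) ;; .assign 31 (.reg 2)) ;;
  updateOrdered

section Cost
variable {n : ℕ} (G G' : SimpleGraph (Fin n)) (π : Equiv.Perm (Fin n))

open Classical in
/-- The number of neighbours of `x` that survive the first `s` positions. -/
noncomputable def aliveDegree (s : ℕ) (x : Fin n) : ℕ :=
  (Finset.univ.filter fun z => G.Adj x z ∧ s ≤ elimRank G π z).card

open Classical in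
/-- The total cost, up to a logarithmic factor, of repairing all vertices from position `s` on whose
elimination rank changes. -/
noncomputable def repairCost (s : ℕ) : ℕ :=
  ∑ x ∈ Finset.univ.filter (fun x => elimRank G π x ≠ elimRank G' π x ∧ s ≤ π x),
    (aliveDegree G π (diffRank G G' π x) x + aliveDegree G' π (diffRank G G' π x) x + 2)

variable {G G' π} {a b : Fin n}

open Classical in
/-- The stored ranks are old or new ones, so the number of neighbours that `pull` visits is bounded by
the alive degrees in the two scans; the summand `1` accounts for the other endpoint of the toggled
edge. -/
theorem card_mixRank_le (T : Toggle G G' a b) (s p : ℕ) (y : Fin n) :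
    (Finset.univ.filter fun z => G'.Adj y z ∧ p ≤ mixRank G G' π s z).card ≤
      aliveDegree G π p y + aliveDegree G' π p y + 1 := by
  have hsub : (Finset.univ.filter fun z => G'.Adj y z ∧ p ≤ mixRank G G' π s z) ⊆
      ((Finset.univ.filter fun z => G.Adj y z ∧ p ≤ elimRank G π z) ∪
      (Finset.univ.filter fun z => G'.Adj y z ∧ p ≤ elimRank G' π z)) ∪
      {if y = a then b else a} := by
    intro z hz
    simp only [Finset.mem_filter, Finset.mem_univ, true_and, Finset.mem_union,
      Finset.mem_singleton] at hz ⊢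
    by_cases hG : G.Adj y z
    · left
      unfold mixRank at hz
      split_ifs at hz
      · exact .inr hz
      · exact .inl ⟨hG, hz.2⟩
    · right
      by_contra hcon
      refine hG ((T.same y z ?_ ?_).2 hz.1)
      · rintro ⟨rfl, rfl⟩; simp at hcon
      · rintro ⟨rfl, rfl⟩
        split_ifs at hcon with h
        · subst h; exact hz.1.ne rfl
        · exact hcon rfl
  refine (Finset.card_le_card hsub).trans ((Finset.card_union_le _ _).trans ?_)
  rw [Finset.card_singleton]
  exact Nat.add_le_add_right (Finset.card_union_le _ _) 1

theorem repairCost_succ_add_le {s t : ℕ} (hst : s ≤ t) {y : Fin n} (hy : (π y : ℕ) = t)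
    (hne : elimRank G π y ≠ elimRank G' π y) :
    repairCost G G' π (t + 1) + (aliveDegree G π (diffRank G G' π y) y +
      aliveDegree G' π (diffRank G G' π y) y + 2) ≤ repairCost G G' π s := by
  classical
  unfold repairCost
  rw [add_comm, ← Finset.sum_insert (f := fun x => aliveDegree G π (diffRank G G' π x) x +
    aliveDegree G' π (diffRank G G' π x) x + 2) (by simp [hy])]
  refine Finset.sum_le_sum_of_subset fun x hx => ?_
  simp only [Finset.mem_insert, Finset.mem_filter, Finset.mem_univ, true_and] at hx ⊢
  rcases hx with rfl | ⟨h1, h2⟩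
  · exact ⟨hne, by omega⟩
  · exact ⟨h1, by omega⟩

end Cost

section Specs
variable {w n h : ℕ} {π : Equiv.Perm (Fin n)} {H : SimpleGraph (Fin n)} {k : Fin n → ℕ}
  {Q : Finset (Fin n)} {lo : Fin n → ℕ} {s : State}

/-- The rank of `x` can be changed without touching the trees if all neighbours of `x` have smaller
ranks than the old and the new one. This is why `pull` removes the other edges before. -/
theorem treeKeys_update {x : Fin n} {m : ℕ}
    (hm : ∀ z, H.Adj x z → min (k x) (k z) = min m (k z)) :
    treeKeys π H (Function.update k x m) Q = treeKeys π H k Q := by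
  classical
  have key : ∀ v z, H.Adj v z → min (Function.update k x m v) (Function.update k x m z) =
      min (k v) (k z) := by
    intro v z hvz
    by_cases hv : v = x
    · subst hv
      rw [Function.update_self, Function.update_of_ne hvz.ne.symm, hm z hvz]
    · rw [Function.update_of_ne hv]
      by_cases hz : z = x
      · subst hz
        rw [Function.update_self, min_comm, ← hm v hvz.symm, min_comm]
      · rw [Function.update_of_ne hz]
  funext id
  by_cases hid : id < n
  · simp only [treeKeys, hid, dite_true]
    refine Finset.image_congr fun z hz => ?_
    simp only [Finset.coe_filter, Finset.mem_univ, true_and, Set.mem_ofPred_eq] at hz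
    simp only [key _ z hz]
  · simp only [treeKeys, hid, dite_false]

theorem Full.setRank (R : Full h π H k Q lo s) {x : Fin n} {m : ℕ}
    (hm : ∀ z, H.Adj x z → min (k x) (k z) = min m (k z)) :
    Full h π H (Function.update k x m) Q lo
      ((s.setMem 4 x m).setMem 2 x (if m = π x then 1 else 0)) := by
  refine ⟨⟨by simp [R.size], by simp [R.leaves], fun z => ?_, fun z => ?_, ?_⟩, fun z => ?_, fun z => ?_⟩
  · rw [State.mem_setMem_of_ne (by omega), State.mem_setMem_of_ne (by omega), R.order]
  · rw [State.mem_setMem_of_ne (by omega), State.mem_setMem_self]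
    simp only [Function.update_apply, Fin.val_inj, R.ranks]
  · rw [State.mem_setMem_of_ne (by omega), State.mem_setMem_of_ne (by omega), treeKeys_update hm]
    exact R.trees
  · rw [State.mem_setMem_self, State.mem_setMem_of_ne (by omega)]
    simp only [Function.update_apply, Fin.val_inj, R.marks]
    by_cases hz : z = x
    · subst hz; simp
    · simp [hz]
  · rw [State.mem_setMem_of_ne (by omega), State.mem_setMem_of_ne (by omega), R.levels]

set_option maxHeartbeats 400000 in
open Classical in
/-- `repair` removes a vertex `y` of minimal position from the queue, gives it its new rank `m`, and
queues neighbours if `y` has entered or left the independent set. -/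
theorem repair_spec (F : Fits w n h) (R : Full h π H k Q lo s) (hk : ∀ x, k x < n)
    (hloQ : ∀ x ∈ Q, lo x ≤ k x) {y : Fin n} (hyQ : y ∈ Q) (hmin : ∀ z ∈ Q, π y ≤ π z) {m : ℕ}
    (hm : ∀ m', m' ≤ (π y : ℕ) → (m' = π y ∨ ∃ z, H.Adj y z ∧ k z = π z ∧ m' = π z) →
      (∀ z, H.Adj y z → lo y ≤ k z → k z = π z → m' ≤ π z) → m' = m)
    (hlom : lo y ≤ m)
    (hlo : ∀ z, (k y = π y ∨ m = π y) → H.Adj y z → π y ≤ k z → z ∉ Q → lo z = π y) :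
    RunsWithin w repair s
      (800 * (h + 1) * ((Finset.univ.filter fun z => H.Adj y z ∧ lo y ≤ k z).card + 1)) fun s' =>
      ∃ Q', Full h π H (Function.update k y m) Q' lo s' ∧
        (∀ z, z ∈ Q' ↔ (z ∈ Q ∧ z ≠ y) ∨
          ((k y = π y ∨ m = π y) ∧ H.Adj y z ∧ π y ≤ k z)) ∧
        s'.reg 7 = s.reg 7 ∧ s'.mem 1 = s.mem 1 := by
  set D := (Finset.univ.filter fun z => H.Adj y z ∧ lo y ≤ k z).card with hD
  have hn : n < 2 ^ w := F.lt_of_le le_rfl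
  have hyn := y.2
  have hw2 := F.two_lt
  have eroot := R.toRep.eval_root F (r := 0) (R.size) le_rfl
  set κ := s.mem 3 (n * (2 ^ h + 2 ^ h) + 1) with hκ
  -- the largest key of the queue belongs to `y`
  have hyκ := R.le_root le_rfl (mem_treeKeys_queue.2 ⟨y, hyQ, rfl⟩)
  rw [← hκ] at hyκ
  obtain ⟨y', hy'Q, hy'κ⟩ := mem_treeKeys_queue.1 (R.root_mem le_rfl
    (show s.mem 3 (n * (2 ^ h + 2 ^ h) + 1) ≠ 0 by rw [← hκ]; unfold key at hyκ; omega))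
  rw [← hκ] at hy'κ
  have hyy' : y' = y := by
    rw [← hy'κ] at hyκ
    have h1 : n - 1 - (π y : ℕ) ≤ n - 1 - π y' := by
      rw [← mul_lt_key (n := n) y'.2]
      refine lt_of_lt_of_le ?_ hyκ
      exact (mul_lt_key y.2).2 le_rfl
    have h2 : (π y : ℕ) ≤ π y' := hmin y' hy'Q
    have h3 := (π y).2
    have h4 := (π y').2
    exact π.injective (Fin.ext (by omega))
  subst hyy'
  have hr : n - 1 - (π y' : ℕ) < n := by omega
  have hκw : κ < 2 ^ w := by
    rw [← hy'κ]
    have := key_le hr y'.2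
    have := F.leaves; have := F.tree_le; omega
  have hκpos : 1 ≤ κ := by rw [← hy'κ]; unfold key; omega
  have e8 : ((root 0 - .lit 1) % .reg 0 : Expr).eval w s = y' := by
    simp only [Expr.eval_mod, Expr.eval_sub, eroot, Expr.eval_lit, Expr.eval_reg, F.one_mod,
      R.size]
    rw [show κ + 2 ^ w - 1 = κ - 1 + 2 ^ w by omega, Nat.add_mod_right,
      Nat.mod_eq_of_lt (show κ - 1 < 2 ^ w by omega), ← hy'κ, key_sub_one_mod y'.2,
      Nat.mod_eq_of_lt (by omega)]
  have hlok := hloQ y' hyQ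
  have hky := hk y'
  have hπy := (π y').2
  have hD1 : 1 ≤ D + 1 := by omega
  unfold repair
  refine RunsWithin.mono (RunsWithin.assign_seq e8 (RunsWithin.assign_seq (v := y') (by simp)
    (RunsWithin.assign_seq (v := 0) (by simp)
    (RunsWithin.seq (T' := 650 * (h + 1) * (D + 1)) (RunsWithin.mono
      (queueSet_spec F (π := π) (H := H) (k := k) (Q := Q) (x := y') (b := false)
        (R.toRep.congr (by simp) (by simp) (by simp) (by simp) (by simp)) (by simp) (by simp))
        le_rfl ?_))))) ?_ (fun _ h => h)
  swap
  · have : (h + 1) * 1 ≤ (h + 1) * (D + 1) := Nat.mul_le_mul_left _ hD1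
    simp only [Expr.cost, Expr.cost_sub, root]
    nlinarith
  rintro t ⟨hs, Rt⟩
  simp only [Bool.false_eq_true, if_false] at Rt
  have treg : ∀ r < 8, t.reg r = s.reg r := fun r hr => by
    rw [hs.reg r (by omega)]
    simp [show r ≠ 8 by omega, show r ≠ 30 by omega, show r ≠ 32 by omega]
  have t8 : t.reg 8 = y' := by rw [hs.reg 8 (by omega)]; simp
  have tm : ∀ a, a ≠ 3 → t.mem a = s.mem a := fun a ha => by rw [hs.mem a ha]; simp
  have t5 : t.mem 5 y' = lo y' + 1 := by rw [tm 5 (by omega), R.levels, if_pos hyQ]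
  have t4 : t.mem 4 y' = k y' := Rt.ranks y'
  have t0 : t.mem 0 y' = π y' := Rt.order y'
  refine RunsWithin.mono (RunsWithin.assign_seq (v := lo y') ?_
    (RunsWithin.store_seq (j := y') (v := 0) (by simp [t8]) (by simp)
    (RunsWithin.assign_seq (v := k y') (by simp [t8, State.mem_setMem, t4])
    (RunsWithin.assign_seq (v := π y') (by simp [t8, State.mem_setMem, t0])
    (RunsWithin.seq (T' := 300 * (h + 1) * (D + 1)) (RunsWithin.mono
      (pull_spec F (Q := Q.erase y') (lo := lo) (H := H) (k := k) (π := π) (x := y') (p := lo y')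
        ?_ hk (by simp [t8]) (by simp) (by simp) hlok) le_rfl ?_)))))) ?_ (fun _ h => h)
  · simp only [Expr.eval_sub, Expr.eval_load, Expr.eval_reg, t8, t5, Expr.eval_lit, F.one_mod]
    rw [show lo y' + 1 + 2 ^ w - 1 = lo y' + 2 ^ w by omega, Nat.add_mod_right,
      Nat.mod_eq_of_lt (by omega)]
  · refine ⟨Rt.congr (by simp) (by simp) (by simp [State.mem_setMem]) (by simp [State.mem_setMem])
      (by simp [State.mem_setMem]), fun x => ?_, fun x => ?_⟩
    · simp [State.mem_setMem, tm, R.marks]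
    · simp only [State.mem_setReg, State.mem_setMem_self, Function.update_apply, Fin.val_inj,
        tm 5 (by omega), R.levels, Finset.mem_erase]
      by_cases hx : x = y' <;> simp [hx]
  · rintro u ⟨l, hl, hlmem, u13, u6, Ru, ⟨hm1, hm2, hm3⟩, ureg, um1⟩
    have hmu : u.reg 12 = m := hm _ hm1
      (hm2.imp_right fun ⟨z, hz, h'⟩ => ⟨z, ((hlmem z).1 hz).1, h'⟩)
      fun z hz1 hz2 hz3 => hm3 z ((hlmem z).2 ⟨hz1, hz2⟩) hz3
    have u8 : u.reg 8 = y' := by rw [ureg 8 (by omega)]; simp [t8]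
    have u10 : u.reg 10 = k y' := by rw [ureg 10 (by omega)]; simp
    have u11 : u.reg 11 = π y' := by rw [ureg 11 (by omega)]; simp
    have u7 : u.reg 7 = s.reg 7 := by rw [ureg 7 (by omega)]; simp [treg]
    have um1' : u.mem 1 = s.mem 1 := by rw [um1]; simp [State.mem_setMem, tm]
    have hll : l.length = D := by
      rw [hD, ← List.toFinset_card_of_nodup hl]
      congr 1
      ext z
      simp [hlmem]
    have Rv := Ru.setRank (x := y') (m := m) fun z hz => by
      obtain ⟨h1, h2, -⟩ := cut_adj.1 hz
      have : ¬ lo y' ≤ k z := fun hle => h2 ⟨rfl, (hlmem z).2 ⟨h1, hle⟩⟩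
      omega
    have hkz : ∀ z, H.Adj y' z → Function.update k y' m z = k z := fun z hz =>
      Function.update_of_ne hz.ne.symm _ _
    have hmn : m < n := by rw [← hmu]; omega
    refine RunsWithin.mono (RunsWithin.store_seq (j := y') (v := m) (by simp [u8]) (by simp [hmu])
      (RunsWithin.store_seq (j := y') (v := if m = π y' then 1 else 0) (by simp [u8])
        (by simp [hmu, u11])
      (RunsWithin.assign_seq (v := (if k y' = π y' then 1 else 0) + if m = π y' then 1 else 0)
        ?_
      (RunsWithin.mono (pushBack_spec F (k := Function.update k y' m) (x := y') (p := π y') (l := l)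
        (b := k y' = π y' ∨ m = π y') (H := H) (lo := lo) (Q := Q.erase y') (π := π) ?_
        (Rv.congr ⟨by simp, by simp, fun a _ => by simp⟩) (by simp [u8]) (by simp [u11])
        hπy ?_ (by simp [u13]) (fun i z hz => by simpa [State.mem_setMem] using u6 i z hz) hl
        (fun z hz => ((hlmem z).1 hz).1) ?_) le_rfl ?_)))) ?_ (fun _ h => h)
    · simp only [Expr.eval_add, Expr.eval_eq, Expr.eval_reg, State.reg_setMem, u10, u11, hmu]
      refine Nat.mod_eq_of_lt ?_
      split_ifs <;> omega
    · intro x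
      rw [Function.update_apply]
      split_ifs
      · exact hmn
      · exact hk x
    · simp only [State.reg_setReg, if_true]
      by_cases h1 : k y' = π y' <;> by_cases h2 : m = π y' <;> simp [h1, h2]
    · intro z hz hb hle hzQ
      have hadj := ((hlmem z).1 hz).1
      rw [hkz z hadj] at hle
      refine hlo z hb hadj hle fun hcon => hzQ (Finset.mem_erase.2 ⟨hadj.ne.symm, hcon⟩)
    · rintro v ⟨Q', Rv', hQ', vreg, vm1⟩
      refine ⟨Q', Rv', fun z => ?_, ?_, ?_⟩
      · rw [hQ', Finset.mem_erase]
        refine or_congr (and_comm) (and_congr_right fun hb => ?_)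
        rw [hlmem]
        constructor
        · rintro ⟨⟨h1, h2⟩, h3⟩
          rw [hkz z h1] at h3
          exact ⟨h1, h3⟩
        · rintro ⟨h1, h3⟩
          rw [hkz z h1]
          refine ⟨⟨h1, le_trans ?_ h3⟩, h3⟩
          rcases hb with hb | hb
          · rw [← hb]; exact hlok
          · rw [← hb]; exact hlom
      · rw [vreg 7 (by omega)]; simp [u7]
      · rw [vm1]; simp [State.mem_setMem, um1']
    · have : (h + 1) * 1 ≤ (h + 1) * (D + 1) := Nat.mul_le_mul_left _ hD1
      rw [hll]
      simp only [Expr.cost]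
      nlinarith
  · have : (h + 1) * 1 ≤ (h + 1) * (D + 1) := Nat.mul_le_mul_left _ hD1
    rw [← hD]
    simp only [Expr.cost, Expr.cost_sub]
    nlinarith

end Specs

section Update
variable {w n h : ℕ} {π : Equiv.Perm (Fin n)} {G G' : SimpleGraph (Fin n)} {a b : Fin n} {s : State}

/-- The queue holds the vertices that wait for repair at the current position `θ`. By `Toggle.jump`
nothing changes until the position of the first vertex in the queue, whose repair advances `θ` past
that position; the vertices that still have to be repaired pay for the steps. -/
theorem repairLoop_spec (F : Fits w n h) (T : Toggle G G' a b) (hab : π a < π b)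
    (R : Full h π G' (mixRank G G' π (π a + 1)) (waiting G G' π (π a + 1)) (diffRank G G' π) s) :
    RunsWithin w (.loop (root 0) repair) s (900 * (h + 1) * repairCost G G' π (π a + 1) + 10)
      fun s' => Full h π G' (elimRank G' π) ∅ (diffRank G G' π) s' ∧
        s'.reg 7 = s.reg 7 ∧ s'.mem 1 = s.mem 1 := by
  classical
  have ha : (π a : ℕ) + 1 ≤ n := (π a).2
  refine RunsWithin.loop (fun c t => ∃ θ, (π a : ℕ) + 1 ≤ θ ∧ θ ≤ n ∧
    Full h π G' (mixRank G G' π θ) (waiting G G' π θ) (diffRank G G' π) t ∧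
    t.reg 7 = s.reg 7 ∧ t.mem 1 = s.mem 1 ∧ c = 900 * (h + 1) * repairCost G G' π θ + 10) ?_
    ⟨_, le_rfl, ha, R, rfl, rfl, rfl⟩
  rintro c t ⟨θ, hθ, hθn, Rt, t7, tm1, rfl⟩
  have eroot := Rt.toRep.eval_root F (r := 0) Rt.size le_rfl
  rw [eroot]
  have ecost : (root 0).cost = 8 := by simp [Expr.cost, root]
  rcases Finset.eq_empty_or_nonempty (waiting G G' π θ) with hQ | hQ
  · left
    refine ⟨?_, by rw [ecost]; omega, ?_, t7, tm1⟩
    · by_contra hne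
      obtain ⟨x, hx, -⟩ := mem_treeKeys_queue.1 (Rt.root_mem le_rfl hne)
      simp [hQ] at hx
    · rw [← T.mixRank_eq_of_waiting_eq_empty hab hθ hθn hQ, ← hQ]
      exact Rt
  · right
    obtain ⟨y, hyQ, hmin⟩ := Finset.exists_min_image _ (fun x => π x) hQ
    have hπy := (π y).2
    have hθy := (mem_waiting.1 hyQ).2.2
    obtain ⟨hj1, hj2⟩ := T.jump hab hθ hθy hπy.le hmin
    rw [← hj1, ← hj2] at Rt
    have hyQ' := hyQ
    rw [← hj1] at hyQ'
    have hmin' : ∀ z ∈ waiting G G' π (π y), π y ≤ π z := by rw [hj1]; exact hmin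
    have hne := (mem_waiting.1 hyQ').1
    have hya : (π a : ℕ) + 1 ≤ π y := by omega
    have hcard := card_mixRank_le (π := π) T (π y) (diffRank G G' π y) y
    have hcost := repairCost_succ_add_le (G := G) (G' := G') hθy rfl hne
    set A := aliveDegree G π (diffRank G G' π y) y + aliveDegree G' π (diffRank G G' π y) y + 2
      with hA
    refine ⟨?_, 800 * (h + 1) * A, 900 * (h + 1) * repairCost G G' π (π y + 1) + 10, ?_, ?_⟩
    · have := Rt.le_root le_rfl (mem_treeKeys_queue.2 ⟨y, hyQ', rfl⟩)
      intro h0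
      rw [h0] at this
      unfold key at this
      omega
    · rw [ecost]
      have h1 : (h + 1) * (repairCost G G' π (π y + 1) + A) ≤ (h + 1) * repairCost G G' π θ :=
        Nat.mul_le_mul_left _ hcost
      have h2 : (h + 1) * 2 ≤ (h + 1) * A := Nat.mul_le_mul_left _ (by omega)
      nlinarith
    · refine RunsWithin.mono (repair_spec F Rt (fun x => (mixRank_le _ x).trans_lt (π x).2) ?_ hyQ'
        hmin' (m := elimRank G' π y)
        (fun m' h1 h2 h3 => eq_elimRank_of_min rfl h1 h2 h3) (min_le_right _ _) ?_) ?_ ?_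
      · intro x hx
        rw [mixRank_of_le (mem_waiting.1 hx).2.2]
        exact min_le_left _ _
      · intro z hf hz hle hzQ
        rw [mixRank_of_le le_rfl] at hf
        exact (T.new_of_adj hab hya rfl hyQ' hf hz hle hzQ).2
      · exact Nat.mul_le_mul_left _ (by omega)
      · rintro u ⟨Q', Ru, hQ', u7, um1⟩
        refine ⟨π y + 1, by omega, by omega, ?_, u7.trans t7, um1.trans tm1, rfl⟩
        rw [mixRank_succ rfl]
        convert Ru using 1
        ext z
        rw [hQ', T.mem_waiting_succ hab hya rfl hyQ', mixRank_of_le (x := y) le_rfl]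

theorem repairCost_antitone : Antitone (repairCost G G' π) := by
  classical
  intro s t hst
  refine Finset.sum_le_sum_of_subset fun x hx => ?_
  simp only [Finset.mem_filter, Finset.mem_univ, true_and] at hx ⊢
  exact ⟨hx.1, hst.trans hx.2⟩

theorem toggle_setAdj {x z : Fin n} (hxz : x ≠ z) {c : Bool} (hc : G.Adj x z ↔ c = false) :
    Toggle G (setAdj G x z c) x z := by
  refine ⟨?_, fun u v h1 h2 => ?_⟩
  · rw [setAdj_adj hxz, hc]; simp
  · rw [setAdj_adj hxz, if_neg (by tauto)]

theorem setAdj_comm (x z : Fin n) (c : Bool) : setAdj G x z c = setAdj G z x c := by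
  unfold setAdj
  rw [SimpleGraph.edge_comm, Sym2.eq_swap]

theorem updateOrdered_spec (F : Fits w n h) (hab : π a < π b) {c : Bool}
    (hc : G.Adj a b ↔ c = false) {lo : Fin n → ℕ}
    (R : Full h π G (elimRank G π) ∅ lo s)
    (h1 : s.reg 1 = if c then 1 else 0) (h30 : s.reg 30 = a) (h31 : s.reg 31 = b) :
    RunsWithin w updateOrdered s (900 * (h + 1) * (repairCost G (setAdj G a b c) π 0 + 1))
      fun s' => (∃ lo', Full h π (setAdj G a b c) (elimRank (setAdj G a b c) π) ∅ lo' s') ∧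
        s'.reg 7 = s.reg 7 ∧ s'.mem 1 = s.mem 1 := by
  have hne : a ≠ b := by rintro rfl; exact lt_irrefl _ hab
  set G' := setAdj G a b c with hG'
  have T : Toggle G G' a b := toggle_setAdj hne hc
  have hk : ∀ x, elimRank G π x < n := elimRank_lt G π
  have hcost : repairCost G G' π (π a + 1) ≤ repairCost G G' π 0 := repairCost_antitone (Nat.zero_le _)
  have hcost' : (h + 1) * repairCost G G' π (π a + 1) ≤ (h + 1) * repairCost G G' π 0 :=
    Nat.mul_le_mul_left _ hcost
  have hab' : (π a : ℕ) < π b := hab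
  refine RunsWithin.mono (RunsWithin.assign_seq (v := if c then 1 else 0) (by simp [h1])
    (RunsWithin.seq (T' := 900 * (h + 1) * repairCost G G' π (π a + 1) + 120 * (h + 1))
      (RunsWithin.mono (edgeSet_spec F (π := π) (H := G) (k := elimRank G π)
        (Q := ∅) (b := c) (R.toRep.congr (by simp) (by simp) (by simp) (by simp) (by simp)) hk
        hne (by simp [h30]) (by simp [h31]) (by simp)) le_rfl ?_))) ?_ (fun _ h => h)
  · rintro t ⟨hs, Rt⟩
    have Ft : Full h π G' (elimRank G π) ∅ (diffRank G G' π) t :=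
      ⟨Rt, fun y => by rw [hs.mem 2 (by omega)]; simp [R.marks],
        fun y => by rw [hs.mem 5 (by omega)]; simp [R.levels]⟩
    have t30 : t.reg 30 = a := by rw [hs.reg 30 (by omega)]; simp [h30]
    have t31 : t.reg 31 = b := by rw [hs.reg 31 (by omega)]; simp [h31]
    have t7 : t.reg 7 = s.reg 7 := by rw [hs.reg 7 (by omega)]; simp
    have tm1 : t.mem 1 = s.mem 1 := by rw [hs.mem 1 (by omega)]; simp
    have t0 := Ft.order a
    have t4a := Ft.ranks a
    have t4b := Ft.ranks b
    have hmix := T.mixRank_init hab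
    have hwait := T.waiting_init hab
    set u := t.setReg 11 (π a) with hu
    have Fu : Full h π G' (elimRank G π) ∅ (diffRank G G' π) u :=
      Ft.congr ⟨by simp [hu], by simp [hu], fun _ _ => by simp [hu]⟩
    -- with the right queue, the loop finishes the work
    have fin : ∀ v : State, Full h π G' (elimRank G π) (waiting G G' π (π a + 1))
        (diffRank G G' π) v → v.reg 7 = s.reg 7 → v.mem 1 = s.mem 1 →
        RunsWithin w (.loop (root 0) repair) v
          (900 * (h + 1) * repairCost G G' π (π a + 1) + 10)
          fun s' => (∃ lo', Full h π G' (elimRank G' π) ∅ lo' s') ∧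
            s'.reg 7 = s.reg 7 ∧ s'.mem 1 = s.mem 1 := by
      intro v Fv v7 vm1
      rw [← hmix] at Fv
      exact RunsWithin.mono (repairLoop_spec F T hab Fv) le_rfl
        fun s' ⟨h1, h2, h3⟩ => ⟨⟨_, h1⟩, h2.trans v7, h3.trans vm1⟩
    have empty : ¬ (elimRank G π a = π a ∧ π a ≤ elimRank G π b) →
        waiting G G' π (π a + 1) = ∅ := fun hn => by
      ext z
      rw [hwait]
      simpa using fun _ h => lt_of_not_ge fun h' => hn ⟨h, h'⟩
    have u7 : u.reg 7 = s.reg 7 := by simp [hu, t7]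
    have um1 : u.mem 1 = s.mem 1 := by simp [hu, tm1]
    refine RunsWithin.mono (RunsWithin.assign_seq (v := π a) (by simp [t30, t0])
      (RunsWithin.seq (T := 100 * (h + 1))
        (T' := 900 * (h + 1) * repairCost G G' π (π a + 1) + 10) (RunsWithin.mono (RunsWithin.cond
        (fun hc => RunsWithin.cond (fun hc' => RunsWithin.nop ?_)
          (fun hc' => RunsWithin.mono (push_spec F Fu (z := b) (p := π a) (by simp [hu, t31])
            (by simp [hu]) (π a).2 ?_) le_rfl ?_)) (fun hc => RunsWithin.nop ?_)) ?_
        (fun _ h => h)))) ?_ (fun _ h => h)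
    · rw [← hu] at hc' ⊢
      refine fin u ?_ u7 um1
      have : elimRank G π b < π a := by by_contra hcon; simp [hu, t31, t4b, hcon] at hc'
      rw [empty (by omega)]
      exact Fu
    · rw [← hu] at hc hc'
      intro _
      have hb : ¬ elimRank G π b < π a := by intro hcon; simp [hu, t31, t4b, hcon] at hc'
      have ha : elimRank G π a = π a := by by_contra hcon; simp [hu, t30, t4a, hcon] at hc
      exact (T.trigger hab ha (not_lt.1 hb)).2
    · rw [← hu] at hc hc'
      have hb : ¬ elimRank G π b < π a := by intro hcon; simp [hu, t31, t4b, hcon] at hc'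
      have ha : elimRank G π a = π a := by by_contra hcon; simp [hu, t30, t4a, hcon] at hc
      rintro v ⟨Fv, vreg, vm1, -⟩
      refine fin v ?_ (by rw [vreg 7 (by omega), u7]) (vm1.trans um1)
      convert Fv using 1
      ext z
      rw [hwait]
      simp [ha, not_lt.1 hb]
    · rw [← hu] at hc ⊢
      refine fin u ?_ u7 um1
      have : elimRank G π a ≠ π a := by intro hcon; simp [hu, t30, t4a, hcon] at hc
      rw [empty (by omega)]
      exact Fu
    · simp [Expr.cost]; omega
    · simp [Expr.cost]; omega
  · simp only [Expr.cost]
    nlinarith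

theorem updateProg_spec (F : Fits w n h) {u v : Fin n} (huv : u ≠ v) {c : Bool}
    (hc : G.Adj u v ↔ c = false) {lo : Fin n → ℕ}
    (R : Full h π G (elimRank G π) ∅ lo s)
    (h1 : s.reg 1 = if c then 1 else 0) (h2 : s.reg 2 = u) (h3 : s.reg 3 = v) :
    RunsWithin w updateProg s (1000 * (h + 1) * (repairCost G (setAdj G u v c) π 0 + 1))
      fun s' => (∃ lo', Full h π (setAdj G u v c) (elimRank (setAdj G u v c) π) ∅ lo' s') ∧
        s'.reg 7 = s.reg 7 ∧ s'.mem 1 = s.mem 1 := by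
  have ou := R.order u
  have ov := R.order v
  refine RunsWithin.mono (RunsWithin.seq (T := 20)
    (T' := 900 * (h + 1) * (repairCost G (setAdj G u v c) π 0 + 1)) (RunsWithin.mono (RunsWithin.cond
    (fun hlt => RunsWithin.assign_seq (v := u) (by simp [h2]) (RunsWithin.assign ?_))
    (fun hlt => RunsWithin.assign_seq (v := v) (by simp [h3]) (RunsWithin.assign ?_))) ?_
    (fun _ h => h))) ?_ (fun _ h => h)
  · have hlt' : (π u : ℕ) < π v := by by_contra hcon; simp [h2, h3, ou, ov, hcon] at hlt
    refine RunsWithin.mono (updateOrdered_spec F (π := π) hlt' hc (lo := lo)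
      (R.congr ⟨by simp, by simp, fun a _ => by simp⟩) (by simp [h1]) (by simp) (by simp [h3]))
      le_rfl ?_
    rintro s' ⟨h, h7, hm⟩
    exact ⟨h, by rw [h7]; simp, by rw [hm]; simp⟩
  · have hlt' : ¬ (π u : ℕ) < π v := by intro hcon; simp [h2, h3, ou, ov, hcon] at hlt
    have hlt'' : π v < π u := by
      refine lt_of_le_of_ne (not_lt.1 hlt') fun e => huv (π.injective e.symm)
    rw [setAdj_comm]
    refine RunsWithin.mono (updateOrdered_spec F (π := π) hlt'' (by rw [G.adj_comm]; exact hc)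
      (lo := lo)
      (R.congr ⟨by simp, by simp, fun a _ => by simp⟩) (by simp [h1]) (by simp) (by simp [h2]))
      le_rfl ?_
    rintro s' ⟨h, h7, hm⟩
    exact ⟨h, by rw [h7]; simp, by rw [hm]; simp⟩
  · simp [Expr.cost]
  · nlinarith

end Update

end DynamicMIS

/-! ### Preprocessing -/

namespace DynamicMIS
open WordRAM

/-- The preprocessing program: compute the number of leaves, store the ranks for the graph without
edges, and insert the edges of the input graph one by one with the update program. -/
def preprocessProg : Prog :=
  .assign 4 (.lit 1) ;;
  .loop (.op .lt (.reg 4) (.reg 0 * .reg 0 + .lit 1)) (.assign 4 (.reg 4 + .reg 4)) ;;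
  .loop (.op .lt (.reg 7) (.reg 0)) (
    .store 4 (.reg 7) (.load 0 (.reg 7)) ;;
    .store 2 (.reg 7) (.lit 1) ;;
    .assign 7 (.reg 7 + .lit 1)) ;;
  .assign 7 (.lit 0) ;;
  .loop (.op .lt (.reg 7) (.reg 0 * .reg 0)) (
    .assign 1 (.lit 1) ;;
    .assign 2 (.reg 7 / .reg 0) ;;
    .assign 3 (.reg 7 % .reg 0) ;;
    .cond (.load 1 (.reg 7)) (.cond (.op .lt (.reg 2) (.reg 3)) updateProg .nop) .nop ;;
    .assign 7 (.reg 7 + .lit 1))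

/-- The height of the segment trees. -/
def treeHeight (n : ℕ) : ℕ := Nat.size (n * n)

theorem two_pow_treeHeight_le (n : ℕ) : 2 ^ treeHeight n ≤ 2 * (n * n) + 1 := by
  unfold treeHeight
  rcases hs : Nat.size (n * n) with _ | k
  · simp
  · have : k < Nat.size (n * n) := by omega
    rw [Nat.lt_size] at this
    rw [pow_succ]; omega

theorem fits_treeHeight {w n : ℕ} (hw : (n + 2) ^ 4 ≤ 2 ^ w) : Fits w n (treeHeight n) := by
  refine ⟨Nat.lt_size_self _, ?_, ?_⟩
  · refine le_trans ?_ hw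
    have := two_pow_treeHeight_le n
    calc (n + 1) * (2 ^ treeHeight n + 2 ^ treeHeight n)
        ≤ (n + 1) * ((2 * (n * n) + 1) + (2 * (n * n) + 1)) := by gcongr
      _ ≤ (n + 2) ^ 4 := by nlinarith [Nat.zero_le (n ^ 4), Nat.zero_le (n ^ 3), Nat.zero_le n]
  · refine lt_of_lt_of_le ?_ hw
    calc 2 < 2 ^ 4 := by norm_num
      _ ≤ (n + 2) ^ 4 := Nat.pow_le_pow_left (by omega) 4

section Prefix
variable {n : ℕ} {G : SimpleGraph (Fin n)}

/-- The graph formed by those edges of `G` that stand in the first `i` entries of the adjacency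
matrix, above the diagonal. -/
def prefixGraph (G : SimpleGraph (Fin n)) (i : ℕ) : SimpleGraph (Fin n) where
  Adj u v := G.Adj u v ∧ min (u : ℕ) v * n + max (u : ℕ) v < i
  symm := ⟨fun u v h => ⟨h.1.symm, by rw [min_comm, max_comm]; exact h.2⟩⟩
  loopless := ⟨fun _ h => h.1.ne rfl⟩

theorem prefixGraph_zero : prefixGraph G 0 = ⊥ := by
  ext u v; simp [prefixGraph]

theorem prefixGraph_sq : prefixGraph G (n * n) = G := by
  ext u v
  refine ⟨fun h => h.1, fun h => ⟨h, ?_⟩⟩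
  have h1 := key_le (n := n) (r := min (u : ℕ) v) (x := max (u : ℕ) v) (by omega) (by omega)
  unfold key at h1
  omega

theorem prefixGraph_succ_of_adj {u v : Fin n} (huv : u < v) (hG : G.Adj u v) :
    prefixGraph G (u * n + v + 1) = setAdj (prefixGraph G (u * n + v)) u v true := by
  ext x y
  rw [setAdj_adj huv.ne]
  have huv' : (u : ℕ) < v := huv
  have e : ∀ x y : Fin n, (x = u ∧ y = v ∨ x = v ∧ y = u) ↔
      x ≠ y ∧ min (x : ℕ) y * n + max (x : ℕ) y = u * n + v := by
    intro x y
    constructor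
    · rintro (⟨rfl, rfl⟩ | ⟨rfl, rfl⟩)
      · exact ⟨huv.ne, by rw [min_eq_left huv'.le, max_eq_right huv'.le]⟩
      · exact ⟨huv.ne', by rw [min_eq_right huv'.le, max_eq_left huv'.le]⟩
    · rintro ⟨hne, h⟩
      obtain ⟨h1, h2⟩ := block_injective (by omega) v.2 h
      rcases le_total (x : ℕ) y with hxy | hxy
      · rw [min_eq_left hxy] at h1; rw [max_eq_right hxy] at h2
        exact .inl ⟨Fin.ext h1, Fin.ext h2⟩
      · rw [min_eq_right hxy] at h1; rw [max_eq_left hxy] at h2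
        exact .inr ⟨Fin.ext h2, Fin.ext h1⟩
  split_ifs with hc
  · have hc' := (e x y).1 hc
    simp only [iff_true, prefixGraph]
    refine ⟨?_, by omega⟩
    rcases hc with ⟨rfl, rfl⟩ | ⟨rfl, rfl⟩
    · exact hG
    · exact hG.symm
  · rw [e] at hc
    simp only [prefixGraph]
    refine and_congr_right fun hxy => ?_
    have := hxy.ne
    have : min (x : ℕ) y * n + max (x : ℕ) y ≠ u * n + v := fun h => hc ⟨hxy.ne, h⟩
    omega

theorem prefixGraph_succ_of_not {u v : Fin n} (h : ¬ (u < v ∧ G.Adj u v)) :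
    prefixGraph G (u * n + v + 1) = prefixGraph G (u * n + v) := by
  ext x y
  simp only [prefixGraph]
  refine and_congr_right fun hxy => ?_
  have : min (x : ℕ) y * n + max (x : ℕ) y ≠ u * n + v := by
    intro he
    obtain ⟨h1, h2⟩ := block_injective (by omega) v.2 he
    have hne : (x : ℕ) ≠ y := fun e => hxy.ne (Fin.ext e)
    refine h ⟨show (u : ℕ) < v by omega, ?_⟩
    rcases le_total (x : ℕ) y with hle | hle
    · rw [min_eq_left hle] at h1; rw [max_eq_right hle] at h2
      obtain rfl := Fin.ext h1
      obtain rfl := Fin.ext h2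
      exact hxy
    · rw [min_eq_right hle] at h1; rw [max_eq_left hle] at h2
      obtain rfl := Fin.ext h1
      obtain rfl := Fin.ext h2
      exact hxy.symm
  omega

theorem elimRank_bot (π : Equiv.Perm (Fin n)) : elimRank ⊥ π = fun x => (π x : ℕ) := by
  funext x
  exact le_antisymm (elimRank_le _ _ _) ((le_elimRank_iff _ _).2 ⟨le_rfl, fun z hz => hz.elim⟩)

end Prefix

section Preprocessing
variable {w n : ℕ} {π : Equiv.Perm (Fin n)} {G : SimpleGraph (Fin n)}

theorem inputState_mem_one (u v : Fin n) :
    (inputState G π).mem 1 (u * n + v) ≠ 0 ↔ G.Adj u v := by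
  simp only [inputState, one_ne_zero, if_false, if_true]
  constructor
  · intro h
    split_ifs at h with hc
    · obtain ⟨u', v', he, hadj⟩ := hc
      obtain ⟨h1, h2⟩ := block_injective v.2 v'.2 he
      rwa [Fin.ext h1, Fin.ext h2]
    · exact absurd rfl h
  · intro h
    rw [if_pos ⟨u, v, rfl, h⟩]
    omega

theorem aliveDegree_le (s : ℕ) (x : Fin n) : aliveDegree G π s x ≤ n := by
  classical
  unfold aliveDegree
  simpa using Finset.card_le_univ (Finset.univ.filter fun z => G.Adj x z ∧ s ≤ elimRank G π z)

theorem repairCost_le {G' : SimpleGraph (Fin n)} (s : ℕ) :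
    repairCost G G' π s ≤ n * (n + n + 2) := by
  classical
  unfold repairCost
  refine (Finset.sum_le_card_nsmul _ _ (n + n + 2) fun x _ => ?_).trans ?_
  · have h1 := aliveDegree_le (G := G) (π := π) (diffRank G G' π x) x
    have h2 := aliveDegree_le (G := G') (π := π) (diffRank G G' π x) x
    omega
  · rw [smul_eq_mul]
    refine Nat.mul_le_mul_right _ ?_
    simpa using Finset.card_le_univ (Finset.univ.filter fun x =>
      elimRank G π x ≠ elimRank G' π x ∧ s ≤ (π x : ℕ))

/-- Before entry `i` of the adjacency matrix is read, the data structure represents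
`prefixGraph G i`. -/
theorem insertAll_spec {h : ℕ} (F : Fits w n h) {s : State}
    (R : Full h π ⊥ (elimRank ⊥ π) ∅ (fun _ => 0) s) (h7 : s.reg 7 = 0)
    (h1 : s.mem 1 = (inputState G π).mem 1) :
    RunsWithin w (.loop (.op .lt (.reg 7) (.reg 0 * .reg 0)) (
      .assign 1 (.lit 1) ;;
      .assign 2 (.reg 7 / .reg 0) ;;
      .assign 3 (.reg 7 % .reg 0) ;;
      .cond (.load 1 (.reg 7)) (.cond (.op .lt (.reg 2) (.reg 3)) updateProg .nop) .nop ;;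
      .assign 7 (.reg 7 + .lit 1))) s
      ((1000 * (h + 1) * (n * (n + n + 2) + 1) + 50) * (n * n) + 10)
      fun s' => ∃ lo, Full h π G (elimRank G π) ∅ lo s' := by
  have hsq := F.sq_lt
  set U := 1000 * (h + 1) * (n * (n + n + 2) + 1) with hU
  refine RunsWithin.loop (fun c t => ∃ i lo, i ≤ n * n ∧
    Full h π (prefixGraph G i) (elimRank (prefixGraph G i) π) ∅ lo t ∧ t.reg 7 = i ∧
    t.mem 1 = s.mem 1 ∧ c = (U + 50) * (n * n - i) + 10) ?_
    ⟨0, fun _ => 0, Nat.zero_le _, by rwa [prefixGraph_zero], h7, rfl, rfl⟩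
  rintro c t ⟨i, lo, hi, Rt, t7, t1, rfl⟩
  have t0 := Rt.size
  have econd : (Expr.op .lt (.reg 7) (.reg 0 * .reg 0)).eval w t = if i < n * n then 1 else 0 := by
    simp [t7, t0, Nat.mod_eq_of_lt (show n * n < 2 ^ w by omega)]
  have ecost : (Expr.op .lt (.reg 7) (.reg 0 * .reg 0)).cost = 5 := by simp [Expr.cost]
  rw [econd, ecost]
  by_cases hin : i < n * n
  · right
    have hn : 0 < n := by
      rcases Nat.eq_zero_or_pos n with rfl | hn
      · simp at hin
      · exact hn
    set u : Fin n := ⟨i / n, Nat.div_lt_of_lt_mul hin⟩ with hu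
    set v : Fin n := ⟨i % n, Nat.mod_lt _ hn⟩ with hv
    have huv : (u : ℕ) * n + v = i := by
      simp only [hu, hv]; rw [mul_comm]; exact Nat.div_add_mod i n
    have hn' := F.lt_of_le (le_refl n)
    have hu2 := u.2
    have hv2 := v.2
    refine ⟨by simp [hin], U + 35, (U + 50) * (n * n - (i + 1)) + 10, ?_, ?_⟩
    · obtain ⟨d, hd⟩ := Nat.exists_eq_add_of_lt hin
      rw [show n * n - (i + 1) = d by omega, show n * n - i = d + 1 by omega, Nat.mul_succ]
      omega
    have next : ∀ (t' : State) (lo' : Fin n → ℕ), Full h π (prefixGraph G (i + 1))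
        (elimRank (prefixGraph G (i + 1)) π) ∅ lo' t' → t'.reg 7 = i → t'.mem 1 = s.mem 1 →
        RunsWithin w (.assign 7 (.reg 7 + .lit 1)) t' 4 fun t'' => ∃ i' lo, i' ≤ n * n ∧
          Full h π (prefixGraph G i') (elimRank (prefixGraph G i') π) ∅ lo t'' ∧ t''.reg 7 = i' ∧
          t''.mem 1 = s.mem 1 ∧
          (U + 50) * (n * n - (i + 1)) + 10 = (U + 50) * (n * n - i') + 10 := by
      intro t' lo' R' h7' h1'
      refine RunsWithin.assign ⟨i + 1, lo', hin, R'.congr ⟨by simp, by simp, fun _ _ => by simp⟩,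
        ?_, h1', rfl⟩
      simp [h7', F.one_mod, Nat.mod_eq_of_lt (show i + 1 < 2 ^ w by omega)]
    refine RunsWithin.mono (RunsWithin.assign_seq (v := 1) (by simp [F.one_mod])
      (RunsWithin.assign_seq (v := u) ?_ (RunsWithin.assign_seq (v := v) ?_
      (RunsWithin.seq (T := U + 12) (T' := 4)
        (RunsWithin.mono (RunsWithin.cond (fun hc => RunsWithin.cond (T := U)
          (fun hc' => RunsWithin.mono (updateProg_spec F (G := prefixGraph G i) (π := π) (u := u)
            (v := v) (c := true) (lo := lo) ?_ ?_ ?_ (by simp) (by simp) (by simp)) ?_ ?_)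
          (fun hc' => RunsWithin.nop ?_))
          (fun hc => RunsWithin.nop ?_)) ?_ (fun _ h => h)))))) ?_ (fun _ h => h)
    · simp [t7, t0, hu, Nat.mod_eq_of_lt (show i / n < 2 ^ w from lt_trans hu2 hn')]
    · simp [t7, t0, hv, Nat.mod_eq_of_lt (show i % n < 2 ^ w from lt_trans hv2 hn')]
    · have : (u : ℕ) < v := by by_contra hcon; simp [hcon] at hc'
      intro e; rw [e] at this; omega
    · have : (u : ℕ) < v := by by_contra hcon; simp [hcon] at hc'
      simp only [prefixGraph, Bool.true_eq_false, iff_false, not_and, not_lt]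
      intro _
      rw [min_eq_left this.le, max_eq_right this.le, huv]
    · exact Rt.congr ⟨by simp, by simp, fun _ _ => by simp⟩
    · rw [hU]
      exact Nat.mul_le_mul_left _ (Nat.add_le_add_right (repairCost_le 0) 1)
    · have hlt : (u : ℕ) < v := by by_contra hcon; simp [hcon] at hc'
      have hadj : G.Adj u v := by
        rw [← inputState_mem_one (π := π), ← h1, ← t1, huv]
        simpa [t7] using hc
      rintro t' ⟨⟨lo', R'⟩, h7', h1'⟩
      refine next t' lo' ?_ (by rw [h7']; simp [t7]) (by rw [h1']; simp [t1])
      rw [← huv, prefixGraph_succ_of_adj hlt hadj, huv]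
      exact R'
    · have hlt : ¬ (u : ℕ) < v := by intro hcon; simp [hcon] at hc'
      refine next _ lo ?_ (by simp [t7]) (by simp [t1])
      rw [← huv, prefixGraph_succ_of_not (fun h => hlt h.1), huv]
      exact Rt.congr ⟨by simp, by simp, fun _ _ => by simp⟩
    · have hadj : ¬ G.Adj u v := by
        rw [← inputState_mem_one (π := π), ← h1, ← t1, huv]
        simpa [t7] using hc
      refine next _ lo ?_ (by simp [t7]) (by simp [t1])
      rw [← huv, prefixGraph_succ_of_not (fun h => hadj h.2), huv]
      exact Rt.congr ⟨by simp, by simp, fun _ _ => by simp⟩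
    · simp [Expr.cost]; omega
    · simp [Expr.cost]; omega
  · left
    obtain rfl : i = n * n := by omega
    refine ⟨by simp, by omega, lo, ?_⟩
    rw [prefixGraph_sq] at Rt
    exact Rt

theorem preprocess_spec (F : Fits w n (treeHeight n)) :
    RunsWithin w preprocessProg (inputState G π)
      (20 * treeHeight n + 30 * n +
        (1000 * (treeHeight n + 1) * (n * (n + n + 2) + 1) + 50) * (n * n) + 100)
      fun s' => ∃ lo, Full (treeHeight n) π G (elimRank G π) ∅ lo s' := by
  set h := treeHeight n with hh
  set s := inputState G π with hs
  have s0 : s.reg 0 = n := by simp [hs, inputState]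
  have s7 : s.reg 7 = 0 := by simp [hs, inputState]
  have sm0 : ∀ x : Fin n, s.mem 0 x = π x := fun x => by simp [hs, inputState]
  have smem : ∀ a i, 2 ≤ a → s.mem a i = 0 := fun a i ha => by
    simp [hs, inputState, show a ≠ 0 by omega, show a ≠ 1 by omega]
  have hsq := F.sq_lt
  have hl := F.leaves
  have hn' := F.lt_of_le (le_refl n)
  have hw2 := F.two_lt
  have htl := F.tree_le
  have hnn : n ≤ n * n := Nat.le_mul_self n
  set U := (1000 * (h + 1) * (n * (n + n + 2) + 1) + 50) * (n * n) + 10 with hU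
  refine RunsWithin.mono (RunsWithin.assign_seq (v := 1) (by simp [F.one_mod])
    (RunsWithin.seq (T' := 30 * n + 4 + (2 + U)) (RunsWithin.loop (T := 20 * h + 10)
    (fun c t => ∃ j ≤ h, t.reg 4 = 2 ^ j ∧ (∀ r, r ≠ 4 → t.reg r = s.reg r) ∧ t.mem = s.mem ∧
      c = 20 * (h - j) + 10) ?_ ⟨0, Nat.zero_le _, by simp, fun r hr => by simp [hr], rfl, rfl⟩)))
    ?_ (fun _ h => h)
  · rintro c t ⟨j, hj, t4, treg, tmem, rfl⟩
    have t0 : t.reg 0 = n := by rw [treg 0 (by omega), s0]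
    have econd : (Expr.op .lt (.reg 4) (.reg 0 * .reg 0 + .lit 1)).eval w t =
        if 2 ^ j < n * n + 1 then 1 else 0 := by
      have : n * n + 1 < 2 ^ w := by
        have : 2 ^ h + 2 ^ h > 2 ^ h + n * n := by omega
        have : 1 ≤ 2 ^ h := Nat.one_le_two_pow
        omega
      simp [t0, t4, F.one_mod, Nat.mod_eq_of_lt this]
    have ecost : (Expr.op .lt (.reg 4) (.reg 0 * .reg 0 + .lit 1)).cost = 7 := by simp [Expr.cost]
    rw [econd, ecost]
    by_cases hlt : 2 ^ j < n * n + 1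
    · right
      have hj' : j < h := by rw [hh, treeHeight, Nat.lt_size]; omega
      have hp : 2 ^ (j + 1) ≤ 2 ^ h := Nat.pow_le_pow_right (by norm_num) hj'
      refine ⟨by simp [hlt], 4, 20 * (h - (j + 1)) + 10, by omega, ?_⟩
      refine RunsWithin.assign ⟨j + 1, hj', ?_, fun r hr => by simp [hr, treg r hr], by simp [tmem],
        rfl⟩
      have : 1 ≤ 2 ^ h := Nat.one_le_two_pow
      simp only [State.reg_setReg, if_true, Expr.eval_add, Expr.eval_reg, t4]
      rw [← mul_two, ← pow_succ, Nat.mod_eq_of_lt (by omega)]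
    · left
      have hjh : j = h := by
        refine le_antisymm hj ?_
        rw [hh, treeHeight, Nat.size_le]; omega
      subst hjh
      refine ⟨by simp [hlt], by omega, ?_⟩
      refine RunsWithin.seq (T := 30 * n + 4) (T' := 2 + U) (RunsWithin.loop (fun c u => ∃ i ≤ n, u.reg 7 = i ∧
        u.reg 0 = n ∧ u.reg 4 = 2 ^ h ∧ (∀ x : Fin n, (x : ℕ) < i → u.mem 4 x = π x) ∧
        (∀ x : Fin n, (x : ℕ) < i → u.mem 2 x = 1) ∧
        (∀ a, a ≠ 4 → a ≠ 2 → u.mem a = s.mem a) ∧ c = 30 * (n - i) + 4) ?_ ⟨0, Nat.zero_le _,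
        by rw [treg 7 (by omega), s7], t0, t4, by simp, by simp, fun a _ _ => by rw [tmem], rfl⟩)
      rintro c u ⟨i, hi, u7, u0, u4, um4, um2, um, rfl⟩
      have econd : (Expr.op .lt (.reg 7) (.reg 0)).eval w u = if i < n then 1 else 0 := by
        simp [u0, u7]
      have ecost : (Expr.op .lt (.reg 7) (.reg 0)).cost = 3 := by simp [Expr.cost]
      rw [econd, ecost]
      by_cases hin : i < n
      · right
        refine ⟨by simp [hin], 20, 30 * (n - (i + 1)) + 4, by omega, ?_⟩
        have e0 : u.mem 0 i = π ⟨i, hin⟩ := by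
          rw [um 0 (by omega) (by omega)]; exact sm0 ⟨i, hin⟩
        refine RunsWithin.mono (RunsWithin.store_seq (j := i) (v := π ⟨i, hin⟩) (by simp [u7])
          (by simp [u7, e0]) (RunsWithin.store_seq (j := i) (v := 1) (by simp [u7])
            (by simp [F.one_mod]) (RunsWithin.assign ⟨i + 1, hin, ?_, by simp [u0], by simp [u4],
              fun x hx => ?_, fun x hx => ?_, fun a h4 h2 => ?_, rfl⟩))) ?_ (fun _ h => h)
        · simp [Expr.cost]
        · simp [u7, F.one_mod, Nat.mod_eq_of_lt (show i + 1 < 2 ^ w by omega)]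
        · simp only [State.mem_setReg]
          rw [State.mem_setMem_of_ne (by omega), State.mem_setMem_self, Function.update_apply]
          split_ifs with hxi
          · subst hxi; rfl
          · exact um4 x (by omega)
        · simp only [State.mem_setReg]
          rw [State.mem_setMem_self, State.mem_setMem_of_ne (by omega), Function.update_apply]
          split_ifs with hxi
          · rfl
          · exact um2 x (by omega)
        · simp only [State.mem_setReg]
          rw [State.mem_setMem_of_ne h2, State.mem_setMem_of_ne h4, um a h4 h2]
      · left
        refine ⟨by simp [hin], by omega, RunsWithin.assign_seq (v := 0) (by simp) ?_⟩
        refine insertAll_spec F ⟨⟨by simp [u0], by simp [u4], fun x => ?_, fun x => ?_, ?_⟩,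
          fun x => ?_, fun x => ?_⟩ (by simp) ?_
        · simp [um, sm0]
        · rw [elimRank_bot, State.mem_setReg, um4 x (by omega)]
        · intro id hid
          have hk : treeKeys π ⊥ (elimRank ⊥ π) ∅ id = ∅ := by
            ext κ
            by_cases hid' : id < n
            · simp [treeKeys, hid']
            · simp [treeKeys, hid']
          rw [hk]
          have hz : ∀ i, u.mem 3 i = 0 := fun i => by
            rw [um 3 (by omega) (by omega), smem 3 i (by omega)]
          exact ⟨by simp [hz], by simp [hz], by simp⟩
        · rw [State.mem_setReg, um2 x (by omega), elimRank_bot, if_pos rfl]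
        · rw [State.mem_setReg, um 5 (by omega) (by omega), smem 5 _ (by omega)]
          simp
        · rw [State.mem_setReg, um 1 (by omega) (by omega)]
  · simp only [Expr.cost]
    omega

end Preprocessing

end DynamicMIS

/-! ### Averages over a random order -/

namespace DynamicMIS
open Finset

section Resample
variable {n : ℕ}

/-- The order that results from `π` when the vertex `y` and the vertex at position `s` change
places. -/
def resample (π : Equiv.Perm (Fin n)) (s : Fin n) (y : Fin n) : Equiv.Perm (Fin n) :=
  Equiv.swap s (π y) * π

theorem resample_apply_eq_iff {π : Equiv.Perm (Fin n)} {s y z : Fin n} (hy : s ≤ π y) {t : ℕ}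
    (ht : t < s) : (resample π s y z : ℕ) = t ↔ (π z : ℕ) = t := by
  have hy' : (s : ℕ) ≤ π y := hy
  simp only [resample, Equiv.Perm.mul_apply, Equiv.swap_apply_def]
  split_ifs with h1 h2
  · rw [h1]; omega
  · rw [h2]; omega
  · rfl

theorem resample_apply_eq_self_iff {π : Equiv.Perm (Fin n)} {s y z : Fin n} :
    (resample π s y z : ℕ) = s ↔ z = y := by
  rw [Fin.val_inj]
  simp only [resample, Equiv.Perm.mul_apply]
  constructor
  · intro h
    have h' := congrArg (Equiv.swap s (π y)) h
    rw [Equiv.swap_apply_self, Equiv.swap_apply_left] at h'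
    exact π.injective h'
  · rintro rfl
    exact Equiv.swap_apply_right _ _

theorem alive_resample (G : SimpleGraph (Fin n)) {π : Equiv.Perm (Fin n)} {s y : Fin n}
    (hy : s ≤ π y) {t : ℕ} (ht : t ≤ s) : alive G (resample π s y) t = alive G π t := by
  induction t with
  | zero => rfl
  | succ t ih =>
    ext x
    simp only [alive, ih (by omega)]
    exact and_congr_right fun _ => forall_congr' fun z => forall_congr' fun _ => by
      rw [resample_apply_eq_iff hy (by omega)]

/-- Whoever is alive after position `s` if the vertex `y` is moved there. -/
theorem mem_alive_resample_succ (G : SimpleGraph (Fin n)) {π : Equiv.Perm (Fin n)} {s y x : Fin n}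
    (hy : s ≤ π y) : x ∈ alive G (resample π s y) (s + 1) ↔
      x ∈ alive G π s ∧ (y ∈ alive G π s → y ≠ x ∧ ¬ G.Adj y x) := by
  simp only [alive, alive_resample G hy le_rfl, resample_apply_eq_self_iff]
  exact and_congr_right fun _ => ⟨fun h hy => h y hy rfl, fun h z hz hzy => by
    subst hzy; exact h hz⟩

theorem card_filter_le (s : Fin n) : ((univ.filter fun j => s ≤ j).card : ℝ) = n - s := by
  rw [show (univ.filter fun j => s ≤ j) = Ici s by ext; simp, Fin.card_Ici, Nat.cast_sub s.2.le]

theorem card_filter_le_apply (π : Equiv.Perm (Fin n)) (s : Fin n) :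
    (univ.filter fun y => s ≤ π y).card = n - s := by
  rw [← Fin.card_Ici s]
  exact card_bij (fun y _ => π y) (by simp) (by simp)
    fun j hj => ⟨π.symm j, by simpa using hj, by simp⟩

/-- Conditioned on the first `s` positions, the vertex at position `s` is uniformly distributed
among the vertices that do not occur there. -/
theorem sum_resample (f : Equiv.Perm (Fin n) → ℝ) (s : Fin n) :
    ∑ π, ∑ y ∈ univ.filter (fun y => s ≤ π y), f (resample π s y) = (n - s : ℝ) * ∑ π, f π := by
  have h1 : ∀ π : Equiv.Perm (Fin n), ∑ y ∈ univ.filter (fun y => s ≤ π y), f (resample π s y) =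
      ∑ j ∈ univ.filter (fun j => s ≤ j), f (Equiv.swap s j * π) := by
    intro π
    refine sum_bij (fun y _ => π y) (by simp) (by simp) (fun j hj => ⟨π.symm j, ?_⟩)
      (fun y _ => rfl)
    simpa using hj
  simp_rw [h1]
  rw [sum_comm]
  have h2 : ∀ j : Fin n, ∑ π, f (Equiv.swap s j * π) = ∑ π, f π := fun j =>
    Equiv.sum_comp (Equiv.mulLeft (Equiv.swap s j)) f
  simp_rw [h2]
  rw [sum_const, nsmul_eq_mul]
  rw [card_filter_le]

/-- The position of a fixed vertex is uniformly distributed. -/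
theorem sum_apply (g : Fin n → ℝ) (a : Fin n) :
    (n : ℝ) * ∑ π : Equiv.Perm (Fin n), g (π a) =
      (Fintype.card (Equiv.Perm (Fin n)) : ℝ) * ∑ j, g j := by
  have h1 : ∀ c : Fin n, ∑ π : Equiv.Perm (Fin n), g (π a) = ∑ π : Equiv.Perm (Fin n), g (π c) := by
    intro c
    rw [← Equiv.sum_comp (Equiv.mulRight (Equiv.swap a c))]
    simp
  calc (n : ℝ) * ∑ π : Equiv.Perm (Fin n), g (π a)
      = ∑ _c : Fin n, ∑ π : Equiv.Perm (Fin n), g (π a) := by simp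
    _ = ∑ c : Fin n, ∑ π : Equiv.Perm (Fin n), g (π c) := sum_congr rfl fun c _ => h1 c
    _ = ∑ π : Equiv.Perm (Fin n), ∑ c : Fin n, g (π c) := sum_comm
    _ = ∑ π : Equiv.Perm (Fin n), ∑ j : Fin n, g j :=
        sum_congr rfl fun π _ => Equiv.sum_comp π g
    _ = _ := by rw [sum_const, nsmul_eq_mul]; rfl

theorem sum_ite_apply_eq (a s : Fin n) : (n : ℝ) * ∑ π : Equiv.Perm (Fin n),
    (if π a = s then (1 : ℝ) else 0) = Fintype.card (Equiv.Perm (Fin n)) := by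
  rw [sum_apply (fun j => if j = s then (1 : ℝ) else 0)]
  simp

theorem sum_ite_le_apply (a s : Fin n) : (n : ℝ) * ∑ π : Equiv.Perm (Fin n),
    (if s ≤ π a then (1 : ℝ) else 0) = Fintype.card (Equiv.Perm (Fin n)) * (n - s : ℝ) := by
  rw [sum_apply (fun j => if s ≤ j then (1 : ℝ) else 0)]
  rw [sum_boole, card_filter_le]

end Resample

/-! ### The expected number of vertices with different status -/

section Disagree
variable {n : ℕ} (G G' : SimpleGraph (Fin n)) (π : Equiv.Perm (Fin n))

open Classical in
/-- The vertices that are alive at position `s` in exactly one of the scans of `G` and `G'`. -/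
noncomputable def disagree (s : ℕ) : Finset (Fin n) :=
  univ.filter fun x => ¬ (x ∈ alive G π s ↔ x ∈ alive G' π s)

variable {G G' π}

theorem mem_disagree {s : ℕ} {x : Fin n} :
    x ∈ disagree G G' π s ↔ ¬ (x ∈ alive G π s ↔ x ∈ alive G' π s) := by
  simp [disagree]

theorem le_of_mem_alive {s : ℕ} {x : Fin n} (h : x ∈ alive G π s) : s ≤ π x :=
  ((le_elimRank G π).2 h).trans (elimRank_le G π x)

theorem disagree_resample {s y : Fin n} (hy : s ≤ π y) :
    disagree G G' (resample π s y) s = disagree G G' π s := by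
  ext x
  rw [mem_disagree, mem_disagree, alive_resample G hy le_rfl, alive_resample G' hy le_rfl]

open Classical in
/-- The indicator of `y` and `x` being `K`-neighbours with `y` in `S` and `x` in `S'`. -/
noncomputable def isPair (K : SimpleGraph (Fin n)) (S S' : Set (Fin n)) (y x : Fin n) : ℕ :=
  if y ∈ S ∧ x ∈ S' ∧ K.Adj y x then 1 else 0

/-- The number of pairs of `K`-neighbours with the first one in `S` and the second one in `S'`. -/
noncomputable def pairs (K : SimpleGraph (Fin n)) (S S' : Set (Fin n)) : ℕ :=
  ∑ y, ∑ x, isPair K S S' y x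

theorem pairs_comm (K : SimpleGraph (Fin n)) (S S' : Set (Fin n)) :
    pairs K S S' = pairs K S' S := by
  classical
  unfold pairs isPair
  rw [sum_comm]
  refine sum_congr rfl fun y _ => sum_congr rfl fun x _ => if_congr ?_ rfl rfl
  rw [K.adj_comm]; tauto

/-- The propositions `p`, `p'` stand for `x` being alive in the two scans, `q`, `q'` for `y` being
alive, `g`, `g'` for the adjacency of `y` and `x`, `e` for `y ≠ x`, and `t` for the pair being the
toggled edge; the vertex `y` is scanned. -/
theorem disagree_pointwise (p p' q q' g g' e t : Prop) [Decidable p] [Decidable p'] [Decidable q]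
    [Decidable q'] [Decidable g] [Decidable g'] [Decidable e] [Decidable t]
    (hs : ¬ t → p ∨ p' → (g ↔ g')) (he : ¬ e → (p ↔ q) ∧ (p' ↔ q')) :
    (if ¬ (p ∧ (q → e ∧ ¬ g) ↔ p' ∧ (q' → e ∧ ¬ g')) then 1 else 0) +
      ((if (q ∧ q') ∧ (p ∧ ¬ p') ∧ g then 1 else 0) +
        (if (q ∧ q') ∧ (p' ∧ ¬ p) ∧ g' then 1 else 0)) ≤
      (if ¬ (p ↔ p') then 1 else 0) +
      ((if (q ∧ ¬ q') ∧ (p ∧ p') ∧ g then 1 else 0) +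
        (if (q' ∧ ¬ q) ∧ (p ∧ p') ∧ g' then 1 else 0)) + (if t then 1 else 0) := by
  by_cases p <;> by_cases p' <;> by_cases q <;> by_cases q' <;> by_cases g <;> by_cases g' <;>
    by_cases e <;> by_cases t <;> simp_all

open Classical in
/-- The expected number of disagreements does not grow, except through the toggled edge: a
disagreement `x` spreads to a common alive neighbour `y` when `x` is scanned, and it vanishes when
`y` is scanned, which is equally likely. -/
theorem sum_card_disagree_resample_le {a b : Fin n} (T : Toggle G G' a b) (s : Fin n) :
    ∑ y ∈ univ.filter (fun y => s ≤ π y), (disagree G G' (resample π s y) (s + 1)).card ≤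
      (n - s) * (disagree G G' π s).card + 2 * if s ≤ π a then 1 else 0 := by
  set V := alive G π s with hV
  set V' := alive G' π s with hV'
  set U := univ.filter (fun y => s ≤ π y) with hU
  have hVU : ∀ y ∈ V, y ∈ U := fun y hy => by simpa [hU] using le_of_mem_alive hy
  have hVU' : ∀ y ∈ V', y ∈ U := fun y hy => by simpa [hU] using le_of_mem_alive hy
  have point : ∀ y ∈ U, ∀ x,
      (if x ∈ disagree G G' (resample π s y) (s + 1) then 1 else 0) +
      (isPair G (V ∩ V') (V \ V') y x + isPair G' (V ∩ V') (V' \ V) y x) ≤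
      (if x ∈ disagree G G' π s then 1 else 0) +
      (isPair G (V \ V') (V ∩ V') y x + isPair G' (V' \ V) (V ∩ V') y x) +
      (if s ≤ π a ∧ (y = a ∧ x = b ∨ y = b ∧ x = a) then 1 else 0) := by
    intro y hy x
    have hy' : s ≤ π y := by simpa [hU] using hy
    simp only [isPair, mem_disagree, mem_alive_resample_succ G hy', mem_alive_resample_succ G' hy',
      ← hV, ← hV', Set.mem_inter_iff, Set.mem_sdiff]
    refine disagree_pointwise _ _ _ _ _ _ _ _ (fun ht hx => ?_) (fun he => ?_)
    · have hx' : s ≤ π x := hx.elim (fun h => le_of_mem_alive h) fun h => le_of_mem_alive h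
      refine T.same y x (fun h => ht ⟨?_, .inl h⟩) (fun h => ht ⟨?_, .inr h⟩)
      · rw [← h.1]; exact hy'
      · rw [← h.2]; exact hx'
    · rw [not_not.1 he]; exact ⟨Iff.rfl, Iff.rfl⟩
  -- summed over `y` and `x`, the `isPair` terms on the two sides cancel by symmetry
  have sum := sum_le_sum fun y hy => sum_le_sum fun x (_ : x ∈ univ) => point y hy x
  simp only [sum_add_distrib] at sum
  have restrict : ∀ (K : SimpleGraph (Fin n)) (S S' : Set (Fin n)), (∀ y ∈ S, y ∈ U) →
      ∑ y ∈ U, ∑ x, isPair K S S' y x = pairs K S S' := by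
    intro K S S' hS
    refine sum_subset (subset_univ _) fun y _ hy => sum_eq_zero fun x _ => if_neg fun h => hy (hS y h.1)
  rw [restrict G _ _ fun y hy => hVU y hy.1, restrict G' _ _ fun y hy => hVU y hy.1,
    restrict G _ _ fun y hy => hVU y hy.1, restrict G' _ _ fun y hy => hVU' y hy.1,
    pairs_comm G (V \ V'), pairs_comm G' (V' \ V)] at sum
  have hleft : ∑ y ∈ U, (disagree G G' (resample π s y) (s + 1)).card =
      ∑ y ∈ U, ∑ x, if x ∈ disagree G G' (resample π s y) (s + 1) then 1 else 0 :=
    sum_congr rfl fun y _ => by simp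
  have hright : ∑ y ∈ U, ∑ x, (if x ∈ disagree G G' π s then 1 else 0) =
      (n - s) * (disagree G G' π s).card := by
    rw [sum_const, card_filter_le_apply, smul_eq_mul]
    simp
  have htrig : ∑ y ∈ U, ∑ x, (if s ≤ π a ∧ (y = a ∧ x = b ∨ y = b ∧ x = a) then 1 else 0) ≤
      2 * if s ≤ π a then 1 else 0 := by
    by_cases hsa : s ≤ π a
    · simp only [hsa, true_and, if_true]
      rw [← sum_product', ← card_filter]
      refine (card_le_card (t := {(a, b), (b, a)}) fun q hq => ?_).trans card_le_two
      simp only [mem_filter, mem_insert, mem_singleton, Prod.ext_iff] at hq ⊢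
      exact hq.2
    · simp [hsa]
  rw [hleft, ← hright]
  omega

variable (G G') in
/-- The expected number of disagreements at position `s` is at most `2 * s / n`. -/
theorem sum_card_disagree_le {a b : Fin n} (T : Toggle G G' a b) {s : ℕ} (hs : s ≤ n) :
    (n : ℝ) * ∑ π : Equiv.Perm (Fin n), ((disagree G G' π s).card : ℝ) ≤
      2 * s * Fintype.card (Equiv.Perm (Fin n)) := by
  classical
  induction s with
  | zero => simp [disagree, alive]
  | succ s ih =>
    have ih := ih (by omega)
    set t : Fin n := ⟨s, hs⟩ with ht
    have hpos : (0 : ℝ) < n - s := by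
      have : (s : ℝ) + 1 ≤ n := by exact_mod_cast hs
      linarith
    have h1 := sum_resample (fun π => ((disagree G G' π (s + 1)).card : ℝ)) t
    have h2 : ∀ π : Equiv.Perm (Fin n), ∑ y ∈ univ.filter (fun y => t ≤ π y),
        ((disagree G G' (resample π t y) (s + 1)).card : ℝ) ≤
        (n - s) * (disagree G G' π s).card + 2 * (if t ≤ π a then (1 : ℝ) else 0) := by
      intro π
      have := sum_card_disagree_resample_le (π := π) T t
      have h3 : ((∑ y ∈ univ.filter (fun y => t ≤ π y),
        (disagree G G' (resample π t y) (s + 1)).card : ℕ) : ℝ) ≤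
        (((n - s) * (disagree G G' π s).card + 2 * (if t ≤ π a then 1 else 0) : ℕ) : ℝ) :=
        Nat.cast_le.2 this
      push_cast [Nat.cast_sub (show s ≤ n by omega)] at h3
      exact h3
    have h3 := sum_le_sum fun π (_ : π ∈ univ) => h2 π
    rw [h1, sum_add_distrib, ← mul_sum, ← mul_sum] at h3
    have h4 := sum_ite_le_apply a t
    simp only [ht] at h3 h4
    -- the toggled edge contributes `2 * (n - s) / n` on average, and `sum_resample` divides by `n - s`
    have h5 : (n - s : ℝ) * (n * ∑ π : Equiv.Perm (Fin n), ((disagree G G' π (s + 1)).card : ℝ)) ≤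
        (n - s) * (2 * (s + 1 : ℕ) * Fintype.card (Equiv.Perm (Fin n))) := by
      have h6 := mul_le_mul_of_nonneg_left h3 (Nat.cast_nonneg (α := ℝ) n)
      have h7 := mul_le_mul_of_nonneg_left ih hpos.le
      push_cast at h4 ⊢
      nlinarith
    exact le_of_mul_le_mul_left h5 hpos

/-- The number of orders for which the vertex at position `s` enters or leaves the greedy MIS. -/
theorem sum_flip_le {a b : Fin n} (T : Toggle G G' a b) (s : Fin n) :
    (n : ℝ) * ((n - s : ℝ) * ∑ π : Equiv.Perm (Fin n),
      (if π.symm s ∈ disagree G G' π s then (1 : ℝ) else 0)) ≤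
      2 * s * Fintype.card (Equiv.Perm (Fin n)) := by
  classical
  rw [← sum_resample]
  refine le_trans (mul_le_mul_of_nonneg_left (sum_le_sum fun π _ => ?_) (Nat.cast_nonneg n))
    (sum_card_disagree_le G G' T s.2.le)
  have h1 : ∀ y ∈ univ.filter (fun y => s ≤ π y),
      (if (resample π s y).symm s ∈ disagree G G' (resample π s y) s then (1 : ℝ) else 0) =
      if y ∈ disagree G G' π s then 1 else 0 := by
    intro y hy
    have hy' : s ≤ π y := by simpa using hy
    have : (resample π s y).symm s = y := by
      rw [Equiv.symm_apply_eq]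
      exact (Fin.ext (resample_apply_eq_self_iff.2 rfl)).symm
    rw [this, disagree_resample hy']
  rw [sum_congr rfl h1, sum_boole]
  exact_mod_cast card_le_card fun y hy => (mem_filter.1 hy).2

end Disagree

end DynamicMIS

/-! ### Degrees among the alive vertices -/

namespace DynamicMIS
open Finset

section Tail
variable {n : ℕ} (G : SimpleGraph (Fin n))

open Classical in
theorem aliveDegree_eq_card {π : Equiv.Perm (Fin n)} {s : ℕ} {x : Fin n} :
    aliveDegree G π s x = (univ.filter fun z => G.Adj x z ∧ z ∈ alive G π s).card := by
  classical
  unfold aliveDegree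
  congr 1
  ext z
  simp [le_elimRank]

theorem aliveDegree_antitone (π : Equiv.Perm (Fin n)) (x : Fin n) :
    Antitone fun s => aliveDegree G π s x := by
  classical
  intro s t hst
  simp only [aliveDegree_eq_card]
  exact card_le_card fun z hz => by
    simp only [mem_filter, mem_univ, true_and] at hz ⊢
    exact ⟨hz.1, alive_antitone G π hst hz.2⟩

open Classical in
/-- A vertex `x` with more than `d` alive neighbours survives the next scanned vertex for at most
`n - s - d` of the `n - s` choices of that vertex, and no alive degree grows. -/
theorem sum_resample_tail_le (π : Equiv.Perm (Fin n)) (s x : Fin n) (d : ℝ) :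
    ∑ y ∈ univ.filter (fun y => s ≤ π y),
      (if x ∈ alive G (resample π s y) (s + 1) ∧ d < aliveDegree G (resample π s y) (s + 1) x
        then (1 : ℝ) else 0) ≤
      (n - s - d) * if x ∈ alive G π s ∧ d < aliveDegree G π s x then 1 else 0 := by
  have h1 : ∀ y ∈ univ.filter (fun y => s ≤ π y),
      (x ∈ alive G (resample π s y) (s + 1) ∧ d < aliveDegree G (resample π s y) (s + 1) x) →
      (x ∈ alive G π s ∧ d < aliveDegree G π s x) ∧ ¬ (G.Adj x y ∧ y ∈ alive G π s) := by
    intro y hy ⟨h, hd⟩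
    have hy' : s ≤ π y := by simpa using hy
    have e : aliveDegree G (resample π s y) s x = aliveDegree G π s x := by
      rw [aliveDegree_eq_card, aliveDegree_eq_card, alive_resample G hy' le_rfl]
    have h2 : aliveDegree G (resample π s y) (s + 1) x ≤ aliveDegree G π s x :=
      e ▸ aliveDegree_antitone G (resample π s y) x (Nat.le_succ s)
    rw [mem_alive_resample_succ G hy'] at h
    refine ⟨⟨h.1, hd.trans_le (Nat.cast_le.2 h2)⟩, fun h3 => (h.2 h3.2).2 h3.1.symm⟩
  by_cases hx : x ∈ alive G π s ∧ d < aliveDegree G π s x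
  · rw [if_pos hx, mul_one, sum_boole]
    set U := univ.filter (fun y => s ≤ π y) with hU
    have h2 : (U.filter fun y => G.Adj x y ∧ y ∈ alive G π s).card = aliveDegree G π s x := by
      rw [aliveDegree_eq_card]
      congr 1
      ext z
      simp only [hU, mem_filter, mem_univ, true_and, and_iff_right_iff_imp]
      exact fun h => le_of_mem_alive h.2
    have h3 := card_filter_add_card_filter_not (s := U) (fun y => G.Adj x y ∧ y ∈ alive G π s)
    rw [h2] at h3
    have h4 : (U.filter fun y => x ∈ alive G (resample π s y) (s + 1) ∧
        d < aliveDegree G (resample π s y) (s + 1) x).card ≤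
        (U.filter fun y => ¬ (G.Adj x y ∧ y ∈ alive G π s)).card :=
      card_le_card fun y hy => by
        rw [mem_filter] at hy ⊢
        exact ⟨hy.1, (h1 y hy.1 hy.2).2⟩
    have h5 : (U.card : ℝ) = n - s := by
      rw [hU, card_filter_le_apply, Nat.cast_sub s.2.le]
    have h6 := congrArg (Nat.cast (R := ℝ)) h3
    push_cast at h6
    have h7 := Nat.cast_le (α := ℝ).2 h4
    have := hx.2
    linarith
  · rw [if_neg hx, mul_zero]
    exact (sum_eq_zero fun y hy => if_neg fun h => hx (h1 y hy h).1).le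

open Classical in
/-- A vertex with more than `d` alive neighbours is eliminated with probability at least `d / n` in
each step of the scan. -/
theorem sum_tail_le (x : Fin n) {d : ℝ} (hd : 0 ≤ d) {s : ℕ} (hs : s ≤ n) :
    ∑ π : Equiv.Perm (Fin n),
      (if x ∈ alive G π s ∧ d < aliveDegree G π s x then (1 : ℝ) else 0) ≤
      Fintype.card (Equiv.Perm (Fin n)) * Real.exp (-(d / n * s)) := by
  induction s with
  | zero =>
    calc _ ≤ ∑ π : Equiv.Perm (Fin n), (1 : ℝ) := sum_le_sum fun π _ => by split_ifs <;> norm_num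
      _ = _ := by simp [card_univ]
  | succ s ih =>
    have ih := ih (by omega)
    set t : Fin n := ⟨s, hs⟩ with ht
    have hpos : (0 : ℝ) < n - s := by
      have : (s : ℝ) + 1 ≤ n := by exact_mod_cast hs
      linarith
    have hn : (0 : ℝ) < n := by have := Nat.cast_nonneg (α := ℝ) s; linarith
    have h1 := sum_resample (fun π =>
      if x ∈ alive G π (s + 1) ∧ d < aliveDegree G π (s + 1) x then (1 : ℝ) else 0) t
    have h2 := sum_le_sum fun π (_ : π ∈ univ) => sum_resample_tail_le G π t x d
    simp only [ht] at h1 h2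
    rw [h1, ← mul_sum] at h2
    have h3 : (n - s - d : ℝ) ≤ (n - s) * Real.exp (-(d / n)) := by
      have h4 := Real.add_one_le_exp (-(d / n))
      have h5 : (n - s : ℝ) * (d / n) ≤ d := by
        rw [← mul_div_assoc, div_le_iff₀ hn]
        have := Nat.cast_nonneg (α := ℝ) s
        nlinarith
      nlinarith
    have hnn : (0 : ℝ) ≤ ∑ π : Equiv.Perm (Fin n),
        (if x ∈ alive G π s ∧ d < aliveDegree G π s x then (1 : ℝ) else 0) :=
      sum_nonneg fun π _ => by split_ifs <;> norm_num
    have h4 := h2.trans (mul_le_mul_of_nonneg_right h3 hnn)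
    rw [mul_assoc] at h4
    refine (le_of_mul_le_mul_left h4 hpos).trans ?_
    refine (mul_le_mul_of_nonneg_left ih (Real.exp_pos _).le).trans_eq ?_
    rw [mul_left_comm, ← Real.exp_add]
    push_cast
    ring_nf

end Tail

/-! ### The expected cost of a repair -/

section Expectation
variable {n : ℕ}

/-- The bound for the number of alive neighbours at position `s`, which holds with high
probability. The factor `12` makes the failure probability at most `n ^ (-6)` for each vertex and
position, and the bound exceeds `n` at position `0`. -/
noncomputable def degreeBound (n s : ℕ) : ℝ := 12 * n * (1 + Real.log n) / (s + 1)

theorem one_le_one_add_log (hn : 0 < n) : 1 ≤ 1 + Real.log n := by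
  have := Real.log_nonneg (x := n) (by exact_mod_cast hn)
  linarith

theorem le_degreeBound_zero (hn : 0 < n) : (n : ℝ) ≤ degreeBound n 0 := by
  have := one_le_one_add_log hn
  have h : (0 : ℝ) < n := by exact_mod_cast hn
  unfold degreeBound
  push_cast
  rw [zero_add, div_one]
  nlinarith

theorem degreeBound_nonneg (hn : 0 < n) (s : ℕ) : 0 ≤ degreeBound n s := by
  have := one_le_one_add_log hn
  unfold degreeBound
  positivity

theorem one_le_degreeBound {s : ℕ} (hs : s < n) : 1 ≤ degreeBound n s := by
  have := one_le_one_add_log (n := n) (by omega)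
  have h : (s : ℝ) + 1 ≤ n := by exact_mod_cast hs
  unfold degreeBound
  rw [le_div_iff₀ (by positivity)]
  nlinarith [Nat.cast_nonneg (α := ℝ) s]

/-- The number of alive neighbours of the alive vertices obeys the bounds `degreeBound`. -/
def LowDegree (G : SimpleGraph (Fin n)) (π : Equiv.Perm (Fin n)) : Prop :=
  ∀ s x : Fin n, x ∈ alive G π s → (aliveDegree G π s x : ℝ) ≤ degreeBound n s

theorem exp_degreeBound_le {s : ℕ} (hs : 1 ≤ s) (hn : 0 < n) :
    Real.exp (-(degreeBound n s / n * s)) ≤ 1 / (n : ℝ) ^ 6 := by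
  have hn' : (0 : ℝ) < n := by exact_mod_cast hn
  have h1 := one_le_one_add_log hn
  have hs' : (1 : ℝ) ≤ s := by exact_mod_cast hs
  have h2 : 6 * Real.log n ≤ degreeBound n s / n * s := by
    unfold degreeBound
    have : 12 * n * (1 + Real.log n) / (s + 1) / n * s = 12 * (1 + Real.log n) * s / (s + 1) := by
      field_simp
    rw [this, le_div_iff₀ (by positivity)]
    nlinarith
  calc Real.exp (-(degreeBound n s / n * s)) ≤ Real.exp (-(6 * Real.log n)) :=
        Real.exp_le_exp.2 (by linarith)
    _ = 1 / (n : ℝ) ^ 6 := by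
        rw [Real.exp_neg, one_div, show (6 : ℝ) * Real.log n = (6 : ℕ) * Real.log n by norm_num,
          Real.exp_nat_mul, Real.exp_log hn']

open Classical in
theorem sum_not_lowDegree_le (G : SimpleGraph (Fin n)) (hn : 0 < n) :
    ∑ π : Equiv.Perm (Fin n), (if LowDegree G π then (0 : ℝ) else 1) ≤
      Fintype.card (Equiv.Perm (Fin n)) * (n * n * (1 / (n : ℝ) ^ 6)) := by
  have h1 : ∀ π : Equiv.Perm (Fin n), (if LowDegree G π then (0 : ℝ) else 1) ≤
      ∑ s : Fin n, ∑ x : Fin n,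
        if x ∈ alive G π s ∧ degreeBound n s < aliveDegree G π s x then (1 : ℝ) else 0 := by
    intro π
    have nn : ∀ s x : Fin n, (0 : ℝ) ≤
        if x ∈ alive G π s ∧ degreeBound n s < aliveDegree G π s x then (1 : ℝ) else 0 :=
      fun s x => by split_ifs <;> norm_num
    split_ifs with h
    · exact sum_nonneg fun s _ => sum_nonneg fun x _ => nn s x
    · unfold LowDegree at h
      push Not at h
      obtain ⟨s, x, hx⟩ := h
      calc (1 : ℝ) = if x ∈ alive G π s ∧ degreeBound n s < aliveDegree G π s x
            then (1 : ℝ) else 0 := (if_pos hx).symm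
        _ ≤ ∑ x : Fin n, if x ∈ alive G π s ∧ degreeBound n s < aliveDegree G π s x
            then (1 : ℝ) else 0 := single_le_sum (fun x _ => nn s x) (mem_univ x)
        _ ≤ _ := single_le_sum (f := fun s : Fin n => ∑ x : Fin n,
            if x ∈ alive G π s ∧ degreeBound n s < aliveDegree G π s x then (1 : ℝ) else 0)
            (fun s _ => sum_nonneg fun x _ => nn s x) (mem_univ s)
  refine (sum_le_sum fun π _ => h1 π).trans ?_
  rw [sum_comm]
  have h2 : ∀ s : Fin n, ∑ π : Equiv.Perm (Fin n), ∑ x : Fin n,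
      (if x ∈ alive G π s ∧ degreeBound n s < aliveDegree G π s x then (1 : ℝ) else 0) ≤
      n * (Fintype.card (Equiv.Perm (Fin n)) * (1 / (n : ℝ) ^ 6)) := by
    intro s
    rw [sum_comm]
    refine (sum_le_sum (g := fun _ => Fintype.card (Equiv.Perm (Fin n)) * (1 / (n : ℝ) ^ 6))
      fun x _ => ?_).trans_eq (by simp)
    -- the tail bound is void at position `0`, where `degreeBound` exceeds every degree anyway
    rcases Nat.eq_zero_or_pos (s : ℕ) with h | h
    · rw [sum_eq_zero fun π _ => if_neg fun h' => ?_]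
      · positivity
      · have h3 := h'.2
        rw [h] at h3
        have h4 := le_degreeBound_zero hn
        have h5 : (aliveDegree G π 0 x : ℝ) ≤ n := by exact_mod_cast aliveDegree_le ..
        linarith
    · refine (sum_tail_le G x (degreeBound_nonneg hn s) s.2.le).trans ?_
      exact mul_le_mul_of_nonneg_left (exp_degreeBound_le h hn) (Nat.cast_nonneg _)
  refine (sum_le_sum fun s _ => h2 s).trans_eq ?_
  simp
  ring

open Classical in
/-- The vertices whose elimination rank changes because of what happens at position `s` are at most
one endpoint of the toggled edge, or neighbours of the vertex at position `s`, provided that it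
enters or leaves the greedy MIS. -/
theorem card_diffRank_eq_le_of_lt {G G' : SimpleGraph (Fin n)} {π : Equiv.Perm (Fin n)}
    {a b : Fin n} (T : Toggle G G' a b) (hab : π a < π b) (hG : LowDegree G π)
    (hG' : LowDegree G' π) (s : Fin n) :
    ((univ.filter fun x => elimRank G π x ≠ elimRank G' π x ∧ diffRank G G' π x = s).card : ℝ) ≤
      (if π a = s then 1 else 0) +
      (if π.symm s ∈ disagree G G' π s then 1 else 0) * degreeBound n s := by
  have hR := degreeBound_nonneg (n := n) (by have := s.2; omega) s
  set y := π.symm s with hy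
  have hys : π y = s := by simp [hy]
  have first : ∀ x, elimRank G π x ≠ elimRank G' π x ∧ diffRank G G' π x = s →
      y = a ∧ x = b ∨ elimRank G π y ≠ elimRank G' π y ∧
        (elimRank G π y = s ∨ elimRank G' π y = s) ∧ G.Adj y x ∧ G'.Adj y x := by
    intro x hx
    obtain ⟨z, hz, h⟩ := T.exists_first hab hx.1
    obtain rfl : z = y := π.injective (Fin.ext (by rw [hz, hys]; exact hx.2))
    rw [hys] at h
    exact h.imp_left fun h => ⟨h.1, h.2.1⟩
  by_cases ha : y = a
  · have h1 : π a = s := by rw [← ha, hys]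
    rw [if_pos h1]
    have h2 : (univ.filter fun x => elimRank G π x ≠ elimRank G' π x ∧
        diffRank G G' π x = s).card ≤ 1 := by
      refine card_le_one.2 fun x hx x' hx' => ?_
      have key : ∀ x, elimRank G π x ≠ elimRank G' π x ∧ diffRank G G' π x = s → x = b :=
        fun x hx => (first x hx).elim And.right fun h =>
          absurd (T.elimRank_fst hab) (ha ▸ h.1)
      rw [key x (mem_filter.1 hx).2, key x' (mem_filter.1 hx').2]
    have h3 : (0 : ℝ) ≤ (if y ∈ disagree G G' π s then 1 else 0) * degreeBound n s :=
      mul_nonneg (by split_ifs <;> norm_num) hR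
    have h4 := Nat.cast_le (α := ℝ).2 h2
    push_cast at h4
    linarith
  · have h1 : π a ≠ s := fun h => ha (by rw [hy, ← h, Equiv.symm_apply_apply])
    rw [if_neg h1, zero_add]
    by_cases hF : elimRank G π y ≠ elimRank G' π y ∧
        (elimRank G π y = s ∨ elimRank G' π y = s)
    · have hG1 := elimRank_le G π y
      have hG2 := elimRank_le G' π y
      rw [hys] at hG1 hG2
      have hd : y ∈ disagree G G' π s := by
        rw [mem_disagree, ← le_elimRank, ← le_elimRank]; omega
      rw [if_pos hd, one_mul]
      have key : ∀ H : SimpleGraph (Fin n), LowDegree H π → elimRank H π y = s →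
          (∀ x, elimRank G π x ≠ elimRank G' π x ∧ diffRank G G' π x = s →
            H.Adj y x ∧ s ≤ elimRank H π x) →
          ((univ.filter fun x => elimRank G π x ≠ elimRank G' π x ∧
            diffRank G G' π x = s).card : ℝ) ≤ degreeBound n s := by
        intro H hH e h
        refine le_trans (Nat.cast_le.2 (card_le_card fun x hx => ?_))
          (hH s y ((le_elimRank H π).1 e.ge))
        exact mem_filter.2 ⟨mem_univ _, h x (mem_filter.1 hx).2⟩
      rcases hF.2 with e | e
      · refine key G hG e fun x hx => ⟨?_, by have := hx.2; unfold diffRank at this; omega⟩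
        exact ((first x hx).resolve_left fun h => ha h.1).2.2.1
      · refine key G' hG' e fun x hx => ⟨?_, by have := hx.2; unfold diffRank at this; omega⟩
        exact ((first x hx).resolve_left fun h => ha h.1).2.2.2
    · rw [filter_eq_empty_iff.2 fun x _ hx => ?_]
      · simp only [card_empty, Nat.cast_zero]
        exact mul_nonneg (by split_ifs <;> norm_num) hR
      · exact (first x hx).elim (fun h => ha h.1) fun h => hF ⟨h.1, h.2.1⟩

open Classical in
theorem card_diffRank_eq_le {G G' : SimpleGraph (Fin n)} {π : Equiv.Perm (Fin n)}
    {a b : Fin n} (T : Toggle G G' a b) (hab : a ≠ b) (hG : LowDegree G π)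
    (hG' : LowDegree G' π) (s : Fin n) :
    ((univ.filter fun x => elimRank G π x ≠ elimRank G' π x ∧ diffRank G G' π x = s).card : ℝ) ≤
      (if π a = s then 1 else 0) + (if π b = s then 1 else 0) +
      (if π.symm s ∈ disagree G G' π s then 1 else 0) * degreeBound n s := by
  have h : ∀ x : Fin n, (0 : ℝ) ≤ if π x = s then 1 else 0 := fun x => by split_ifs <;> norm_num
  rcases lt_or_gt_of_ne (π.injective.ne hab) with h1 | h1
  · linarith [card_diffRank_eq_le_of_lt T h1 hG hG' s, h b]
  · linarith [card_diffRank_eq_le_of_lt T.swap h1 hG hG' s, h a]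

open Classical in
theorem repairCost_le_sum {G G' : SimpleGraph (Fin n)} {π : Equiv.Perm (Fin n)}
    {a b : Fin n} (T : Toggle G G' a b) (hab : a ≠ b) (hG : LowDegree G π)
    (hG' : LowDegree G' π) :
    (repairCost G G' π 0 : ℝ) ≤ ∑ s : Fin n,
      ((if π a = s then 1 else 0) + (if π b = s then 1 else 0) +
      (if π.symm s ∈ disagree G G' π s then 1 else 0) * degreeBound n s) *
        (2 * degreeBound n s + 2) := by
  set A := univ.filter fun x => elimRank G π x ≠ elimRank G' π x with hA
  have hlt : ∀ x, diffRank G G' π x < n := fun x => by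
    have := elimRank_lt G π x
    unfold diffRank; omega
  have h1 : (repairCost G G' π 0 : ℝ) ≤
      ∑ x ∈ A, (2 * degreeBound n (diffRank G G' π x) + 2) := by
    unfold repairCost
    simp only [Nat.zero_le, and_true]
    push_cast
    refine sum_le_sum fun x _ => ?_
    have e1 := hG ⟨_, hlt x⟩ x ((le_elimRank G π).1 (min_le_left _ _))
    have e2 := hG' ⟨_, hlt x⟩ x ((le_elimRank G' π).1 (min_le_right _ _))
    simp only at e1 e2
    linarith
  refine h1.trans ?_
  rw [← sum_fiberwise A fun x => (⟨_, hlt x⟩ : Fin n)]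
  refine sum_le_sum fun s _ => ?_
  have h2 : ∀ x ∈ A.filter (fun x => (⟨_, hlt x⟩ : Fin n) = s),
      2 * degreeBound n (diffRank G G' π x) + 2 = 2 * degreeBound n s + 2 := by
    intro x hx
    rw [← (mem_filter.1 hx).2]
  rw [sum_congr rfl h2, sum_const, nsmul_eq_mul]
  refine mul_le_mul_of_nonneg_right ?_ ?_
  · refine le_trans (Nat.cast_le.2 (card_le_card fun x hx => ?_)) (card_diffRank_eq_le T hab hG hG' s)
    rw [mem_filter, hA, mem_filter, Fin.ext_iff] at hx
    exact mem_filter.2 ⟨mem_univ _, hx.1.2, hx.2⟩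
  · have := degreeBound_nonneg (n := n) (by have := s.2; omega) s
    linarith

theorem sum_inv_succ_le (n : ℕ) : ∑ s : Fin n, (1 / (s + 1 : ℝ)) ≤ 1 + Real.log n := by
  refine le_trans (le_of_eq ?_) (harmonic_le_one_add_log n)
  rw [Fin.sum_univ_eq_sum_range (fun s => 1 / (s + 1 : ℝ)) n, harmonic]
  push_cast
  simp

theorem sum_inv_sub_le (n : ℕ) : ∑ s : Fin n, (1 / (n - s : ℝ)) ≤ 1 + Real.log n := by
  refine le_trans (le_of_eq ?_) (sum_inv_succ_le n)
  rw [← Equiv.sum_comp Fin.revPerm]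
  refine sum_congr rfl fun s _ => ?_
  rw [Fin.revPerm_apply, Fin.val_rev, Nat.cast_sub s.2]
  push_cast
  ring_nf

/-- The contribution of the endpoints of the toggled edge, which are at position `s` with
probability `2 / n`. -/
theorem trigger_term_le {s : ℕ} (hs : s < n) :
    2 / n * (2 * degreeBound n s + 2) ≤ 96 * (1 + Real.log n) * (1 / (s + 1)) := by
  have h1 := one_le_degreeBound hs
  have hn : (0 : ℝ) < n := by exact_mod_cast (by omega : 0 < n)
  calc 2 / n * (2 * degreeBound n s + 2) ≤ 2 / n * (4 * degreeBound n s) :=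
        mul_le_mul_of_nonneg_left (by linarith) (by positivity)
    _ = _ := by unfold degreeBound; field_simp; norm_num

/-- The contribution of the vertex at position `s` entering or leaving the greedy MIS, which has
probability at most `2 * s / (n * (n - s))` by `sum_flip_le`. -/
theorem spread_term_le {s : ℕ} (hs : s < n) :
    2 * s / (n * (n - s)) * degreeBound n s * (2 * degreeBound n s + 2) ≤
      1152 * (1 + Real.log n) ^ 2 * (1 / (n - s) + 1 / (s + 1)) := by
  have h1 := one_le_degreeBound hs
  have hn : (0 : ℝ) < n := by exact_mod_cast (by omega : 0 < n)
  have hns : (0 : ℝ) < n - s := sub_pos.2 (by exact_mod_cast hs)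
  have hs0 : (0 : ℝ) ≤ s := Nat.cast_nonneg s
  calc 2 * s / (n * (n - s)) * degreeBound n s * (2 * degreeBound n s + 2)
      ≤ 2 * s / (n * (n - s)) * degreeBound n s * (4 * degreeBound n s) :=
        mul_le_mul_of_nonneg_left (by linarith) (by positivity)
    _ = 1152 * (1 + Real.log n) ^ 2 * (n * s / ((n - s) * (s + 1) ^ 2)) := by
        unfold degreeBound; field_simp; ring
    _ ≤ 1152 * (1 + Real.log n) ^ 2 * (1 / (n - s) + 1 / (s + 1)) := by
        refine mul_le_mul_of_nonneg_left ?_ (by positivity)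
        rw [div_add_div _ _ hns.ne' (by positivity), div_le_div_iff₀ (by positivity) (by positivity)]
        have h2 : n * s * ((n - s) * (s + 1 : ℝ)) ≤ (n + 1) * (s + 1) * ((n - s) * (s + 1)) := by
          refine mul_le_mul_of_nonneg_right ?_ (by positivity)
          nlinarith
        nlinarith

open Classical in
/-- The number of vertices that an update affects, counted with their numbers of alive neighbours,
is polylogarithmic in expectation. -/
theorem sum_repairCost_le {G G' : SimpleGraph (Fin n)} {a b : Fin n} (T : Toggle G G' a b)
    (hab : a ≠ b) : ∑ π : Equiv.Perm (Fin n), (repairCost G G' π 0 : ℝ) ≤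
      Fintype.card (Equiv.Perm (Fin n)) * (2408 * (1 + Real.log n) ^ 3) := by
  have hn : 0 < n := by have := a.2; omega
  have hn' : (1 : ℝ) ≤ n := by exact_mod_cast hn
  have hL := one_le_one_add_log hn
  set L := 1 + Real.log n with hLdef
  set N : ℝ := ((Fintype.card (Equiv.Perm (Fin n)) : ℕ) : ℝ) with hN
  have hN0 : 0 ≤ N := Nat.cast_nonneg _
  set main : Equiv.Perm (Fin n) → Fin n → ℝ := fun π s =>
    ((if π a = s then 1 else 0) + (if π b = s then 1 else 0) +
      (if π.symm s ∈ disagree G G' π s then 1 else 0) * degreeBound n s) *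
        (2 * degreeBound n s + 2) with hmain
  set bad : SimpleGraph (Fin n) → Equiv.Perm (Fin n) → ℝ := fun H π =>
    if LowDegree H π then 0 else 1 with hbad
  have hR := fun s : Fin n => degreeBound_nonneg hn s
  have hmain0 : ∀ π s, 0 ≤ main π s := fun π s => by
    have := hR s
    have h1 : ∀ x : Fin n, (0 : ℝ) ≤ if π x = s then 1 else 0 := fun x => by split_ifs <;> norm_num
    have h2 : (0 : ℝ) ≤ if π.symm s ∈ disagree G G' π s then 1 else 0 := by split_ifs <;> norm_num
    exact mul_nonneg (add_nonneg (add_nonneg (h1 a) (h1 b)) (mul_nonneg h2 this)) (by linarith)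
  have hbad0 : ∀ H π, 0 ≤ bad H π := fun H π => by simp only [hbad]; split_ifs <;> norm_num
  have point : ∀ π : Equiv.Perm (Fin n), (repairCost G G' π 0 : ℝ) ≤
      ∑ s, main π s + (bad G π + bad G' π) * (4 * n ^ 2) := by
    intro π
    have h0 := sum_nonneg fun s (_ : s ∈ univ) => hmain0 π s
    -- if a degree bound fails, the trivial bound on the cost is good enough
    have htriv : (repairCost G G' π 0 : ℝ) ≤ 4 * n ^ 2 := by
      have : (repairCost G G' π 0 : ℝ) ≤ n * (n + n + 2) := by exact_mod_cast repairCost_le 0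
      nlinarith
    by_cases hG : LowDegree G π
    · by_cases hG' : LowDegree G' π
      · have := repairCost_le_sum T hab hG hG'
        have e : bad G π = 0 := if_pos hG
        have e' : bad G' π = 0 := if_pos hG'
        rw [e, e']
        linarith
      · have e' : bad G' π = 1 := if_neg hG'
        nlinarith [hbad0 G π]
    · have e : bad G π = 1 := if_neg hG
      nlinarith [hbad0 G' π]
  refine (sum_le_sum fun π _ => point π).trans ?_
  rw [sum_add_distrib, ← sum_mul, sum_add_distrib, sum_comm]
  have hsum : ∀ s : Fin n, ∑ π : Equiv.Perm (Fin n), main π s ≤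
      N * (96 * L * (1 / (s + 1)) + 1152 * L ^ 2 * (1 / (n - s) + 1 / (s + 1))) := by
    intro s
    have hns : (0 : ℝ) < n - s := sub_pos.2 (by exact_mod_cast s.2)
    have ha := sum_ite_apply_eq a s
    have hb := sum_ite_apply_eq b s
    have hF := sum_flip_le T s
    simp only [hmain]
    rw [← sum_mul, sum_add_distrib, sum_add_distrib, ← sum_mul]
    set Sa := ∑ π : Equiv.Perm (Fin n), (if π a = s then (1 : ℝ) else 0)
    set Sb := ∑ π : Equiv.Perm (Fin n), (if π b = s then (1 : ℝ) else 0)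
    set SF := ∑ π : Equiv.Perm (Fin n), (if π.symm s ∈ disagree G G' π s then (1 : ℝ) else 0)
    have ha' : Sa = N / n := by rw [eq_div_iff (by positivity)]; linarith
    have hb' : Sb = N / n := by rw [eq_div_iff (by positivity)]; linarith
    have hF' : SF ≤ N * (2 * s / (n * (n - s))) := by
      rw [← mul_div_assoc, le_div_iff₀ (by positivity)]; nlinarith
    calc (Sa + Sb + SF * degreeBound n s) * (2 * degreeBound n s + 2)
        ≤ (N / n + N / n + N * (2 * s / (n * (n - s))) * degreeBound n s) *
          (2 * degreeBound n s + 2) := by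
          rw [ha', hb']
          refine mul_le_mul_of_nonneg_right ?_ (by linarith [hR s])
          linarith [mul_le_mul_of_nonneg_right hF' (hR s)]
      _ = N * (2 / n * (2 * degreeBound n s + 2) +
          2 * s / (n * (n - s)) * degreeBound n s * (2 * degreeBound n s + 2)) := by ring
      _ ≤ _ := mul_le_mul_of_nonneg_left
          (add_le_add (trigger_term_le s.2) (spread_term_le s.2)) hN0
  have hmainsum : ∑ s, ∑ π : Equiv.Perm (Fin n), main π s ≤
      N * (96 * L * L + 1152 * L ^ 2 * (L + L)) := by
    refine (sum_le_sum fun s _ => hsum s).trans ?_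
    rw [← mul_sum, sum_add_distrib, ← mul_sum, ← mul_sum, sum_add_distrib]
    have h1 := sum_inv_succ_le n
    have h2 := sum_inv_sub_le n
    gcongr
  have hbadsum : ∀ H, ∑ π, bad H π * (4 * (n : ℝ) ^ 2) ≤ N * 4 := by
    intro H
    rw [← sum_mul]
    refine (mul_le_mul_of_nonneg_right (sum_not_lowDegree_le H hn) (by positivity)).trans ?_
    rw [mul_assoc]
    refine mul_le_mul_of_nonneg_left ?_ hN0
    have : (n : ℝ) * n * (1 / (n : ℝ) ^ 6) * (4 * n ^ 2) = 4 / n ^ 2 := by field_simp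
    rw [this, div_le_iff₀ (by positivity)]
    nlinarith
  have hb1 := hbadsum G
  have hb2 := hbadsum G'
  rw [← sum_mul] at hb1 hb2
  have hL3 : 96 * L * L + 1152 * L ^ 2 * (L + L) + 8 ≤ 2408 * L ^ 3 := by
    have h2 : 1 ≤ L ^ 2 := one_le_pow₀ hL
    have h3 : L ^ 2 ≤ L ^ 3 := pow_le_pow_right₀ hL (by norm_num)
    nlinarith
  have := mul_le_mul_of_nonneg_left hL3 hN0
  rw [add_mul]
  linarith

end Expectation

end DynamicMIS

/-! ### Runs of the algorithm -/

namespace DynamicMIS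
open WordRAM

section Run
variable {n w h : ℕ} {G G' : SimpleGraph (Fin n)} {π : Equiv.Perm (Fin n)} {s : State} {lo : ℕ}

theorem announced_spec (F : Fits w n h) {u v : Fin n} (huv : u ≠ v) {c : Bool}
    (hc : G.Adj u v ↔ c = false) (R : ∃ lo, Full h π G (elimRank G π) ∅ lo s) :
    RunsWithin w updateProg (((s.setReg 1 (if c then 1 else 0)).setReg 2 u).setReg 3 v)
      (1000 * (h + 1) * (repairCost G (setAdj G u v c) π 0 + 1)) fun s' =>
        ∃ lo, Full h π (setAdj G u v c) (elimRank (setAdj G u v c) π) ∅ lo s' := by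
  obtain ⟨lo, R⟩ := R
  refine RunsWithin.mono (updateProg_spec F huv hc (R.congr ⟨?_, ?_, ?_⟩) ?_ ?_ ?_) le_rfl
    fun s' h => h.1
  all_goals simp [State.setReg]

theorem update_step (F : Fits w n h) {τ : EdgeUpdate n} (hτ : τ.Step G G')
    (R : ∃ lo, Full h π G (elimRank G π) ∅ lo s) :
    RunsWithin w updateProg (announce s τ) (1000 * (h + 1) * (repairCost G G' π 0 + 1)) fun s' =>
      ∃ lo, Full h π G' (elimRank G' π) ∅ lo s' := by
  cases τ with
  | insert u v =>
    obtain ⟨huv, hadj, rfl⟩ := hτ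
    exact announced_spec F huv (c := true) (by simpa using hadj) R
  | delete u v =>
    obtain ⟨hadj, rfl⟩ := hτ
    exact announced_spec F hadj.ne (c := false) (by simpa using hadj) R

theorem exists_toggle {τ : EdgeUpdate n} (hτ : τ.Step G G') :
    ∃ a b : Fin n, a ≠ b ∧ Toggle G G' a b := by
  cases τ with
  | insert u v =>
    obtain ⟨huv, hadj, rfl⟩ := hτ
    exact ⟨u, v, huv, toggle_setAdj (c := true) huv (by simpa using hadj)⟩
  | delete u v =>
    obtain ⟨hadj, rfl⟩ := hτ
    exact ⟨u, v, hadj.ne, toggle_setAdj (c := false) hadj.ne (by simpa using hadj)⟩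

theorem stores_of_full (R : ∃ lo, Full h π G (elimRank G π) ∅ lo s) :
    Stores s (greedyMIS G π) := by
  obtain ⟨lo, R⟩ := R
  intro v
  rw [R.marks v]
  exact if_congr (mem_greedyMIS G π).symm rfl rfl

end Run

/-- Runs one after the other, while the invariant `P` holds. -/
theorem exists_sequence {α : Type*} (P : ℕ → α → Prop) (r : ℕ → α → ℕ → α → Prop) {m : ℕ} {s₀ : α}
    (h₀ : P 0 s₀) (h : ∀ i < m, ∀ s, P i s → ∃ t s', r i s t s' ∧ P (i + 1) s') :
    ∃ (s : ℕ → α) (t : ℕ → ℕ), s 0 = s₀ ∧ (∀ i ≤ m, P i (s i)) ∧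
      ∀ i < m, r i (s i) (t i) (s (i + 1)) := by
  have : Nonempty α := ⟨s₀⟩
  choose! f g hr hP using h
  set s : ℕ → α := fun i => Nat.rec s₀ g i with hs
  have key : ∀ i ≤ m, P i (s i) := by
    intro i hi
    induction i with
    | zero => exact h₀
    | succ i ih => exact hP i hi _ (ih (by omega))
  exact ⟨s, fun i => f i (s i), rfl, key, fun i hi => hr i hi _ (key i hi.le)⟩

theorem preprocess_time_le (n : ℕ) :
    20 * treeHeight n + 30 * n +
      (1000 * (treeHeight n + 1) * (n * (n + n + 2) + 1) + 50) * (n * n) + 100 ≤ (n + 2) ^ 22 := by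
  have h1 : treeHeight n + 1 ≤ 2 * (n * n) + 1 := Nat.lt_two_pow_self.trans_le (two_pow_treeHeight_le n)
  set h := treeHeight n
  set m := n + 2 with hm
  have hm2 : 2 ≤ m := by omega
  have two : ∀ k, 2 ^ k ≤ m ^ k := fun k => Nat.pow_le_pow_left hm2 k
  have h10 := two 10
  have h6 := two 6
  norm_num at h10 h6
  have a1 : h + 1 ≤ m ^ 3 := by
    calc h + 1 ≤ 2 * (m * m) := by rw [hm]; nlinarith
      _ ≤ m * (m * m) := Nat.mul_le_mul_right _ hm2
      _ = m ^ 3 := by ring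
  have a2 : n * (n + n + 2) + 1 ≤ m ^ 3 := by
    calc n * (n + n + 2) + 1 ≤ 2 * (m * m) := by rw [hm]; nlinarith
      _ ≤ m * (m * m) := Nat.mul_le_mul_right _ hm2
      _ = m ^ 3 := by ring
  have a3 : n * n ≤ m ^ 2 := by rw [sq]; exact Nat.mul_le_mul (by omega) (by omega)
  have a4 : n ≤ m ^ 3 := le_trans (by omega) (Nat.le_self_pow (by norm_num) m)
  have a5 : (1000 * (h + 1) * (n * (n + n + 2) + 1) + 50) * (n * n) ≤ m ^ 19 := by
    calc (1000 * (h + 1) * (n * (n + n + 2) + 1) + 50) * (n * n)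
        ≤ (m ^ 10 * m ^ 3 * m ^ 3 + m ^ 6) * m ^ 2 := by gcongr <;> omega
      _ ≤ (m ^ 16 + m ^ 16) * m ^ 2 := by
          gcongr
          · exact le_of_eq (by ring)
          · omega
          · norm_num
      _ = 2 * m ^ 18 := by ring
      _ ≤ m * m ^ 18 := Nat.mul_le_mul_right _ hm2
      _ = m ^ 19 := by ring
  have a6 : 20 * h + 30 * n + 100 ≤ m ^ 19 := by
    have : 20 * h + 30 * n + 100 ≤ 256 * m ^ 3 := by
      have := two 3
      norm_num at this
      omega
    calc 20 * h + 30 * n + 100 ≤ 256 * m ^ 3 := this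
      _ ≤ m ^ 10 * m ^ 3 := Nat.mul_le_mul_right _ (by omega)
      _ = m ^ 13 := by ring
      _ ≤ m ^ 19 := Nat.pow_le_pow_right (by omega) (by norm_num)
  calc _ ≤ 2 * m ^ 19 := by omega
    _ ≤ m ^ 3 * m ^ 19 := Nat.mul_le_mul_right _ (by have := two 3; norm_num at this; omega)
    _ = m ^ 22 := by ring

theorem treeHeight_add_one_le {n : ℕ} (hn : 2 ≤ n) : (treeHeight n + 1 : ℝ) ≤ 8 * Real.log n := by
  have hn' : (2 : ℝ) ≤ n := by exact_mod_cast hn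
  have h2 := Real.log_two_gt_d9
  have hlog : Real.log 2 ≤ Real.log n := Real.log_le_log (by norm_num) hn'
  have h1 : (2 : ℝ) ^ treeHeight n ≤ n ^ 4 := by
    have : 2 ^ treeHeight n ≤ n ^ 4 := (two_pow_treeHeight_le n).trans (by nlinarith [sq_nonneg n, Nat.mul_le_mul hn hn])
    exact_mod_cast this
  have h3 := Real.log_le_log (by positivity) h1
  rw [Real.log_pow, Real.log_pow] at h3
  push_cast at h3
  have h4 := Nat.cast_nonneg (α := ℝ) (treeHeight n)
  nlinarith

/-- The constant is `1000 * 8 * 65020`: the cost of a unit of work on the trees, the height of the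
trees divided by `log n`, and `2408 * 3 ^ 3 + 4`, since `1 + log n ≤ 3 * log n` and
`1 ≤ 4 * (log n) ^ 3` for `n ≥ 2`. -/
theorem expected_time_le {n : ℕ} {G G' : SimpleGraph (Fin n)} {a b : Fin n} (T : Toggle G G' a b)
    (hab : a ≠ b) (t : Equiv.Perm (Fin n) → ℕ)
    (ht : ∀ π, t π ≤ 1000 * (treeHeight n + 1) * (repairCost G G' π 0 + 1)) :
    Finset.expect Finset.univ (fun π => (t π : ℝ)) ≤ 8000 * 65020 * Real.log n ^ 4 := by
  have hn : 2 ≤ n := by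
    have := a.2; have := b.2
    have : (a : ℕ) ≠ b := fun e => hab (Fin.ext e)
    omega
  -- two distinct vertices exist, so that `log n` is bounded away from `0` and absorbs constants
  have hlog : 2 / 3 ≤ Real.log n := by
    have h2 := Real.log_two_gt_d9
    have : Real.log 2 ≤ Real.log n := Real.log_le_log (by norm_num) (by exact_mod_cast hn)
    linarith
  have hh := treeHeight_add_one_le hn
  have hcost := sum_repairCost_le T hab
  set ℓ := Real.log n
  set N : ℝ := ((Fintype.card (Equiv.Perm (Fin n)) : ℕ) : ℝ) with hN
  have hN0 : 0 < N := by rw [hN]; exact_mod_cast Fintype.card_pos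
  rw [Fintype.expect_eq_sum_div_card, div_le_iff₀ hN0]
  have h1 : ∑ π, (t π : ℝ) ≤ ∑ π, 1000 * (treeHeight n + 1 : ℝ) * (repairCost G G' π 0 + 1) :=
    Finset.sum_le_sum fun π _ => by exact_mod_cast ht π
  have h2 : ∑ π : Equiv.Perm (Fin n), ((repairCost G G' π 0 : ℝ) + 1) ≤ N * (65020 * ℓ ^ 3) := by
    rw [Finset.sum_add_distrib]
    have h3 : 1 + ℓ ≤ 3 * ℓ := by linarith
    have h4 : (1 + ℓ) ^ 3 ≤ (3 * ℓ) ^ 3 := pow_le_pow_left₀ (by linarith) h3 3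
    have h5 : (2 / 3 : ℝ) ^ 3 ≤ ℓ ^ 3 := pow_le_pow_left₀ (by norm_num) hlog 3
    have h6 : 2408 * (1 + ℓ) ^ 3 + 1 ≤ 65020 * ℓ ^ 3 := by
      rw [mul_pow] at h4
      norm_num at h4 h5 ⊢
      linarith
    have h7 : ∑ π : Equiv.Perm (Fin n), (1 : ℝ) = N := by simp [hN]
    rw [h7]
    linarith [mul_le_mul_of_nonneg_left h6 hN0.le]
  rw [← Finset.mul_sum] at h1
  calc _ ≤ _ := h1
    _ ≤ 1000 * (8 * ℓ) * (N * (65020 * ℓ ^ 3)) := by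
        have : 0 ≤ ∑ π : Equiv.Perm (Fin n), ((repairCost G G' π 0 : ℝ) + 1) :=
          Finset.sum_nonneg fun π _ => by positivity
        gcongr
    _ = _ := by ring

end DynamicMIS

theorem theorem1 :
    ∃ (A : DynamicMIS.Algorithm) (c d : ℕ) (C : ℝ),
      ∀ (n w : ℕ), (n + 2) ^ c ≤ 2 ^ w →
      ∀ (m : ℕ) (G : ℕ → SimpleGraph (Fin n)) (σ : ℕ → DynamicMIS.EdgeUpdate n),
        (∀ i < m, (σ i).Step (G i) (G (i + 1))) →
        ∃ (s : Equiv.Perm (Fin n) → ℕ → WordRAM.State) (t₀ : Equiv.Perm (Fin n) → ℕ)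
          (t : Equiv.Perm (Fin n) → ℕ → ℕ),
          (∀ π, WordRAM.Exec w A.preprocess (DynamicMIS.inputState (G 0) π) (t₀ π) (s π 0) ∧
            t₀ π ≤ (n + 2) ^ d) ∧
          (∀ π, ∀ i < m,
            WordRAM.Exec w A.update (DynamicMIS.announce (s π i) (σ i)) (t π i) (s π (i + 1))) ∧
          (∀ π, ∀ i ≤ m, DynamicMIS.Stores (s π i) (DynamicMIS.greedyMIS (G i) π)) ∧
          (∀ i < m, Finset.expect Finset.univ (fun π => (t π i : ℝ)) ≤ C * Real.log n ^ 4) := by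
  open DynamicMIS in
  -- `4`: the words address the segment trees; `22`: see `preprocess_time_le`
  refine ⟨⟨preprocessProg, updateProg⟩, 4, 22, 8000 * 65020, fun n w hw m G σ hσ => ?_⟩
  have F := fits_treeHeight hw
  have run : ∀ π : Equiv.Perm (Fin n), ∃ (s : ℕ → WordRAM.State) (t₀ : ℕ) (t : ℕ → ℕ),
      (WordRAM.Exec w preprocessProg (inputState (G 0) π) t₀ (s 0) ∧ t₀ ≤ (n + 2) ^ 22) ∧
      (∀ i ≤ m, ∃ lo, Full (treeHeight n) π (G i) (elimRank (G i) π) ∅ lo (s i)) ∧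
      ∀ i < m, WordRAM.Exec w updateProg (announce (s i) (σ i)) (t i) (s (i + 1)) ∧
        t i ≤ 1000 * (treeHeight n + 1) * (repairCost (G i) (G (i + 1)) π 0 + 1) := by
    intro π
    obtain ⟨t₀, s₀, h₀, ht₀, R₀⟩ := preprocess_spec (G := G 0) (π := π) F
    obtain ⟨s, t, rfl, hR, ht⟩ := exists_sequence
      (fun i s => ∃ lo, Full (treeHeight n) π (G i) (elimRank (G i) π) ∅ lo s)
      (fun i s t s' => WordRAM.Exec w updateProg (announce s (σ i)) t s' ∧
        t ≤ 1000 * (treeHeight n + 1) * (repairCost (G i) (G (i + 1)) π 0 + 1)) (m := m) R₀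
      fun i hi s R => by
        obtain ⟨t, s', h1, h2, h3⟩ := update_step F (hσ i hi) R
        exact ⟨t, s', ⟨h1, h2⟩, h3⟩
    exact ⟨s, t₀, t, ⟨h₀, ht₀.trans (preprocess_time_le n)⟩, hR, ht⟩
  choose s t₀ t h₀ hR ht using run
  refine ⟨s, t₀, t, h₀, fun π i hi => (ht π i hi).1, fun π i hi => stores_of_full (hR π i hi),
    fun i hi => ?_⟩
  obtain ⟨a, b, hab, T⟩ := exists_toggle (hσ i hi)
  exact expected_time_le T hab _ fun π => (ht π i hi).2
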